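/- **Setting.** Let $d\ge 1$. Let $\mathcal K=(K^r)_{r\in\mathbb R}$ be a function which takes a finite multiset $S$ of points of $\mathbb R^d$ (repeated points count as distinct vertices) to a filtration of simplicial complexes $K^r(S)$ with vertices in $S$, so $K^r(S)\subseteq K^t(S)$ for $r\le t$. Assume that (D2) for every $r\in\mathbb R$ there is $\phi(r)<\infty$ such that for every finite multiset $S$ and every $z\in\mathbb R^d$, every simplex $\sigma\in K^r(S\cup\{z\})\,\triangle\,K^r(S)$ lies in the closed Euclidean ball of radius $\phi(r)$ around $z$. For an integer $q\ge 0$ and $\vec r=(r_1,\dots,r_k)\in\mathbb R^k$ let $\psi(S)=\chi_q^{\vec r}(S)=\Big(\sum_{j=0}^q(-1)^j\,\#K^{r_i}_j(S)\Big)_{i=1}^k$, where $K_j$ is the set of simplices of $K$ with $j+1$ vertices; $\psi$ is assumed to be measurable. Let $2q+3<p\le\infty$, let $F$ be a probability distribution on $\mathbb R^d$ with density $f$, $\|f\|_p<\infty$, let $X_1,X_2,\dots$ be iid with law $F$, and $\mathbf X_n=\{X_1,\dots,X_n\}$. For each $n$ let $\hat F_n$ be an estimator, that is, a probability distribution which depends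 measurably on the sample $(X_1,\dots,X_n)$, with density $\hat f_n$, such that $\|\hat f_n-f\|_1\to0$ and $\|\hat f_n-f\|_p\to 0$ in probability (resp. almost surely). Let $m_n\in\mathbb N$ with $m_n\to\infty$, let $\mathbf X^*_{m_n}$ consist of $m_n$ points which, conditionally on $\mathbf X_n$, are iid with law $\hat F_n$, and let $G$ be a probability distribution on $\mathbb R^k$. Consider $$\text{(A)}\quad \tfrac1{\sqrt n}\Big(\psi(\sqrt[d]{n}\,\mathbf X_n)-\mathbb E\,\psi(\sqrt[d]{n}\,\mathbf X_n)\Big)\overset{d}{\to}G\quad (n\to\infty),$$ $$\text{(B)}\quad \tfrac1{\sqrt{m_n}}\Big(\psi(\sqrt[d]{m_n}\,\mathbf X^*_{m_n})-\mathbb E\big[\psi(\sqrt[d]{m_n}\,\mathbf X^*_{m_n})\,\big|\,\mathbf X_n\big]\Big)\overset{d}{\to}G\ \text{ in probability (resp. a.s.)},$$ where (B) means weak convergence to $G$, in probability (resp. almost surely), of the conditional law given $\mathbf X_n$. Let (A$_m$) denote the convergence in (A) along the sample sizes $m_n$, that is, $$\text{(A}_m\text{)}\quad \tfrac1{\sqrt{m_n}}\Big(\psi(\sqrt[d]{m_n}\,\mathbf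 X_{m_n})-\mathbb E\,\psi(\sqrt[d]{m_n}\,\mathbf X_{m_n})\Big)\overset{d}{\to}G\quad(n\to\infty).$$ **Statement.** In either version (in probability, or almost surely) the following holds. 1. (A) implies (B). 2. If $\min_n|m_n/N-1|\to0$ as $N\to\infty$ (for example if $m_n=n$, or more generally if $m_{n+1}/m_n\to1$), then (B) implies (A), so that (A) holds if and only if (B) holds. 3. For every $m_n\to\infty$, (A$_m$) holds if and only if (B) holds. -/

import Mathlib

open MeasureTheory ProbabilityTheory Filter Topology
open scoped ENNReal BoundedContinuousFunction

noncomputable section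

/-- `ℝ^d` with its Euclidean norm and Lebesgue measure. -/
abbrev Euc (d : ℕ) : Type := EuclideanSpace ℝ (Fin d)

/-! ### Filtrations of simplicial complexes over finite point multisets -/

open Classical in
/-- The vertex set of a finite multiset `S` of points. Repeated points are distinct vertices: a point
`x` of multiplicity `c` contributes the vertices `(x, 0), …, (x, c - 1)`. -/
def vertexSet {d : ℕ} (S : Multiset (Euc d)) : Finset (Euc d × ℕ) := S.toEnumFinset

/-- A function which takes a finite multiset `S` of points of `ℝ^d` to a filtration `(K^r(S))`,
`r ∈ ℝ`, of simplicial complexes with vertices in `S`. (Faces are nonempty, and not every point of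
`S` has to be a vertex of the complex.) -/
structure ComplexFiltration (d : ℕ) where
  /-- the complex `K^r(S)` -/
  cplx : ℝ → Multiset (Euc d) → PreAbstractSimplicialComplex (Euc d × ℕ)
  /-- every simplex of `K^r(S)` has its vertices in `S` -/
  subset_vertexSet : ∀ (r : ℝ) (S : Multiset (Euc d)), ∀ σ ∈ (cplx r S).faces, σ ⊆ vertexSet S
  /-- `K^r(S) ⊆ K^t(S)` for `r ≤ t` -/
  mono : ∀ (r t : ℝ) (S : Multiset (Euc d)), r ≤ t → (cplx r S).faces ⊆ (cplx t S).faces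

/-- Locality: at each level `r` there is a radius `φ = φ(r) < ∞` such that, for all `S` and `z`, each
simplex in the symmetric difference of `K^r(S ∪ {z})` and `K^r(S)` lies in the closed ball of radius
`φ` around `z`. Here `S ∪ {z}` is `z ::ₘ S`, which raises the multiplicity of `z` by one. -/
def ComplexFiltration.IsLocalBall {d : ℕ} (K : ComplexFiltration d) : Prop :=
  ∀ r : ℝ, ∃ φ : ℝ, ∀ (S : Multiset (Euc d)) (z : Euc d),
    ∀ σ ∈ symmDiff (K.cplx r (z ::ₘ S)).faces (K.cplx r S).faces,
      ∀ v ∈ σ, v.1 ∈ Metric.closedBall z φ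

/-- The `q`-truncated Euler characteristic `∑_{k=0}^q (-1)^k #K_k`, where `K_k` is the set of
simplices with `k + 1` vertices. -/
def truncEuler {V : Type*} (q : ℕ) (K : PreAbstractSimplicialComplex V) : ℝ :=
  ∑ k ∈ Finset.range (q + 1), (-1 : ℝ) ^ k * (Set.ncard {σ | σ ∈ K.faces ∧ σ.card = k + 1} : ℝ)

/-- The vector `χ_q^{r⃗}` of the `q`-truncated Euler characteristics at the levels `r₁, …, r_k`. -/
def ComplexFiltration.eulerVector {d : ℕ} (K : ComplexFiltration d) (q : ℕ) {k : ℕ}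
    (r : Fin k → ℝ) (S : Multiset (Euc d)) : Fin k → ℝ :=
  fun i => truncEuler q (K.cplx (r i) S)

/-! ### Statistics of samples -/

/-- The multiset `{x₁, …, x_n}`. -/
def pointMultiset {d n : ℕ} (x : Fin n → Euc d) : Multiset (Euc d) :=
  (Finset.univ : Finset (Fin n)).val.map x

/-- Measurability of a function of finite point multisets: on multisets with `n` points it is a
measurable function of the `n` points, for each `n`. -/
def MeasurableStatistic {d k : ℕ} (ψ : Multiset (Euc d) → Fin k → ℝ) : Prop :=
  ∀ n : ℕ, Measurable fun x : Fin n → Euc d => ψ (pointMultiset x)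

/-- `ψ(n^{1/d} {x₁, …, x_n})`. -/
def scaledStatistic {d k : ℕ} (ψ : Multiset (Euc d) → Fin k → ℝ) (n : ℕ)
    (x : Fin n → Euc d) : Fin k → ℝ :=
  ψ (pointMultiset fun i => (n : ℝ) ^ (1 / (d : ℝ)) • x i)

/-- The law of `n^{-1/2} (ψ(n^{1/d} Y_n) - E ψ(n^{1/d} Y_n))`, where `Y_n` consists of `n` independent
points with common law `Q`. -/
def standardizedLaw {d k : ℕ} (ψ : Multiset (Euc d) → Fin k → ℝ) (n : ℕ)
    (Q : Measure (Euc d)) : Measure (Fin k → ℝ) :=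
  (Measure.pi fun _ : Fin n => Q).map fun x =>
    (Real.sqrt n)⁻¹ •
      (scaledStatistic ψ n x - ∫ y, scaledStatistic ψ n y ∂(Measure.pi fun _ : Fin n => Q))

/-- `g` is a Lebesgue density of the measure `Q`. -/
def HasLebesgueDensity {d : ℕ} (Q : Measure (Euc d)) (g : Euc d → ℝ) : Prop :=
  Measurable g ∧ (∀ x, 0 ≤ g x) ∧ Q = volume.withDensity fun x => ENNReal.ofReal (g x)

/-! ### Modes of convergence -/

/-- Weak convergence of the laws `L n` to `G`. -/
def WeakConv {k : ℕ} (L : ℕ → Measure (Fin k → ℝ)) (G : Measure (Fin k → ℝ)) : Prop :=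
  ∀ v : (Fin k → ℝ) →ᵇ ℝ, Tendsto (fun n => ∫ y, v y ∂(L n)) atTop (𝓝 (∫ y, v y ∂G))

/-- Weak convergence in probability of random laws `L n ω` to the fixed law `G`. -/
def WeakConvInProb {Ω : Type*} [MeasurableSpace Ω] (P : Measure Ω) {k : ℕ}
    (L : ℕ → Ω → Measure (Fin k → ℝ)) (G : Measure (Fin k → ℝ)) : Prop :=
  ∀ v : (Fin k → ℝ) →ᵇ ℝ,
    TendstoInMeasure P (fun n ω => ∫ y, v y ∂(L n ω)) atTop (fun _ => ∫ y, v y ∂G)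

/-- Almost sure weak convergence of random laws `L n ω` to the fixed law `G`. -/
def WeakConvAS {Ω : Type*} [MeasurableSpace Ω] (P : Measure Ω) {k : ℕ}
    (L : ℕ → Ω → Measure (Fin k → ℝ)) (G : Measure (Fin k → ℝ)) : Prop :=
  ∀ᵐ ω ∂P, WeakConv (fun n => L n ω) G

/-- Convergence to `0` in probability of `[0, ∞]`-valued quantities. -/
def ZeroInProb {Ω : Type*} [MeasurableSpace Ω] (P : Measure Ω) (N : ℕ → Ω → ℝ≥0∞) : Prop :=
  ∀ ε : ℝ≥0∞, 0 < ε → Tendsto (fun n => P {ω | ε ≤ N n ω}) atTop (𝓝 0)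

/-- Almost sure convergence to `0` of `[0, ∞]`-valued quantities. -/
def ZeroAS {Ω : Type*} [MeasurableSpace Ω] (P : Measure Ω) (N : ℕ → Ω → ℝ≥0∞) : Prop :=
  ∀ᵐ ω ∂P, Tendsto (fun n => N n ω) atTop (𝓝 0)

/-- The sequence `m` has no multiplicative gaps in the limit: `min_n |m_n / N - 1| → 0` as `N → ∞`.
This holds, for example, for `m_n = n`, and whenever `m_n → ∞` and `m_{n+1} / m_n → 1`. -/
def NoAsymptoticGaps (m : ℕ → ℕ) : Prop :=
  ∀ ε : ℝ, 0 < ε → ∀ᶠ N : ℕ in atTop, ∃ n : ℕ, |(m n : ℝ) - (N : ℝ)| ≤ ε * (N : ℝ)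

end

/-! ### Local statistics of finite multisets -/

/-! The core is a comparison that is deterministic in the sample: for a fixed bounded Lipschitz test
function, the standardized laws of `m n` points under `F` and under the estimate give close
integrals as soon as the two densities are close in `L^1` and in `L^p` and `m n > 0`
(`lipschitzClose_standardizedLaw`). This yields the equivalence of (A_m) and (B) in both modes of
convergence. (A) implies (A_m) because `m n → ∞`; the converse, when `m` has no gaps, needs
continuity of the standardized law in the sample size.

For the comparison, note that a new point changes only simplices near it. Hence its effect on `ψ`
has degree `q + 1` in the number of neighbours and ignores distant points
(`ComplexFiltration.isLocalStatistic`). Couple the two samples pointwise by the maximal coupling of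
`f` and `g`. By Efron–Stein, the variance of the difference of the two statistics is at most a sum
over `i` of second moments of differences of two add-one costs. Such a difference vanishes unless
the samples differ near the `i`-th point. At scale `n^{1/d}` the relevant balls have volume of order
`1/n`, so after truncating `f` at a level `K` the exceptional event has small probability
(`measure_differsNear_le`).

On that event the squared costs, of degree `2 q + 2`, are controlled by uniform integrability: the
neighbour counts have bounded moments of some order `τ > 2 q + 2` (`exists_moment_bound`). Since the
centre of the ball is itself a sample point, order `τ` costs the integral of `f ^ (τ + 1)`; this is
the origin of `p > 2 q + 3`. The variance is therefore a small multiple of `n`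
(`exists_variance_sub_le`), and division by `√n` makes the centred statistics close in `L^2`.

A change of sample size consists of dropping a small proportion of the points, which the same
variance bound covers, and of a change of scale, which is a dilation of the density and is
continuous in `L^1` (`exists_integral_standardizedLaw_sub_le`). -/

/-- A real statistic of finite multisets whose add-one cost at `z` has range `R`: it grows at most
polynomially in the number of points within distance `R` of `z`, and it is not changed by a point
at a distance larger than `R` from `z`. -/
structure IsLocalStatistic {E : Type*} [PseudoMetricSpace E] (a R : ℝ) (q : ℕ)
    (ψ : Multiset E → ℝ) : Prop where
  abs_sub_le : ∀ (S : Multiset E) (z : E),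
    |ψ (z ::ₘ S) - ψ S| ≤ a * (1 + ((S.filter fun x => dist x z ≤ R).card : ℝ)) ^ (q + 1)
  sub_eq : ∀ (S : Multiset E) (w z : E), R < dist w z →
    ψ (z ::ₘ w ::ₘ S) - ψ (w ::ₘ S) = ψ (z ::ₘ S) - ψ S

namespace IsLocalStatistic

variable {E : Type*} [PseudoMetricSpace E] {a R : ℝ} {q : ℕ} {ψ : Multiset E → ℝ}

theorem nonneg (h : IsLocalStatistic a R q ψ) (z : E) : 0 ≤ a := by
  have h1 := (abs_nonneg _).trans (h.abs_sub_le 0 z)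
  simpa using h1

theorem sub_eq_of_far (h : IsLocalStatistic a R q ψ) (z : E) (A B : Multiset E)
    (hA : ∀ w ∈ A, R < dist w z) :
    ψ (z ::ₘ (A + B)) - ψ (A + B) = ψ (z ::ₘ B) - ψ B := by
  induction A using Multiset.induction_on with
  | empty => simp
  | cons w A ih =>
    rw [Multiset.cons_add, h.sub_eq _ _ _ (hA w (Multiset.mem_cons_self w A))]
    exact ih fun v hv => hA v (Multiset.mem_cons_of_mem hv)

/-- Far points can be removed one at a time, so the add-one cost is a function of the neighbours
alone. This is what lets two samples that agree near `z` be compared. -/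
theorem sub_eq_filter (h : IsLocalStatistic a R q ψ) (z : E) (S : Multiset E) :
    ψ (z ::ₘ S) - ψ S = ψ (z ::ₘ S.filter fun x => dist x z ≤ R) -
      ψ (S.filter fun x => dist x z ≤ R) := by
  have h1 := h.sub_eq_of_far z (S.filter fun x => ¬ dist x z ≤ R)
    (S.filter fun x => dist x z ≤ R) (fun w hw => not_le.1 (Multiset.mem_filter.1 hw).2)
  rwa [add_comm, Multiset.filter_add_not] at h1

theorem sub_congr (h : IsLocalStatistic a R q ψ) (z : E) {S S' : Multiset E}
    (hS : (S.filter fun x => dist x z ≤ R) = S'.filter fun x => dist x z ≤ R) :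
    ψ (z ::ₘ S) - ψ S = ψ (z ::ₘ S') - ψ S' := by
  rw [h.sub_eq_filter, h.sub_eq_filter z S', hS]

theorem abs_sub_zero_le (h : IsLocalStatistic a R q ψ) (S : Multiset E) :
    |ψ S - ψ 0| ≤ S.card * (a * (1 + (S.card : ℝ)) ^ (q + 1)) := by
  induction S using Multiset.induction_on with
  | empty => simp
  | cons z S ih =>
    have ha := h.nonneg z
    have h1 : a * (1 + ((S.filter fun x => dist x z ≤ R).card : ℝ)) ^ (q + 1) ≤
        a * (1 + ((z ::ₘ S).card : ℝ)) ^ (q + 1) := by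
      have : (S.filter fun x => dist x z ≤ R).card ≤ (z ::ₘ S).card :=
        (Multiset.card_le_card (Multiset.filter_le _ _)).trans (by simp)
      gcongr
    have h2 : (S.card : ℝ) * (a * (1 + (S.card : ℝ)) ^ (q + 1)) ≤
        S.card * (a * (1 + ((z ::ₘ S).card : ℝ)) ^ (q + 1)) := by
      have : S.card ≤ (z ::ₘ S).card := by simp
      gcongr
    have h3 := h.abs_sub_le S z
    calc |ψ (z ::ₘ S) - ψ 0| = |(ψ (z ::ₘ S) - ψ S) + (ψ S - ψ 0)| := by ring_nf
      _ ≤ |ψ (z ::ₘ S) - ψ S| + |ψ S - ψ 0| := abs_add_le _ _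
      _ ≤ a * (1 + ((z ::ₘ S).card : ℝ)) ^ (q + 1) +
          S.card * (a * (1 + ((z ::ₘ S).card : ℝ)) ^ (q + 1)) := by linarith
      _ = ((z ::ₘ S).card : ℝ) * (a * (1 + ((z ::ₘ S).card : ℝ)) ^ (q + 1)) := by
        have : ((z ::ₘ S).card : ℝ) = S.card + 1 := by simp
        rw [this]; ring

/-- On multisets with at most `n` points a local statistic is bounded. -/
theorem exists_bound (h : IsLocalStatistic a R q ψ) (n : ℕ) :
    ∃ C : ℝ, 0 ≤ C ∧ ∀ S : Multiset E, S.card ≤ n → |ψ S| ≤ C := by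
  rcases isEmpty_or_nonempty E with hE | ⟨⟨z⟩⟩
  · refine ⟨|ψ 0|, abs_nonneg _, fun S _ => ?_⟩
    have : S = 0 := Multiset.eq_zero_of_forall_notMem fun x => hE.elim x
    rw [this]
  · have ha := h.nonneg z
    refine ⟨|ψ 0| + n * (a * (1 + (n : ℝ)) ^ (q + 1)), by positivity, fun S hS => ?_⟩
    have h1 := h.abs_sub_zero_le S
    have h2 : (S.card : ℝ) * (a * (1 + (S.card : ℝ)) ^ (q + 1)) ≤
        n * (a * (1 + (n : ℝ)) ^ (q + 1)) := by gcongr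
    have h3 : |ψ S| ≤ |ψ S - ψ 0| + |ψ 0| := by
      simpa using abs_add_le (ψ S - ψ 0) (ψ 0)
    linarith

end IsLocalStatistic

/-- Absorbs the scale `n^{1/d}` into the range and leaves the constant `a` unchanged, so later
bounds can be uniform in `n`. -/
theorem IsLocalStatistic.comp_smul {E : Type*} [NormedAddCommGroup E] [NormedSpace ℝ E]
    {a R : ℝ} {q : ℕ} {ψ : Multiset E → ℝ} (h : IsLocalStatistic a R q ψ) {s : ℝ} (hs : 0 < s) :
    IsLocalStatistic a (R / s) q fun S => ψ (S.map fun x => s • x) := by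
  have hd : ∀ x z : E, dist (s • x) (s • z) ≤ R ↔ dist x z ≤ R / s := fun x z => by
    rw [dist_smul₀, Real.norm_of_nonneg hs.le, le_div_iff₀ hs, mul_comm]
  constructor
  · intro S z
    have := h.abs_sub_le (S.map fun x => s • x) (s • z)
    simp only [Multiset.map_cons]
    rw [Multiset.filter_map, Multiset.card_map] at this
    simpa only [Function.comp_def, hd] using this
  · intro S w z hwz
    simp only [Multiset.map_cons]
    refine h.sub_eq _ _ _ ?_
    rw [← not_le] at hwz ⊢
    rwa [hd]

/-! ### Truncated Euler characteristics are local statistics -/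

-- Writing the characteristic as a signed sum over subsets of an arbitrary ambient vertex set `W`
-- allows complexes on different multisets to be subtracted term by term.
open Classical in
theorem truncEuler_eq_sum {V : Type*} (q : ℕ) (K : PreAbstractSimplicialComplex V) (W : Finset V)
    (hW : ∀ σ ∈ K.faces, σ ⊆ W) :
    truncEuler q K = ∑ σ ∈ W.powerset with σ.card ≤ q + 1,
      (-1 : ℝ) ^ (σ.card - 1) * if σ ∈ K.faces then 1 else 0 := by
  have hne : ∀ σ ∈ K.faces, 0 < σ.card := fun σ hσ =>
    Finset.card_pos.2 (K.isRelLowerSet_faces hσ).1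
  have h1 : ∀ k ∈ Finset.range (q + 1),
      (-1 : ℝ) ^ k * (Set.ncard {σ | σ ∈ K.faces ∧ σ.card = k + 1} : ℝ) =
      ∑ σ ∈ {σ ∈ W.powerset | σ.card ≤ q + 1 ∧ σ ∈ K.faces} with σ.card - 1 = k,
        (-1 : ℝ) ^ (σ.card - 1) := by
    intro k hk
    rw [Finset.mem_range] at hk
    have : {σ | σ ∈ K.faces ∧ σ.card = k + 1} =
        (({σ ∈ W.powerset | σ.card ≤ q + 1 ∧ σ ∈ K.faces}.filter
          fun σ => σ.card - 1 = k : Finset (Finset V)) : Set (Finset V)) := by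
      ext σ
      simp only [Set.mem_ofPred_eq, Finset.coe_filter, Finset.mem_filter, Finset.mem_powerset]
      constructor
      · rintro ⟨h1, h2⟩
        exact ⟨⟨hW σ h1, by omega, h1⟩, by omega⟩
      · rintro ⟨⟨-, h2, h3⟩, h4⟩
        have := hne σ h3
        exact ⟨h3, by omega⟩
    rw [this, Set.ncard_coe_finset, Finset.sum_congr rfl (g := fun _ => (-1 : ℝ) ^ k)
      (fun σ hσ => by rw [(Finset.mem_filter.1 hσ).2]), Finset.sum_const, nsmul_eq_mul, mul_comm]
  rw [truncEuler, Finset.sum_congr rfl h1, Finset.sum_fiberwise_of_maps_to]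
  · simp only [mul_ite, mul_one, mul_zero]
    rw [← Finset.sum_filter, Finset.filter_filter]
  · intro σ hσ
    have h2 := (Finset.mem_filter.1 hσ).2
    rw [Finset.mem_range]
    omega

open Classical in
theorem card_filter_powerset_le {V : Type*} (W : Finset V) (q : ℕ) :
    ((W.powerset.filter fun σ => σ.Nonempty ∧ σ.card ≤ q + 1).card : ℝ) ≤
      (q + 1) * (max 1 (W.card : ℝ)) ^ (q + 1) := by
  have h1 : (W.powerset.filter fun σ => σ.Nonempty ∧ σ.card ≤ q + 1) ⊆
      (Finset.range (q + 1)).biUnion fun k => W.powersetCard (k + 1) := by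
    intro σ hσ
    obtain ⟨h1, h2, h3⟩ := Finset.mem_filter.1 hσ
    have := Finset.card_pos.2 h2
    simp only [Finset.mem_biUnion, Finset.mem_range, Finset.mem_powersetCard]
    exact ⟨σ.card - 1, by omega, Finset.mem_powerset.1 h1, by omega⟩
  have h2 := (Finset.card_le_card h1).trans Finset.card_biUnion_le
  have h3 : ∀ k ∈ Finset.range (q + 1),
      ((W.powersetCard (k + 1)).card : ℝ) ≤ (max 1 (W.card : ℝ)) ^ (q + 1) := by
    intro k hk
    rw [Finset.mem_range] at hk
    rw [Finset.card_powersetCard]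
    calc ((W.card.choose (k + 1) : ℕ) : ℝ) ≤ (W.card : ℝ) ^ (k + 1) := by
          exact_mod_cast Nat.choose_le_pow _ _
      _ ≤ (max 1 (W.card : ℝ)) ^ (k + 1) := by gcongr; exact le_max_right _ _
      _ ≤ _ := pow_le_pow_right₀ (le_max_left _ _) (by omega)
  calc _ ≤ ((∑ k ∈ Finset.range (q + 1), (W.powersetCard (k + 1)).card : ℕ) : ℝ) := by
        exact_mod_cast h2
    _ ≤ ∑ k ∈ Finset.range (q + 1), (max 1 (W.card : ℝ)) ^ (q + 1) := by
        rw [Nat.cast_sum]; exact Finset.sum_le_sum h3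
    _ = _ := by simp

open Classical in
theorem card_filter_vertexSet {d : ℕ} (S : Multiset (Euc d)) (p : Euc d → Prop) :
    ((vertexSet S).filter fun v => p v.1).card = (S.filter p).card := by
  conv_rhs => rw [← Multiset.map_toEnumFinset_fst S]
  rw [Multiset.filter_map, Multiset.card_map, Finset.card_def, Finset.filter_val]
  simp only [vertexSet, Function.comp_def]

theorem vertexSet_mono {d : ℕ} {S T : Multiset (Euc d)} (h : S ≤ T) :
    vertexSet S ⊆ vertexSet T := by
  classical
  exact Multiset.toEnumFinset_mono h

/-- The cost at `z` counts only simplices inside the `φ`-ball, hence subsets of size at most `q + 1`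
of the vertices within `R`. For the second property, a simplex affected by both `z` and `w` would
lie in two `φ`-balls, which are disjoint when the centres are more than `2 φ` apart. -/
theorem ComplexFiltration.isLocalStatistic {d : ℕ} (K : ComplexFiltration d) (q : ℕ) (r φ R : ℝ)
    (hφR : φ ≤ R) (hφR' : 2 * φ ≤ R)
    (hφ : ∀ (S : Multiset (Euc d)) (z : Euc d),
      ∀ σ ∈ symmDiff (K.cplx r (z ::ₘ S)).faces (K.cplx r S).faces,
        ∀ v ∈ σ, v.1 ∈ Metric.closedBall z φ) :
    IsLocalStatistic (q + 1) R q fun S => truncEuler q (K.cplx r S) := by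
  classical
  have hsum : ∀ S T : Multiset (Euc d), S ≤ T → truncEuler q (K.cplx r S) =
      ∑ σ ∈ (vertexSet T).powerset with σ.card ≤ q + 1,
        (-1 : ℝ) ^ (σ.card - 1) * if σ ∈ (K.cplx r S).faces then 1 else 0 := fun S T hST =>
    truncEuler_eq_sum q _ _ fun σ hσ =>
      (K.subset_vertexSet r S σ hσ).trans (vertexSet_mono hST)
  have hsd : ∀ (S : Multiset (Euc d)) (z : Euc d) (σ : Finset (Euc d × ℕ)),
      ¬ (∀ v ∈ σ, v.1 ∈ Metric.closedBall z φ) →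
      (σ ∈ (K.cplx r (z ::ₘ S)).faces ↔ σ ∈ (K.cplx r S).faces) := by
    intro S z σ hσ
    by_contra hcon
    refine hσ (hφ S z σ ?_)
    rw [Set.mem_symmDiff]
    tauto
  have hne : ∀ (S : Multiset (Euc d)), ∀ σ ∈ (K.cplx r S).faces, σ.Nonempty := fun S σ hσ =>
    ((K.cplx r S).isRelLowerSet_faces hσ).1
  constructor
  · intro S z
    have hle : S ≤ z ::ₘ S := Multiset.le_cons_self S z
    rw [hsum _ _ le_rfl, hsum _ _ hle, ← Finset.sum_sub_distrib]
    set W := (vertexSet (z ::ₘ S)).filter fun v => dist v.1 z ≤ R with hW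
    have hWc : (max 1 (W.card : ℝ)) ≤ 1 + ((S.filter fun x => dist x z ≤ R).card : ℝ) := by
      rw [hW, card_filter_vertexSet _ fun x => dist x z ≤ R, Multiset.filter_cons]
      have : ((if dist z z ≤ R then {z} else 0 : Multiset (Euc d)).card : ℝ) ≤ 1 := by
        split_ifs <;> simp
      rw [Multiset.card_add, Nat.cast_add]
      exact max_le (by simp) (by gcongr)
    have hterm : ∀ σ ∈ (vertexSet (z ::ₘ S)).powerset.filter fun σ => σ.card ≤ q + 1,
        |(-1 : ℝ) ^ (σ.card - 1) * (if σ ∈ (K.cplx r (z ::ₘ S)).faces then 1 else 0) -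
          (-1 : ℝ) ^ (σ.card - 1) * (if σ ∈ (K.cplx r S).faces then 1 else 0)| ≤
        if σ ⊆ W ∧ σ.Nonempty then 1 else 0 := by
      intro σ hσ
      have hσ' := Finset.mem_powerset.1 (Finset.mem_filter.1 hσ).1
      by_cases hb : ∀ v ∈ σ, v.1 ∈ Metric.closedBall z φ
      · have hsub : σ ⊆ W := fun v hv => Finset.mem_filter.2
          ⟨hσ' hv, (Metric.mem_closedBall.1 (hb v hv)).trans hφR⟩
        rw [← mul_sub, abs_mul, abs_pow, abs_neg, abs_one, one_pow, one_mul]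
        by_cases hn : σ.Nonempty
        · rw [if_pos (show σ ⊆ W ∧ σ.Nonempty from ⟨hsub, hn⟩)]
          split_ifs <;> simp
        · have h1 : σ ∉ (K.cplx r (z ::ₘ S)).faces := fun h => hn (hne _ σ h)
          have h2 : σ ∉ (K.cplx r S).faces := fun h => hn (hne _ σ h)
          simp [h1, h2, hn]
      · simp only [hsd S z σ hb, sub_self, abs_zero]
        split_ifs <;> simp
    calc _ ≤ ∑ σ ∈ (vertexSet (z ::ₘ S)).powerset with σ.card ≤ q + 1,
          (if σ ⊆ W ∧ σ.Nonempty then (1 : ℝ) else 0) :=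
          (Finset.abs_sum_le_sum_abs _ _).trans (Finset.sum_le_sum hterm)
      _ ≤ ((W.powerset.filter fun σ => σ.Nonempty ∧ σ.card ≤ q + 1).card : ℝ) := by
          rw [Finset.sum_boole, Finset.filter_filter]
          norm_cast
          refine Finset.card_le_card fun σ hσ => ?_
          simp only [Finset.mem_filter, Finset.mem_powerset] at hσ ⊢
          tauto
      _ ≤ (q + 1) * (max 1 (W.card : ℝ)) ^ (q + 1) := card_filter_powerset_le W q
      _ ≤ _ := by gcongr
  · intro S w z hwz
    have hle1 : S ≤ z ::ₘ w ::ₘ S :=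
      (Multiset.le_cons_self S w).trans (Multiset.le_cons_self _ z)
    have hle2 : w ::ₘ S ≤ z ::ₘ w ::ₘ S := Multiset.le_cons_self _ z
    have hle3 : z ::ₘ S ≤ z ::ₘ w ::ₘ S := Multiset.cons_le_cons z (Multiset.le_cons_self S w)
    rw [hsum _ _ le_rfl, hsum _ _ hle1, hsum _ _ hle2, hsum _ _ hle3, ← Finset.sum_sub_distrib,
      ← Finset.sum_sub_distrib]
    refine Finset.sum_congr rfl fun σ _ => ?_
    by_cases hbz : ∀ v ∈ σ, v.1 ∈ Metric.closedBall z φ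
    · by_cases hbw : ∀ v ∈ σ, v.1 ∈ Metric.closedBall w φ
      -- A vertex of `σ` would be within `φ` of both `z` and `w`, against `dist w z > R ≥ 2 φ`; and
      -- the empty set is never a face.
      · have hn : ¬ σ.Nonempty := by
          rintro ⟨v, hv⟩
          have h1 := Metric.mem_closedBall.1 (hbz v hv)
          have h2 := Metric.mem_closedBall.1 (hbw v hv)
          have h3 := dist_triangle_left w z v.1
          linarith
        have hnot : ∀ T, σ ∉ (K.cplx r T).faces := fun T h => hn (hne T σ h)
        simp [hnot]
      · have h1 := hsd (z ::ₘ S) w σ hbw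
        have h2 := hsd S w σ hbw
        rw [Multiset.cons_swap] at h1
        simp only [h1, h2]
    · simp only [hsd (w ::ₘ S) z σ hbz, hsd S z σ hbz, sub_self]

/-! ### The Efron–Stein inequality -/

theorem integrable_of_forall_abs_le {α : Type*} {_ : MeasurableSpace α} {μ : Measure α}
    [IsFiniteMeasure μ] {u : α → ℝ} (hu : Measurable u) {C : ℝ} (hC : ∀ x, |u x| ≤ C) :
    Integrable u μ :=
  Integrable.of_bound hu.aestronglyMeasurable C (ae_of_all _ hC)

theorem integrable_sq_of_forall_abs_le {α : Type*} {_ : MeasurableSpace α} {μ : Measure α}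
    [IsFiniteMeasure μ] {u : α → ℝ} (hu : Measurable u) {C : ℝ} (hC : ∀ x, |u x| ≤ C) :
    Integrable (fun x => u x ^ 2) μ :=
  integrable_of_forall_abs_le (hu.pow_const 2) (C := C ^ 2) fun x => by
    rw [abs_pow]; exact pow_le_pow_left₀ (abs_nonneg _) (hC x) 2

/-- The bias–variance identity: among all constants the mean minimizes the quadratic error. -/
theorem integral_sub_const_sq {α : Type*} {_ : MeasurableSpace α} {μ : Measure α}
    [IsProbabilityMeasure μ] {u : α → ℝ} (hu : Measurable u) {C : ℝ} (hC : ∀ x, |u x| ≤ C)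
    (c : ℝ) :
    ∫ x, (u x - c) ^ 2 ∂μ = ∫ x, (u x - ∫ y, u y ∂μ) ^ 2 ∂μ + (∫ y, u y ∂μ - c) ^ 2 := by
  have h1 := integrable_of_forall_abs_le (μ := μ) hu hC
  have h2 := integrable_sq_of_forall_abs_le (μ := μ) hu hC
  have key : ∀ b : ℝ, ∫ x, (u x - b) ^ 2 ∂μ =
      ∫ x, u x ^ 2 ∂μ - 2 * b * ∫ x, u x ∂μ + b ^ 2 := by
    intro b
    have : ∀ x, (u x - b) ^ 2 = u x ^ 2 - 2 * b * u x + b ^ 2 := fun x => by ring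
    simp_rw [this]
    have h3 : Integrable (fun x => 2 * b * u x) μ := h1.const_mul _
    have h4 : Integrable (fun x => u x ^ 2 - 2 * b * u x) μ := h2.sub h3
    rw [integral_add h4 (integrable_const _), integral_sub h2 h3, integral_const_mul]
    simp
  rw [key, key]
  ring

theorem sq_integral_le {α : Type*} {_ : MeasurableSpace α} {μ : Measure α}
    [IsProbabilityMeasure μ] {u : α → ℝ} (hu : Measurable u) {C : ℝ} (hC : ∀ x, |u x| ≤ C) :
    (∫ x, u x ∂μ) ^ 2 ≤ ∫ x, u x ^ 2 ∂μ := by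
  have h := integral_sub_const_sq (μ := μ) hu hC 0
  simp only [sub_zero] at h
  have : 0 ≤ ∫ x, (u x - ∫ y, u y ∂μ) ^ 2 ∂μ := integral_nonneg fun x => sq_nonneg _
  linarith

theorem abs_integral_le_of_forall {α : Type*} {_ : MeasurableSpace α} {μ : Measure α}
    [IsProbabilityMeasure μ] {u : α → ℝ} {C : ℝ} (hC : ∀ x, |u x| ≤ C) :
    |∫ x, u x ∂μ| ≤ C := by
  have := norm_integral_le_of_norm_le_const (μ := μ) (f := u) (C := C) (ae_of_all _ hC)
  simpa using this

theorem integral_pi_fin_succ {α : Type*} [MeasurableSpace α] (μ : Measure α)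
    [IsProbabilityMeasure μ] {n : ℕ} {u : (Fin (n + 1) → α) → ℝ} (hu : Measurable u) {C : ℝ}
    (hC : ∀ x, |u x| ≤ C) :
    ∫ x, u x ∂(Measure.pi fun _ => μ) =
      ∫ y, ∫ a, u (Fin.cons a y) ∂μ ∂(Measure.pi fun _ : Fin n => μ) := by
  have h := (measurePreserving_piFinSuccAbove (fun _ : Fin (n + 1) => μ) 0).symm
  rw [← h.integral_comp', integral_prod_symm]
  · simp [MeasurableEquiv.piFinSuccAbove_symm_apply, Fin.insertNthEquiv]
  · exact integrable_of_forall_abs_le (hu.comp (MeasurableEquiv.measurable _)) fun x => hC _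

/-- The Efron–Stein inequality for bounded functions of independent, identically distributed
variables: `g i` does not depend on the `i`-th variable. -/
theorem efronStein {α : Type*} [MeasurableSpace α] (μ : Measure α) [IsProbabilityMeasure μ]
    {C : ℝ} (n : ℕ) (f : (Fin n → α) → ℝ) (hf : Measurable f) (hfC : ∀ x, |f x| ≤ C)
    (g : Fin n → (Fin n → α) → ℝ) (hg : ∀ i, Measurable (g i)) (hgC : ∀ i x, |g i x| ≤ C)
    (hgi : ∀ i x a, g i (Function.update x i a) = g i x) :
    ∫ x, (f x - ∫ y, f y ∂(Measure.pi fun _ => μ)) ^ 2 ∂(Measure.pi fun _ => μ) ≤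
      ∑ i, ∫ x, (f x - g i x) ^ 2 ∂(Measure.pi fun _ => μ) := by
  induction n with
  | zero =>
    have h : ∀ x, f x = f default := fun x => by rw [Subsingleton.elim x default]
    simp [h]
  | succ n ih =>
    have hcons : Measurable fun z : (Fin n → α) × α => (Fin.cons z.2 z.1 : Fin (n + 1) → α) := by
      refine measurable_pi_iff.2 fun i => ?_
      refine Fin.cases ?_ (fun j => ?_) i
      · simpa using measurable_snd
      · simpa [Function.comp_def] using (measurable_pi_apply j).comp measurable_fst
    have hcons1 : ∀ y : Fin n → α, Measurable fun a : α => (Fin.cons a y : Fin (n + 1) → α) :=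
      fun y => hcons.comp measurable_prodMk_left
    have hmeas : ∀ u : (Fin (n + 1) → α) → ℝ, Measurable u →
        Measurable fun y : Fin n → α => ∫ a, u (Fin.cons a y) ∂μ := fun u hu =>
      ((hu.comp hcons).stronglyMeasurable.integral_prod_right' (ν := μ)).measurable
    set ν := Measure.pi fun _ : Fin n => μ with hν
    set M := Measure.pi fun _ : Fin (n + 1) => μ with hM
    have hCb : 0 ≤ C := by
      obtain ⟨x⟩ : Nonempty (Fin (n + 1) → α) := M.nonempty_of_neZero
      exact (abs_nonneg _).trans (hfC x)
    -- Induction on the number of variables: `h` and `G i` average out the first one, and the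
    -- induction hypothesis is applied to them.
    set h : (Fin n → α) → ℝ := fun y => ∫ a, f (Fin.cons a y) ∂μ with hh
    set G : Fin n → (Fin n → α) → ℝ := fun i y => ∫ a, g i.succ (Fin.cons a y) ∂μ with hG
    have hhm : Measurable h := hmeas f hf
    have hGm : ∀ i, Measurable (G i) := fun i => hmeas _ (hg i.succ)
    have hhC : ∀ y, |h y| ≤ C := fun y => abs_integral_le_of_forall fun a => hfC _
    have hGC : ∀ i y, |G i y| ≤ C := fun i y => abs_integral_le_of_forall fun a => hgC _ _
    have hGi : ∀ i y a, G i (Function.update y i a) = G i y := by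
      intro i y a
      simp only [hG]
      congr 1 with b
      rw [Fin.cons_update, hgi]
    have hmean : ∫ x, f x ∂M = ∫ y, h y ∂ν := integral_pi_fin_succ μ hf hfC
    have hIH := ih h hhm hhC G hGm hGC hGi
    have hdiff : ∀ i x, |f x - g i x| ≤ 2 * C := fun i x => by
      have := abs_sub (f x) (g i x)
      linarith [hfC x, hgC i x]
    have hsucc : ∀ i : Fin (n + 1), ∫ x, (f x - g i x) ^ 2 ∂M =
        ∫ y, ∫ a, (f (Fin.cons a y) - g i (Fin.cons a y)) ^ 2 ∂μ ∂ν := by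
      intro i
      refine integral_pi_fin_succ μ ((hf.sub (hg i)).pow_const 2) (C := (2 * C) ^ 2) fun x => ?_
      rw [abs_pow]
      exact pow_le_pow_left₀ (abs_nonneg _) (hdiff i x) 2
    have hint : ∀ i : Fin (n + 1),
        Integrable (fun y => ∫ a, (f (Fin.cons a y) - g i (Fin.cons a y)) ^ 2 ∂μ) ν := by
      intro i
      refine integrable_of_forall_abs_le (C := (2 * C) ^ 2)
        (hmeas _ ((hf.sub (hg i)).pow_const 2)) fun y => abs_integral_le_of_forall fun a => ?_
      rw [abs_pow]
      exact pow_le_pow_left₀ (abs_nonneg _) (hdiff i _) 2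
    have hhm' : ∀ c : ℝ, |c| ≤ C → ∀ y, |h y - c| ≤ 2 * C := fun c hc y => by
      have := abs_sub (h y) c
      linarith [hhC y]
    have hmC : |∫ y, h y ∂ν| ≤ C := abs_integral_le_of_forall hhC
    -- Total variance splits into the mean conditional variance and the variance of `h`. Given the
    -- other variables `g 0` is constant, so the conditional variance is at most the conditional
    -- mean of `(f - g 0) ^ 2`.
    have h0 : ∫ x, (f x - ∫ y, f y ∂M) ^ 2 ∂M ≤
        ∫ x, (f x - g 0 x) ^ 2 ∂M + ∫ y, (h y - ∫ y, h y ∂ν) ^ 2 ∂ν := by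
      rw [hsucc, hmean, integral_pi_fin_succ μ (C := (2 * C) ^ 2) ((hf.sub_const _).pow_const 2),
        ← integral_add (hint 0) (integrable_sq_of_forall_abs_le (hhm.sub_const _) (hhm' _ hmC))]
      · refine integral_mono ?_ ((hint 0).add
          (integrable_sq_of_forall_abs_le (hhm.sub_const _) (hhm' _ hmC))) fun y => ?_
        · refine integrable_of_forall_abs_le (C := (2 * C) ^ 2)
            (hmeas _ ((hf.sub_const _).pow_const 2)) fun y => abs_integral_le_of_forall fun a => ?_
          rw [abs_pow]
          refine pow_le_pow_left₀ (abs_nonneg _) ?_ 2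
          have := abs_sub (f (Fin.cons a y)) (∫ y, h y ∂ν)
          linarith [hfC (Fin.cons a y)]
        · rcases isEmpty_or_nonempty α with hα | ⟨⟨a₀⟩⟩
          · exact ((M.nonempty_of_neZero.some) 0 |> hα.elim)
          have hfy : Measurable fun a => f (Fin.cons a y) := hf.comp (hcons1 y)
          have e1 := integral_sub_const_sq (μ := μ) hfy (fun a => hfC _) (∫ y, h y ∂ν)
          have e2 := integral_sub_const_sq (μ := μ) hfy (fun a => hfC _) (g 0 (Fin.cons a₀ y))
          have e3 : ∀ a, g 0 (Fin.cons a y) = g 0 (Fin.cons a₀ y) := fun a => by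
            have := hgi 0 (Fin.cons a₀ y) a
            rwa [Fin.update_cons_zero] at this
          simp only [e3]
          have e4 := sq_nonneg (∫ a, f (Fin.cons a y) ∂μ - g 0 (Fin.cons a₀ y))
          simp only [hh] at *
          linarith
      · intro x
        rw [abs_pow]
        refine pow_le_pow_left₀ (abs_nonneg _) ?_ 2
        have := abs_sub (f x) (∫ y, h y ∂ν)
        linarith [hfC x]
    -- Jensen's inequality for the average over the first variable.
    have h1 : ∀ i : Fin n, ∫ y, (h y - G i y) ^ 2 ∂ν ≤ ∫ x, (f x - g i.succ x) ^ 2 ∂M := by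
      intro i
      rw [hsucc]
      refine integral_mono (integrable_sq_of_forall_abs_le (C := 2 * C) (hhm.sub (hGm i))
        fun y => hhm' _ (hGC i y) y) (hint _) fun y => ?_
      have hfy : Measurable fun a => f (Fin.cons a y) := hf.comp (hcons1 y)
      have hgy : Measurable fun a => g i.succ (Fin.cons a y) := (hg i.succ).comp (hcons1 y)
      have e := sq_integral_le (μ := μ) (hfy.sub hgy) (C := 2 * C) fun a => hdiff _ _
      simp only [Pi.sub_apply] at e
      rwa [integral_sub (integrable_of_forall_abs_le hfy fun a => hfC _)
        (integrable_of_forall_abs_le hgy fun a => hgC _ _)] at e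
    rw [Fin.sum_univ_succ]
    have := Finset.sum_le_sum fun i (_ : i ∈ Finset.univ) => h1 i
    linarith

/-! ### The maximal coupling of two densities -/

section Coupling

variable {E : Type*} [MeasurableSpace E] {vol : Measure E} {f g : E → ℝ≥0∞}

/-- The coupling of the laws with densities `f` and `g` which puts as much mass as possible on the
diagonal. -/
noncomputable def densityCoupling (vol : Measure E) (f g : E → ℝ≥0∞) : Measure (E × E) :=
  (vol.withDensity fun x => min (f x) (g x)).map (fun x => (x, x)) +
    (∫⁻ x, (f x - g x) ∂vol)⁻¹ •
      ((vol.withDensity fun x => f x - g x).prod (vol.withDensity fun x => g x - f x))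

theorem lintegral_min_add_sub (hf : Measurable f) (hg : Measurable g) :
    ∫⁻ x, min (f x) (g x) ∂vol + ∫⁻ x, (f x - g x) ∂vol = ∫⁻ x, f x ∂vol := by
  rw [← lintegral_add_left (hf.min hg)]
  congr 1 with x
  rw [add_comm]
  exact tsub_add_min

/-- Both sides complement the integral of `min f g` to total mass one. -/
theorem lintegral_sub_comm (hf : Measurable f) (hg : Measurable g)
    (hf1 : ∫⁻ x, f x ∂vol = 1) (hg1 : ∫⁻ x, g x ∂vol = 1) :
    ∫⁻ x, (f x - g x) ∂vol = ∫⁻ x, (g x - f x) ∂vol := by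
  have h1 := lintegral_min_add_sub (vol := vol) hf hg
  have h2 := lintegral_min_add_sub (vol := vol) hg hf
  have h3 : ∫⁻ x, min (f x) (g x) ∂vol ≠ ∞ := ne_top_of_le_ne_top ENNReal.one_ne_top
    (hf1 ▸ lintegral_mono fun x => min_le_left _ _)
  simp_rw [min_comm (g _)] at h2
  rw [hg1, ← hf1, ← h1] at h2
  exact ((ENNReal.add_right_inj h3).1 h2).symm

theorem lintegral_sub_le_one (hf1 : ∫⁻ x, f x ∂vol = 1) : ∫⁻ x, (f x - g x) ∂vol ≤ 1 :=
  hf1 ▸ lintegral_mono fun _ => tsub_le_self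

theorem isProbabilityMeasure_withDensity' (hf1 : ∫⁻ x, f x ∂vol = 1) :
    IsProbabilityMeasure (vol.withDensity f) :=
  ⟨by rw [withDensity_apply _ MeasurableSet.univ, Measure.restrict_univ, hf1]⟩

variable [SFinite vol]

/-- The off-diagonal part has first marginal `f - g` times the mass of `g - f`. The two excess
masses are equal, so the normalizing factor cancels and `min f g + (f - g) = f` remains. -/
theorem map_fst_densityCoupling (hf : Measurable f) (hg : Measurable g)
    (hf1 : ∫⁻ x, f x ∂vol = 1) (hg1 : ∫⁻ x, g x ∂vol = 1) :
    (densityCoupling vol f g).map Prod.fst = vol.withDensity f := by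
  have hc := lintegral_sub_comm hf hg hf1 hg1
  have hc1 : ∫⁻ x, (f x - g x) ∂vol ≠ ∞ :=
    ne_top_of_le_ne_top ENNReal.one_ne_top (lintegral_sub_le_one hf1)
  have hd : Measurable fun x : E => (x, x) := measurable_id.prodMk measurable_id
  rw [densityCoupling, Measure.map_add _ _ measurable_fst, Measure.map_map measurable_fst hd,
    Measure.map_smul, Measure.map_fst_prod, withDensity_apply _ MeasurableSet.univ,
    Measure.restrict_univ, ← hc]
  have : (Prod.fst ∘ fun x : E => (x, x)) = id := rfl
  rw [this, Measure.map_id, smul_smul]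
  have h2 : ((∫⁻ x, (f x - g x) ∂vol)⁻¹ * ∫⁻ x, (f x - g x) ∂vol) •
      (vol.withDensity fun x => f x - g x) = vol.withDensity fun x => f x - g x := by
    -- If the excess mass is zero its inverse is `∞` and nothing cancels, but the excess measure
    -- itself is then zero.
    by_cases h0 : ∫⁻ x, (f x - g x) ∂vol = 0
    · have : vol.withDensity (fun x => f x - g x) = 0 := by
        exact withDensity_eq_zero_iff (hf.sub hg).aemeasurable |>.2
          ((lintegral_eq_zero_iff (hf.sub hg)).1 h0)
      rw [this, smul_zero]
    · rw [ENNReal.inv_mul_cancel h0 hc1, one_smul]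
  rw [h2, ← withDensity_add_left (hf.min hg)]
  congr 1 with x
  simp only [Pi.add_apply]
  rw [add_comm]
  exact tsub_add_min

theorem map_swap_densityCoupling (hf : Measurable f) (hg : Measurable g)
    (hf1 : ∫⁻ x, f x ∂vol = 1) (hg1 : ∫⁻ x, g x ∂vol = 1) :
    (densityCoupling vol f g).map Prod.swap = densityCoupling vol g f := by
  have hd : Measurable fun x : E => (x, x) := measurable_id.prodMk measurable_id
  rw [densityCoupling, Measure.map_add _ _ measurable_swap, Measure.map_map measurable_swap hd,
    Measure.map_smul, Measure.prod_swap, lintegral_sub_comm hf hg hf1 hg1, densityCoupling]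
  simp_rw [min_comm (g _)]
  rfl

theorem map_snd_densityCoupling (hf : Measurable f) (hg : Measurable g)
    (hf1 : ∫⁻ x, f x ∂vol = 1) (hg1 : ∫⁻ x, g x ∂vol = 1) :
    (densityCoupling vol f g).map Prod.snd = vol.withDensity g := by
  rw [← map_fst_densityCoupling hg hf hg1 hf1, ← map_swap_densityCoupling hf hg hf1 hg1,
    Measure.map_map measurable_fst measurable_swap]
  rfl

theorem densityCoupling_ne_le [MeasurableEq E] (hf : Measurable f) (hg : Measurable g)
    (hf1 : ∫⁻ x, f x ∂vol = 1) (hg1 : ∫⁻ x, g x ∂vol = 1) :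
    densityCoupling vol f g {z | z.1 ≠ z.2} ≤ ∫⁻ x, (f x - g x) ∂vol := by
  have hd : Measurable fun x : E => (x, x) := measurable_id.prodMk measurable_id
  have hm : MeasurableSet {z : E × E | z.1 ≠ z.2} :=
    MeasurableEq.measurableSet_diagonal.compl
  have hc1 : ∫⁻ x, (f x - g x) ∂vol ≠ ∞ :=
    ne_top_of_le_ne_top ENNReal.one_ne_top (lintegral_sub_le_one hf1)
  rw [densityCoupling, Measure.add_apply, Measure.map_apply hd hm]
  have : (fun x : E => (x, x)) ⁻¹' {z : E × E | z.1 ≠ z.2} = ∅ := by ext x; simp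
  rw [this, measure_empty, zero_add, Measure.smul_apply, smul_eq_mul]
  refine (mul_le_mul_right (measure_mono (Set.subset_univ _)) _).trans ?_
  rw [← Set.univ_prod_univ, Measure.prod_prod, withDensity_apply _ MeasurableSet.univ,
    withDensity_apply _ MeasurableSet.univ, Measure.restrict_univ,
    ← lintegral_sub_comm hf hg hf1 hg1, ← mul_assoc]
  exact mul_le_of_le_one_left zero_le (ENNReal.inv_mul_le_one _)

theorem isProbabilityMeasure_densityCoupling (hf : Measurable f) (hg : Measurable g)
    (hf1 : ∫⁻ x, f x ∂vol = 1) (hg1 : ∫⁻ x, g x ∂vol = 1) :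
    IsProbabilityMeasure (densityCoupling vol f g) := by
  have := isProbabilityMeasure_withDensity' hf1
  rw [← map_fst_densityCoupling hf hg hf1 hg1] at this
  exact Measure.isProbabilityMeasure_of_map (f := Prod.fst) 
end Coupling

/-! ### Moments of the number of sample points in a small ball -/

theorem exists_rpow_le_exp (τ : ℝ) (hτ : 0 ≤ τ) :
    ∃ C : ℝ, 0 ≤ C ∧ ∀ u : ℝ, 0 ≤ u → u ^ τ ≤ C * Real.exp u := by
  refine ⟨1 + (Nat.factorial ⌈τ⌉₊ : ℝ), by positivity, fun u hu => ?_⟩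
  have he : 1 ≤ Real.exp u := Real.one_le_exp hu
  have h1 : u ^ τ ≤ 1 + u ^ ⌈τ⌉₊ := by
    rcases le_total u 1 with h | h
    · have := Real.rpow_le_one hu h hτ
      have := pow_nonneg hu ⌈τ⌉₊
      linarith
    · have : u ^ τ ≤ u ^ (⌈τ⌉₊ : ℝ) := Real.rpow_le_rpow_of_exponent_le h (Nat.le_ceil τ)
      rw [Real.rpow_natCast] at this
      linarith
  have h2 := Real.pow_div_factorial_le_exp u hu ⌈τ⌉₊
  rw [div_le_iff₀ (by positivity)] at h2
  nlinarith

section Moments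

variable {E : Type*} [PseudoMetricSpace E] [MeasurableSpace E] [OpensMeasurableSpace E]

theorem measurable_card_near [SecondCountableTopology E] {α : Type*} [MeasurableSpace α]
    {ι : Type*} (A : Finset ι) (ρ : ℝ)
    {x : ι → α → E} (hx : ∀ j, Measurable (x j)) {z : α → E} (hz : Measurable z) :
    Measurable fun a => ((A.filter fun j => dist (x j a) (z a) ≤ ρ).card : ℝ) := by
  simp_rw [Finset.card_filter, Nat.cast_sum]
  refine Finset.measurable_sum _ fun j _ => ?_
  have : MeasurableSet {a | dist (x j a) (z a) ≤ ρ} :=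
    measurableSet_le ((hx j).dist hz) measurable_const
  simp only [Nat.cast_ite, Nat.cast_one, Nat.cast_zero]
  exact Measurable.ite this measurable_const measurable_const

/-- The count is binomial with mean at most `h`. Its exponential moment at `l = 1 / (1 + h)` is a
product of `n` factors, bounded through `1 + x ≤ exp x` and `exp l - 1 ≤ l * exp 1`. -/
theorem integral_exp_card_near_le (μ : Measure E) [IsProbabilityMeasure μ] (z : E) (ρ : ℝ) (n : ℕ)
    (h : ℝ) (hh : n * μ.real (Metric.closedBall z ρ) ≤ h) :
    ∫ x, Real.exp (((Finset.univ.filter fun j => dist (x j) z ≤ ρ).card : ℝ) / (1 + h))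
      ∂(Measure.pi fun _ : Fin n => μ) ≤ Real.exp (Real.exp 1) := by
  have hb0 : 0 ≤ μ.real (Metric.closedBall z ρ) := measureReal_nonneg
  have h0 : 0 ≤ h := le_trans (by positivity) hh
  set l := 1 / (1 + h) with hl
  have hl0 : 0 < l := by positivity
  have hl1 : l ≤ 1 := by rw [hl, div_le_one (by positivity)]; linarith
  have hprod : ∀ x : Fin n → E,
      Real.exp (((Finset.univ.filter fun j => dist (x j) z ≤ ρ).card : ℝ) / (1 + h)) =
      ∏ j, (1 + (Metric.closedBall z ρ).indicator (fun _ => Real.exp l - 1) (x j)) := by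
    intro x
    rw [Finset.card_filter, Nat.cast_sum, Finset.sum_div, Real.exp_sum]
    refine Finset.prod_congr rfl fun j _ => ?_
    by_cases hj : dist (x j) z ≤ ρ
    · rw [Set.indicator_of_mem (Metric.mem_closedBall.2 hj)]
      simp [hj, hl]
    · rw [Set.indicator_of_notMem (by rwa [Metric.mem_closedBall])]
      simp [hj]
  simp_rw [hprod]
  have hint : Integrable ((Metric.closedBall z ρ).indicator (fun _ => Real.exp l - 1)) μ :=
    (integrable_const _).indicator Metric.isClosed_closedBall.measurableSet
  rw [integral_fintype_prod_eq_pow (ι := Fin n)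
      (fun y => 1 + (Metric.closedBall z ρ).indicator (fun _ => Real.exp l - 1) y),
    integral_add (integrable_const _) hint,
    integral_indicator_const _ Metric.isClosed_closedBall.measurableSet, Fintype.card_fin]
  simp only [integral_const, probReal_univ, smul_eq_mul, mul_one]
  set b := μ.real (Metric.closedBall z ρ)
  have h1 : Real.exp l - 1 ≤ l * Real.exp 1 := by
    have e1 := Real.add_one_le_exp (-l)
    have e2 : Real.exp (-l) * Real.exp l = 1 := by rw [← Real.exp_add]; simp
    have e3 : Real.exp l ≤ Real.exp 1 := Real.exp_le_exp.2 hl1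
    nlinarith [Real.exp_pos l]
  have h2 : 0 ≤ Real.exp l - 1 := by linarith [Real.one_le_exp hl0.le]
  calc (1 + b * (Real.exp l - 1)) ^ n ≤ (Real.exp (b * (Real.exp l - 1))) ^ n := by
        gcongr
        linarith [Real.add_one_le_exp (b * (Real.exp l - 1))]
    _ = Real.exp (n * b * (Real.exp l - 1)) := by rw [← Real.exp_nat_mul]; ring_nf
    _ ≤ Real.exp (Real.exp 1) := by
        apply Real.exp_le_exp.2
        have e1 : n * b * (Real.exp l - 1) ≤ h * (l * Real.exp 1) := by gcongr
        have e2 : h * l ≤ 1 := by rw [hl, mul_one_div, div_le_one (by positivity)]; linarith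
        nlinarith [Real.exp_pos 1]

/-- Apply `u ^ τ ≤ C * exp u` to `u = (1 + N) / (1 + h)`, where `N` is the count and `h` its mean,
and use the exponential moment. The constant depends on `τ` only. -/
theorem exists_lintegral_rpow_card_near_le [SecondCountableTopology E] (τ : ℝ) (hτ : 0 ≤ τ) :
    ∃ C : ℝ≥0∞, C ≠ ∞ ∧ ∀ (μ : Measure E) [IsProbabilityMeasure μ] (z : E) (ρ : ℝ) (n : ℕ),
      ∫⁻ x, ENNReal.ofReal
          ((1 + ((Finset.univ.filter fun j => dist (x j) z ≤ ρ).card : ℝ)) ^ τ)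
        ∂(Measure.pi fun _ : Fin n => μ) ≤
      C * (1 + n * μ (Metric.closedBall z ρ)) ^ τ := by
  obtain ⟨C, hC0, hC⟩ := exists_rpow_le_exp τ hτ
  refine ⟨ENNReal.ofReal (C * Real.exp 1 * Real.exp (Real.exp 1)), ENNReal.ofReal_ne_top,
    fun μ _ z ρ n => ?_⟩
  set b := μ.real (Metric.closedBall z ρ) with hb
  have hb0 : 0 ≤ b := measureReal_nonneg
  set h : ℝ := n * b with hh
  have h0 : 0 ≤ h := by positivity
  have hE := integral_exp_card_near_le μ z ρ n h le_rfl
  set N : (Fin n → E) → ℝ := fun x => ((Finset.univ.filter fun j => dist (x j) z ≤ ρ).card : ℝ)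
    with hN
  have hNm : Measurable N := measurable_card_near _ _ (fun j => measurable_pi_apply j)
    measurable_const
  have hpt : ∀ x, (1 + N x) ^ τ ≤ C * Real.exp 1 * (1 + h) ^ τ * Real.exp (N x / (1 + h)) := by
    intro x
    have hN0 : 0 ≤ N x := by positivity
    have h1 := hC ((1 + N x) / (1 + h)) (by positivity)
    rw [Real.div_rpow (by positivity) (by positivity), div_le_iff₀ (by positivity)] at h1
    have h2 : Real.exp ((1 + N x) / (1 + h)) ≤ Real.exp 1 * Real.exp (N x / (1 + h)) := by
      rw [← Real.exp_add, add_div]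
      apply Real.exp_le_exp.2
      gcongr
      rw [div_le_one (by positivity)]
      linarith
    calc (1 + N x) ^ τ ≤ C * Real.exp ((1 + N x) / (1 + h)) * (1 + h) ^ τ := h1
      _ ≤ C * (Real.exp 1 * Real.exp (N x / (1 + h))) * (1 + h) ^ τ := by gcongr
      _ = _ := by ring
  have hint : Integrable (fun x => Real.exp (N x / (1 + h))) (Measure.pi fun _ : Fin n => μ) := by
    refine integrable_of_forall_abs_le (C := Real.exp (n / (1 + h)))
      (Real.measurable_exp.comp (hNm.div_const _)) fun x => ?_
    rw [Real.abs_exp]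
    apply Real.exp_le_exp.2
    gcongr
    simp only [hN]
    exact_mod_cast (Finset.card_le_univ _).trans (by simp)
  calc _ ≤ ∫⁻ x, ENNReal.ofReal (C * Real.exp 1 * (1 + h) ^ τ * Real.exp (N x / (1 + h)))
        ∂(Measure.pi fun _ : Fin n => μ) :=
        lintegral_mono fun x => ENNReal.ofReal_le_ofReal (hpt x)
    _ = ENNReal.ofReal (∫ x, C * Real.exp 1 * (1 + h) ^ τ * Real.exp (N x / (1 + h))
        ∂(Measure.pi fun _ : Fin n => μ)) :=
        (ofReal_integral_eq_lintegral_ofReal (hint.const_mul _)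
          (ae_of_all _ fun x => by positivity)).symm
    _ ≤ ENNReal.ofReal (C * Real.exp 1 * (1 + h) ^ τ * Real.exp (Real.exp 1)) := by
        rw [integral_const_mul]
        exact ENNReal.ofReal_le_ofReal (by gcongr)
    _ = _ := by
        rw [show C * Real.exp 1 * (1 + h) ^ τ * Real.exp (Real.exp 1) =
          C * Real.exp 1 * Real.exp (Real.exp 1) * (1 + h) ^ τ by ring,
          ENNReal.ofReal_mul (by positivity), ← ENNReal.ofReal_rpow_of_nonneg (by positivity) hτ,
          ENNReal.ofReal_add zero_le_one h0, hh, ENNReal.ofReal_mul (p := (n : ℝ)) (by positivity), hb,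
          ofReal_measureReal]
        simp

theorem lintegral_pi_fin_succAbove {α : Type*} [MeasurableSpace α] (μ : Measure α)
    [IsProbabilityMeasure μ] {n : ℕ} (i : Fin (n + 1)) {u : (Fin (n + 1) → α) → ℝ≥0∞}
    (hu : Measurable u) :
    ∫⁻ x, u x ∂(Measure.pi fun _ => μ) =
      ∫⁻ a, ∫⁻ y, u (i.insertNth a y) ∂(Measure.pi fun _ : Fin n => μ) ∂μ := by
  have h := (measurePreserving_piFinSuccAbove (fun _ : Fin (n + 1) => μ) i).symm
  rw [← h.lintegral_comp hu, lintegral_prod]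
  · simp [MeasurableEquiv.piFinSuccAbove_symm_apply, Fin.insertNthEquiv]
  · exact (hu.comp (MeasurableEquiv.measurable _)).aemeasurable

/-- Condition on the `i`-th point: the others are an iid sample around a fixed centre. Keeping `n`
in place of `n - 1` on the right only weakens the bound. -/
theorem exists_lintegral_rpow_card_near_erase_le [SecondCountableTopology E]
    (τ : ℝ) (hτ : 0 ≤ τ) :
    ∃ C : ℝ≥0∞, C ≠ ∞ ∧ ∀ (μ : Measure E) [IsProbabilityMeasure μ] (ρ : ℝ) (n : ℕ) (i : Fin n),
      ∫⁻ x, ENNReal.ofReal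
          ((1 + (((Finset.univ.erase i).filter fun j => dist (x j) (x i) ≤ ρ).card : ℝ)) ^ τ)
        ∂(Measure.pi fun _ : Fin n => μ) ≤
      C * ∫⁻ z, (1 + n * μ (Metric.closedBall z ρ)) ^ τ ∂μ := by
  obtain ⟨C, hC0, hC⟩ := exists_lintegral_rpow_card_near_le (E := E) τ hτ
  refine ⟨C, hC0, fun μ _ ρ n i => ?_⟩
  obtain _ | n := n
  · exact i.elim0
  rw [lintegral_pi_fin_succAbove μ i, ← lintegral_const_mul' _ _ hC0]
  · refine lintegral_mono fun z => ?_
    have hcard : ∀ y : Fin n → E,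
        ((Finset.univ.erase i).filter fun j => dist
          ((i.insertNth z y : Fin (n + 1) → E) j) ((i.insertNth z y : Fin (n + 1) → E) i) ≤ ρ).card
        = (Finset.univ.filter fun j => dist (y j) z ≤ ρ).card := by
      intro y
      have : Finset.univ.erase i = Finset.univ.map i.succAboveEmb := by
        ext j
        simp [Fin.exists_succAbove_eq_iff]
      rw [this, Finset.filter_map, Finset.card_map]
      simp
    simp_rw [hcard]
    refine (hC μ z ρ n).trans ?_
    gcongr
    simp
  · exact ENNReal.measurable_ofReal.comp (((measurable_card_near _ _
      (fun j => measurable_pi_apply j) (measurable_pi_apply i)).const_add 1).pow_const τ)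

/-- Hölder on each ball gives a factor `v ^ (t - 1)`; exchanging the order of integration gives one
more `v`, because `x` lies in the ball around `z` exactly when `z` lies in the ball around `x`. -/
theorem lintegral_rpow_ball_le [SecondCountableTopology E] (vol : Measure E) [SFinite vol]
    {f : E → ℝ≥0∞} (hf : Measurable f)
    {t : ℝ} (ht : 1 ≤ t) {ρ : ℝ} {v : ℝ≥0∞} (hv : ∀ z, vol (Metric.closedBall z ρ) ≤ v) :
    ∫⁻ z, (vol.withDensity f (Metric.closedBall z ρ)) ^ t ∂vol ≤ v ^ t * ∫⁻ x, f x ^ t ∂vol := by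
  have ht0 : 0 < t := by linarith
  have h1 : ∀ z, (vol.withDensity f (Metric.closedBall z ρ)) ^ t ≤
      v ^ (t - 1) * ∫⁻ x, (Metric.closedBall z ρ).indicator (fun x => f x ^ t) x ∂vol := by
    intro z
    have hm : MeasurableSet (Metric.closedBall z ρ) := Metric.isClosed_closedBall.measurableSet
    rw [withDensity_apply _ hm, lintegral_indicator hm]
    have := eLpNorm'_le_eLpNorm'_mul_rpow_measure_univ (μ := vol.restrict (Metric.closedBall z ρ))
      zero_lt_one ht hf.aestronglyMeasurable
    simp only [eLpNorm', enorm_eq_self, ENNReal.rpow_one, div_one,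
      Measure.restrict_apply MeasurableSet.univ, Set.univ_inter] at this
    calc _ ≤ ((∫⁻ x in Metric.closedBall z ρ, f x ^ t ∂vol) ^ (1 / t) *
          vol (Metric.closedBall z ρ) ^ (1 - 1 / t)) ^ t := by gcongr
      _ = (∫⁻ x in Metric.closedBall z ρ, f x ^ t ∂vol) *
          vol (Metric.closedBall z ρ) ^ (t - 1) := by
        rw [ENNReal.mul_rpow_of_nonneg _ _ ht0.le, ← ENNReal.rpow_mul, ← ENNReal.rpow_mul,
          one_div_mul_cancel ht0.ne', ENNReal.rpow_one]
        congr 2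
        field_simp
      _ ≤ _ := by
        rw [mul_comm]
        gcongr
        exact hv z
  refine (lintegral_mono h1).trans ?_
  have hmeas : Measurable (Function.uncurry fun z x : E =>
      (Metric.closedBall z ρ).indicator (fun x => f x ^ t) x) := by
    have hs : MeasurableSet {p : E × E | dist p.2 p.1 ≤ ρ} :=
      measurableSet_le (measurable_snd.dist measurable_fst) measurable_const
    exact ((hf.comp measurable_snd).pow_const t).indicator hs
  have hmeas' : Measurable fun z => ∫⁻ x, (Metric.closedBall z ρ).indicator (fun x => f x ^ t) x
      ∂vol := hmeas.lintegral_prod_right'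
  rw [lintegral_const_mul _ hmeas', lintegral_lintegral_swap hmeas.aemeasurable]
  have h2 : ∀ x, ∫⁻ z, (Metric.closedBall z ρ).indicator (fun x => f x ^ t) x ∂vol ≤
      v * f x ^ t := by
    intro x
    have : ∀ z, (Metric.closedBall z ρ).indicator (fun x => f x ^ t) x =
        (Metric.closedBall x ρ).indicator (fun _ => f x ^ t) z := by
      intro z
      simp only [Set.indicator, Metric.mem_closedBall, dist_comm x z]
    simp_rw [this]
    rw [lintegral_indicator_const Metric.isClosed_closedBall.measurableSet, mul_comm]
    gcongr
    exact hv x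
  calc _ ≤ v ^ (t - 1) * ∫⁻ x, v * f x ^ t ∂vol := by gcongr with x; exact h2 x
    _ = v ^ (t - 1) * v ^ (1 : ℝ) * ∫⁻ x, f x ^ t ∂vol := by
      rw [lintegral_const_mul _ (hf.pow_const t), ENNReal.rpow_one, mul_assoc]
    _ = _ := by
      rw [← ENNReal.rpow_add_of_nonneg _ _ (by linarith) zero_le_one]
      congr 2
      ring

/-- Integrating against `f` turns the `τ`-th power of the expected count `H` into `f * H ^ τ`, which
is at most `f ^ (τ + 1) + H ^ (τ + 1)`. This is where one extra order of integrability is spent. -/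
theorem lintegral_one_add_ball_rpow_le [SecondCountableTopology E] (vol : Measure E) [SFinite vol]
    {f : E → ℝ≥0∞} (hf : Measurable f) (hf1 : ∫⁻ x, f x ∂vol = 1) {τ : ℝ} (hτ : 1 ≤ τ) {B : ℝ≥0∞}
    (hfB : ∫⁻ x, f x ^ (τ + 1) ∂vol ≤ B) {ρ : ℝ} {v V : ℝ≥0∞}
    (hv : ∀ z, vol (Metric.closedBall z ρ) ≤ v) (n : ℕ) (hV : n * v ≤ V) :
    ∫⁻ z, (1 + n * vol.withDensity f (Metric.closedBall z ρ)) ^ τ ∂(vol.withDensity f) ≤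
      2 ^ (τ - 1) * (1 + B + V ^ (τ + 1) * B) := by
  set H : E → ℝ≥0∞ := fun z => n * vol.withDensity f (Metric.closedBall z ρ) with hH
  have hHm : Measurable H := by
    refine Measurable.const_mul ?_ _
    have hs : MeasurableSet {p : E × E | dist p.2 p.1 ≤ ρ} :=
      measurableSet_le (measurable_snd.dist measurable_fst) measurable_const
    exact measurable_measure_prodMk_left hs
  have hpt : ∀ z, f z * (1 + H z) ^ τ ≤ 2 ^ (τ - 1) * (f z + f z ^ (τ + 1) + H z ^ (τ + 1)) := by
    intro z
    have h1 := ENNReal.rpow_add_le_mul_rpow_add_rpow 1 (H z) hτ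
    rw [ENNReal.one_rpow] at h1
    have h2 : f z * H z ^ τ ≤ f z ^ (τ + 1) + H z ^ (τ + 1) := by
      have hs : ∀ a : ℝ≥0∞, a ^ (τ + 1) = a * a ^ τ := fun a => by
        rw [ENNReal.rpow_add_of_nonneg _ _ (by linarith) zero_le_one, ENNReal.rpow_one, mul_comm]
      rw [hs, hs]
      rcases le_total (f z) (H z) with h | h
      · exact le_add_left (by gcongr)
      · exact le_add_right (by gcongr)
    calc _ ≤ f z * (2 ^ (τ - 1) * (1 + H z ^ τ)) := by gcongr
      _ = 2 ^ (τ - 1) * (f z + f z * H z ^ τ) := by ring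
      _ ≤ 2 ^ (τ - 1) * (f z + (f z ^ (τ + 1) + H z ^ (τ + 1))) := by gcongr
      _ = _ := by rw [add_assoc]
  rw [lintegral_withDensity_eq_lintegral_mul _ hf ((hHm.const_add 1).pow_const τ)]
  refine (lintegral_mono hpt).trans ?_
  have hm1 : Measurable fun z => f z + f z ^ (τ + 1) := hf.add (hf.pow_const _)
  have hm2 : Measurable fun z => f z + f z ^ (τ + 1) + H z ^ (τ + 1) := hm1.add (hHm.pow_const _)
  rw [lintegral_const_mul _ hm2, lintegral_add_left hm1, lintegral_add_left hf, hf1]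
  gcongr
  simp only [hH]
  have h0 : 0 ≤ τ + 1 := by linarith
  simp_rw [ENNReal.mul_rpow_of_nonneg _ _ h0]
  rw [lintegral_const_mul' _ _ (ENNReal.rpow_ne_top_of_nonneg h0 (ENNReal.natCast_ne_top n))]
  calc _ ≤ (n : ℝ≥0∞) ^ (τ + 1) * (v ^ (τ + 1) * ∫⁻ x, f x ^ (τ + 1) ∂vol) := by
        gcongr
        exact lintegral_rpow_ball_le vol hf (by linarith) hv
    _ = (n * v) ^ (τ + 1) * ∫⁻ x, f x ^ (τ + 1) ∂vol := by
        rw [ENNReal.mul_rpow_of_nonneg _ _ h0, mul_assoc]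
    _ ≤ _ := by gcongr

/-- The moments of order `τ` of the number of points near a sample point are bounded in terms of
the norm of order `τ + 1` of the density. -/
theorem exists_moment_bound [SecondCountableTopology E] {τ : ℝ} (hτ : 1 ≤ τ) {B V : ℝ≥0∞}
    (hB : B ≠ ∞) (hV : V ≠ ∞) :
    ∃ D : ℝ≥0∞, D ≠ ∞ ∧ ∀ (vol : Measure E) [SFinite vol] (f : E → ℝ≥0∞), Measurable f →
      ∫⁻ x, f x ∂vol = 1 → ∫⁻ x, f x ^ (τ + 1) ∂vol ≤ B → ∀ (ρ : ℝ) (v : ℝ≥0∞),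
      (∀ z, vol (Metric.closedBall z ρ) ≤ v) → ∀ n : ℕ, n * v ≤ V → ∀ i : Fin n,
      ∫⁻ x, ENNReal.ofReal
          ((1 + (((Finset.univ.erase i).filter fun j => dist (x j) (x i) ≤ ρ).card : ℝ)) ^ τ)
        ∂(Measure.pi fun _ : Fin n => vol.withDensity f) ≤ D := by
  obtain ⟨C, hC0, hC⟩ := exists_lintegral_rpow_card_near_erase_le (E := E) τ (by linarith)
  refine ⟨C * (2 ^ (τ - 1) * (1 + B + V ^ (τ + 1) * B)), ?_, ?_⟩
  · have h1 : (2 : ℝ≥0∞) ^ (τ - 1) ≠ ∞ :=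
      ENNReal.rpow_ne_top_of_nonneg (by linarith) ENNReal.ofNat_ne_top
    have h2 : V ^ (τ + 1) ≠ ∞ := ENNReal.rpow_ne_top_of_nonneg (by linarith) hV
    finiteness
  · intro vol _ f hf hf1 hfB ρ v hv n hn i
    have := isProbabilityMeasure_withDensity' hf1
    refine (hC (vol.withDensity f) ρ n i).trans ?_
    gcongr
    exact lintegral_one_add_ball_rpow_le vol hf hf1 hτ hfB hv n hn

end Moments

/-! ### Local statistics of coupled samples -/

/-- Enumerating `A` in increasing order reduces a subsample to a full sample of size `A.card`. -/
theorem measurable_finset_map {E α : Type*} [MeasurableSpace E] [MeasurableSpace α]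
    {θ : Multiset E → ℝ}
    (hθ : ∀ n, Measurable fun x : Fin n → E => θ ((Finset.univ : Finset (Fin n)).val.map x))
    {n : ℕ} (A : Finset (Fin n)) {x : α → Fin n → E} (hx : ∀ j, Measurable fun w => x w j) :
    Measurable fun w => θ (A.val.map (x w)) := by
  have h : ∀ w, A.val.map (x w) = (Finset.univ : Finset (Fin A.card)).val.map
      (fun i => x w (A.orderEmbOfFin rfl i)) := by
    intro w
    conv_lhs => rw [← Finset.map_orderEmbOfFin_univ A rfl, Finset.map_val, Multiset.map_map]
    rfl
  simp_rw [h]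
  exact (hθ A.card).comp (measurable_pi_iff.2 fun i => hx _)

theorem univ_val_map_eq_cons {E : Type*} {n : ℕ} {A : Finset (Fin n)} {i : Fin n} (hi : i ∈ A)
    (x : Fin n → E) : A.val.map x = x i ::ₘ (A.erase i).val.map x := by
  conv_lhs => rw [← Finset.insert_erase hi, Finset.insert_val_of_notMem (Finset.notMem_erase i A)]
  rw [Multiset.map_cons]

theorem card_filter_val_map {E ι : Type*} (A : Finset ι) (x : ι → E)
    (p : E → Prop) [DecidablePred p] :
    ((A.val.map x).filter p).card = (A.filter fun j => p (x j)).card := by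
  rw [Multiset.filter_map, Multiset.card_map]
  rfl

section Deterministic

variable {E : Type*} [PseudoMetricSpace E] {a ρ : ℝ} {q : ℕ} {θ : Multiset E → ℝ}

/-- The two samples may look different from the `i`-th point of `x` within the distance `ρ`; the
second sample consists of the points `y j`, `j ∈ J`. -/
def DiffersNear {n : ℕ} (ρ : ℝ) (J : Finset (Fin n)) (i : Fin n) (x y : Fin n → E) : Prop :=
  x i ≠ y i ∨ ∃ j, j ≠ i ∧ ((j ∉ J ∧ dist (x j) (x i) ≤ ρ) ∨
    (x j ≠ y j ∧ (dist (x j) (x i) ≤ ρ ∨ dist (y j) (x i) ≤ ρ)))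

/-- The two samples share the point `i` and all neighbours within `ρ` of it, so removing it has the
same effect on both. -/
theorem IsLocalStatistic.sub_eq_of_not_differsNear (h : IsLocalStatistic a ρ q θ) {n : ℕ}
    {J : Finset (Fin n)} {i : Fin n} (hi : i ∈ J) {x y : Fin n → E}
    (hxy : ¬ DiffersNear ρ J i x y) :
    θ ((Finset.univ : Finset (Fin n)).val.map x) - θ ((Finset.univ.erase i).val.map x) =
      θ (J.val.map y) - θ ((J.erase i).val.map y) := by
  unfold DiffersNear at hxy
  push Not at hxy
  obtain ⟨h1, h2⟩ := hxy
  rw [univ_val_map_eq_cons (Finset.mem_univ i), univ_val_map_eq_cons hi, ← h1]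
  refine h.sub_congr _ ?_
  rw [Multiset.filter_map, Multiset.filter_map]
  have hset : (Finset.univ.erase i).filter (fun j => dist (x j) (x i) ≤ ρ) =
      (J.erase i).filter (fun j => dist (y j) (x i) ≤ ρ) := by
    ext j
    simp only [Finset.mem_filter, Finset.mem_erase, Finset.mem_univ, and_true]
    constructor
    · rintro ⟨hj, hd⟩
      obtain ⟨h3, h4⟩ := h2 j hj
      have hjJ : j ∈ J := by
        by_contra hjJ
        exact absurd hd (not_le.2 (h3 hjJ))
      have hxy : x j = y j := by
        by_contra hne
        exact absurd hd (not_le.2 (h4 hne).1)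
      exact ⟨⟨hj, hjJ⟩, hxy ▸ hd⟩
    · rintro ⟨⟨hj, hjJ⟩, hd⟩
      obtain ⟨h3, h4⟩ := h2 j hj
      have hxy : x j = y j := by
        by_contra hne
        exact absurd hd (not_le.2 (h4 hne).2)
      exact ⟨hj, hxy ▸ hd⟩
  have hl : ((Finset.univ.erase i).val.filter ((fun z => dist z (x i) ≤ ρ) ∘ x)) =
      ((Finset.univ.erase i).filter (fun j => dist (x j) (x i) ≤ ρ)).val := rfl
  have hr : ((J.erase i).val.filter ((fun z => dist z (x i) ≤ ρ) ∘ y)) =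
      ((J.erase i).filter (fun j => dist (y j) (x i) ≤ ρ)).val := rfl
  rw [hl, hr, ← hset]
  refine Multiset.map_congr rfl fun j hj => ?_
  obtain ⟨hj1, hd⟩ := Finset.mem_filter.1 (Finset.mem_def.2 hj)
  by_contra hne
  exact absurd hd (not_le.2 ((h2 j (Finset.ne_of_mem_erase hj1)).2 hne).1)

theorem IsLocalStatistic.abs_sub_erase_le (h : IsLocalStatistic a ρ q θ) {n : ℕ}
    (J : Finset (Fin n)) (i : Fin n) (x : Fin n → E) :
    |θ (J.val.map x) - θ ((J.erase i).val.map x)| ≤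
      a * (1 + (((Finset.univ.erase i).filter fun j => dist (x j) (x i) ≤ ρ).card : ℝ)) ^ (q + 1) := by
  have ha := h.nonneg (x i)
  by_cases hi : i ∈ J
  · rw [univ_val_map_eq_cons hi]
    refine (h.abs_sub_le _ _).trans ?_
    rw [card_filter_val_map]
    gcongr
    exact Finset.subset_univ J
  · rw [Finset.erase_eq_of_notMem hi, sub_self, abs_zero]
    positivity

end Deterministic

/-- Uniform integrability in elementary form. Above the threshold `b`, where `κ * b ^ (τ - T) = 1`,
the higher power dominates; below it `b ^ T` suffices. -/
theorem exists_rpow_le_add {T τ : ℝ} (hT : 0 ≤ T) (hTτ : T < τ) {κ : ℝ} (hκ : 0 < κ) :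
    ∃ L : ℝ, 0 ≤ L ∧ ∀ u : ℝ, 0 < u → u ^ T ≤ κ * u ^ τ + L := by
  set b := (1 / κ) ^ (1 / (τ - T)) with hb
  have hb0 : 0 ≤ b := by positivity
  have hd : 0 < τ - T := by linarith
  refine ⟨b ^ T, by positivity, fun u hu => ?_⟩
  rcases le_total u b with h | h
  · have : u ^ T ≤ b ^ T := Real.rpow_le_rpow hu.le h hT
    have : 0 ≤ κ * u ^ τ := by positivity
    linarith
  · have h1 : 1 / κ ≤ u ^ (τ - T) := by
      have := Real.rpow_le_rpow hb0 h hd.le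
      rwa [hb, ← Real.rpow_mul (by positivity), one_div_mul_cancel hd.ne', Real.rpow_one] at this
    have h2 : u ^ τ = u ^ T * u ^ (τ - T) := by
      rw [← Real.rpow_add hu]; ring_nf
    have h3 : 1 ≤ κ * u ^ (τ - T) := by
      rwa [div_le_iff₀ hκ, mul_comm] at h1
    have h4 : 0 < u ^ T := by positivity
    have h5 : 0 ≤ b ^ T := by positivity
    rw [h2]
    nlinarith

/-! ### Probability that coupled samples differ near a given point -/

section Probability

variable {E : Type*} [PseudoMetricSpace E] [MeasurableSpace E] [OpensMeasurableSpace E]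
  [SecondCountableTopology E] {vol : Measure E} {f : E → ℝ≥0∞} {π : Measure (E × E)}
  [IsProbabilityMeasure π]

/-- The pairs `i` and `j` are independent. Given the latter, `(z i).1` has to fall into a ball of
volume at most `v` where its density is at most `K`. -/
theorem measure_pair_near_le (hf : Measurable f) (hπ : π.map Prod.fst = vol.withDensity f)
    {n : ℕ} {i j : Fin n} (hij : i ≠ j) {A : Set (E × E)} (hA : MeasurableSet A)
    {φ : E × E → E} (hφ : Measurable φ) (K v : ℝ≥0∞) (ρ : ℝ)
    (hv : ∀ z, vol (Metric.closedBall z ρ) ≤ v) :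
    (Measure.pi fun _ : Fin n => π)
        {z | z j ∈ A ∧ f (z i).1 ≤ K ∧ dist (φ (z j)) (z i).1 ≤ ρ} ≤ K * v * π A := by
  have hind : iIndepFun (fun (k : Fin n) (z : Fin n → E × E) => z k)
      (Measure.pi fun _ : Fin n => π) :=
    iIndepFun_pi (X := fun _ => id) fun _ => aemeasurable_id
  have hmap := (indepFun_iff_map_prod_eq_prod_map_map (measurable_pi_apply i).aemeasurable
    (measurable_pi_apply j).aemeasurable).1 (hind.indepFun hij)
  rw [(measurePreserving_eval (fun _ : Fin n => π) i).map_eq,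
    (measurePreserving_eval (fun _ : Fin n => π) j).map_eq] at hmap
  have hS : MeasurableSet {p : (E × E) × (E × E) | p.2 ∈ A ∧ f p.1.1 ≤ K ∧
      dist (φ p.2) p.1.1 ≤ ρ} := by
    refine (measurable_snd hA).inter (MeasurableSet.inter ?_ ?_)
    · exact measurableSet_le (hf.comp (measurable_fst.comp measurable_fst)) measurable_const
    · exact measurableSet_le ((hφ.comp measurable_snd).dist (measurable_fst.comp measurable_fst))
        measurable_const
  have h1 : (Measure.pi fun _ : Fin n => π)
      {z | z j ∈ A ∧ f (z i).1 ≤ K ∧ dist (φ (z j)) (z i).1 ≤ ρ} =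
      (π.prod π) {p : (E × E) × (E × E) | p.2 ∈ A ∧ f p.1.1 ≤ K ∧ dist (φ p.2) p.1.1 ≤ ρ} := by
    rw [← hmap, Measure.map_apply ((measurable_pi_apply i).prodMk (measurable_pi_apply j)) hS]
    rfl
  rw [h1, Measure.prod_apply_symm hS, ← setLIntegral_const, ← lintegral_indicator hA]
  refine lintegral_mono fun w => ?_
  by_cases hw : w ∈ A
  · rw [Set.indicator_of_mem hw]
    have hB : MeasurableSet {x : E | f x ≤ K ∧ dist (φ w) x ≤ ρ} :=
      (measurableSet_le hf measurable_const).inter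
        (measurableSet_le (measurable_const.dist measurable_id) measurable_const)
    calc π ((fun x => (x, w)) ⁻¹' {p : (E × E) × (E × E) | p.2 ∈ A ∧ f p.1.1 ≤ K ∧
          dist (φ p.2) p.1.1 ≤ ρ}) ≤ π (Prod.fst ⁻¹' {x : E | f x ≤ K ∧ dist (φ w) x ≤ ρ}) :=
          measure_mono fun p hp => hp.2
      _ = ∫⁻ x in {x : E | f x ≤ K ∧ dist (φ w) x ≤ ρ}, f x ∂vol := by
          rw [← Measure.map_apply measurable_fst hB, hπ, withDensity_apply _ hB]
      _ ≤ ∫⁻ x in {x : E | f x ≤ K ∧ dist (φ w) x ≤ ρ}, K ∂vol :=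
          setLIntegral_mono measurable_const fun x hx => hx.1
      _ ≤ K * v := by
          rw [setLIntegral_const]
          gcongr
          refine (measure_mono fun x hx => ?_).trans (hv (φ w))
          rw [Metric.mem_closedBall, dist_comm]
          exact hx.2
  · rw [Set.indicator_of_notMem hw]
    refine (measure_mono_null (fun x hx => hw hx.1) measure_empty).le

theorem measure_eval_preimage {α : Type*} [MeasurableSpace α] {μ : Measure α}
    [IsProbabilityMeasure μ] {n : ℕ} (i : Fin n) {A : Set α} (hA : MeasurableSet A) :
    (Measure.pi fun _ : Fin n => μ) {z | z i ∈ A} = μ A :=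
  (measurePreserving_eval (fun _ : Fin n => μ) i).measure_preimage hA.nullMeasurableSet

/-- A union bound whose four terms are: the pair `i` is mismatched; `f` exceeds `K` at the `i`-th
point; a neighbour has index outside `J`; some other mismatched pair has a coordinate nearby. The
last two sums stay bounded because `n * v ≤ V`. -/
theorem measure_differsNear_le [MeasurableEq E] (hf : Measurable f)
    (hπ : π.map Prod.fst = vol.withDensity f)
    {n : ℕ} (J : Finset (Fin n)) (i : Fin n) (K : ℝ≥0∞) {v V η c : ℝ≥0∞} {ρ : ℝ}
    (hv : ∀ z, vol (Metric.closedBall z ρ) ≤ v) (hV : n * v ≤ V)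
    (hη : (Jᶜ.card : ℝ≥0∞) ≤ η * n) (hc : π {z | z.1 ≠ z.2} ≤ c) :
    (Measure.pi fun _ : Fin n => π)
        {z | DiffersNear ρ J i (fun j => (z j).1) fun j => (z j).2} ≤
      c + vol.withDensity f {x | K < f x} + η * (K * V) + 2 * (K * V * c) := by
  have hne : MeasurableSet {z : E × E | z.1 ≠ z.2} := MeasurableEq.measurableSet_diagonal.compl
  have hK : MeasurableSet {x | K < f x} := measurableSet_lt measurable_const hf
  set M := Measure.pi fun _ : Fin n => π with hM
  set S : (E × E → E) → Set (E × E) → Fin n → Set (Fin n → E × E) := fun φ A j =>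
    {z | z j ∈ A ∧ f (z i).1 ≤ K ∧ dist (φ (z j)) (z i).1 ≤ ρ} with hS
  have hsub : {z : Fin n → E × E | DiffersNear ρ J i (fun j => (z j).1) fun j => (z j).2} ⊆
      {z | z i ∈ {z : E × E | z.1 ≠ z.2}} ∪ {z | z i ∈ Prod.fst ⁻¹' {x | K < f x}} ∪
        (⋃ j ∈ Jᶜ.erase i, S Prod.fst Set.univ j) ∪
        (⋃ j ∈ Finset.univ.erase i, S Prod.fst {z | z.1 ≠ z.2} j ∪ S Prod.snd {z | z.1 ≠ z.2} j) := by
    intro z hz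
    by_cases hKz : K < f (z i).1
    · exact Or.inl (Or.inl (Or.inr hKz))
    have hKz' := not_lt.1 hKz
    rcases hz with hz | ⟨j, hj, ⟨hjJ, hd⟩ | ⟨hjne, hd | hd⟩⟩
    · exact Or.inl (Or.inl (Or.inl hz))
    · refine Or.inl (Or.inr ?_)
      simp only [Set.mem_iUnion]
      exact ⟨j, by simp [hj, hjJ], ⟨trivial, hKz', hd⟩⟩
    · refine Or.inr ?_
      simp only [Set.mem_iUnion]
      exact ⟨j, by simp [hj], Or.inl ⟨hjne, hKz', hd⟩⟩
    · refine Or.inr ?_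
      simp only [Set.mem_iUnion]
      exact ⟨j, by simp [hj], Or.inr ⟨hjne, hKz', hd⟩⟩
  have hpair : ∀ (φ : E × E → E), Measurable φ → ∀ A : Set (E × E), MeasurableSet A →
      ∀ j, j ≠ i → M (S φ A j) ≤ K * v * π A := fun φ hφ A hA j hj =>
    measure_pair_near_le hf hπ hj.symm hA hφ K v ρ hv
  refine (measure_mono hsub).trans ?_
  refine (measure_union_le _ _).trans (add_le_add ((measure_union_le _ _).trans
    (add_le_add ((measure_union_le _ _).trans (add_le_add ?_ ?_)) ?_)) ?_)
  · rw [hM, measure_eval_preimage i hne]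
    exact hc
  · rw [hM, measure_eval_preimage i (measurable_fst hK), ← Measure.map_apply measurable_fst hK, hπ]
  · calc M (⋃ j ∈ Jᶜ.erase i, S Prod.fst Set.univ j)
        ≤ ∑ j ∈ Jᶜ.erase i, M (S Prod.fst Set.univ j) := measure_biUnion_finset_le _ _
      _ ≤ ∑ j ∈ Jᶜ.erase i, K * v := by
          refine Finset.sum_le_sum fun j hj => ?_
          have := hpair Prod.fst measurable_fst Set.univ MeasurableSet.univ j
            (Finset.ne_of_mem_erase hj)
          rwa [measure_univ, mul_one] at this
      _ ≤ (Jᶜ.card : ℝ≥0∞) * (K * v) := by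
          rw [Finset.sum_const, nsmul_eq_mul]
          gcongr
          exact Finset.erase_subset _ _
      _ ≤ η * n * (K * v) := by gcongr
      _ = η * (K * (n * v)) := by ring
      _ ≤ _ := by gcongr
  · calc M (⋃ j ∈ Finset.univ.erase i,
          S Prod.fst {z | z.1 ≠ z.2} j ∪ S Prod.snd {z | z.1 ≠ z.2} j)
        ≤ ∑ j ∈ Finset.univ.erase i,
          M (S Prod.fst {z | z.1 ≠ z.2} j ∪ S Prod.snd {z | z.1 ≠ z.2} j) :=
          measure_biUnion_finset_le _ _
      _ ≤ ∑ j ∈ Finset.univ.erase i, 2 * (K * v * c) := by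
          refine Finset.sum_le_sum fun j hj => ?_
          rw [two_mul]
          refine (measure_union_le _ _).trans (add_le_add ?_ ?_)
          · exact (hpair _ measurable_fst _ hne j (Finset.ne_of_mem_erase hj)).trans (by gcongr)
          · exact (hpair _ measurable_snd _ hne j (Finset.ne_of_mem_erase hj)).trans (by gcongr)
      _ ≤ n * (2 * (K * v * c)) := by
          rw [Finset.sum_const, nsmul_eq_mul]
          gcongr
          exact (Finset.card_le_univ _).trans (by simp)
      _ = 2 * (K * (n * v) * c) := by ring
      _ ≤ _ := by gcongr

end Probability

theorem lintegral_pi_fst {E : Type*} [MeasurableSpace E] {π : Measure (E × E)} [IsProbabilityMeasure π] {n : ℕ}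
    {μ : Measure E} (hπ : π.map Prod.fst = μ)
    {u : (Fin n → E) → ℝ≥0∞} (hu : Measurable u) :
    ∫⁻ z, u (fun j => (z j).1) ∂(Measure.pi fun _ : Fin n => π) =
      ∫⁻ x, u x ∂(Measure.pi fun _ : Fin n => μ) := by
  have : IsProbabilityMeasure μ := hπ ▸ Measure.isProbabilityMeasure_map measurable_fst.aemeasurable
  exact (measurePreserving_pi (fun _ : Fin n => π) (fun _ : Fin n => μ)
    (fun _ => ⟨measurable_fst, hπ⟩)).lintegral_comp hu

theorem lintegral_pi_snd {E : Type*} [MeasurableSpace E] {π : Measure (E × E)} [IsProbabilityMeasure π] {n : ℕ}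
    {μ : Measure E} (hπ : π.map Prod.snd = μ)
    {u : (Fin n → E) → ℝ≥0∞} (hu : Measurable u) :
    ∫⁻ z, u (fun j => (z j).2) ∂(Measure.pi fun _ : Fin n => π) =
      ∫⁻ x, u x ∂(Measure.pi fun _ : Fin n => μ) := by
  have : IsProbabilityMeasure μ := hπ ▸ Measure.isProbabilityMeasure_map measurable_snd.aemeasurable
  exact (measurePreserving_pi (fun _ : Fin n => π) (fun _ : Fin n => μ)
    (fun _ => ⟨measurable_snd, hπ⟩)).lintegral_comp hu

/-- Zero unless the samples differ near `i`. Otherwise both costs are bounded by their neighbour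
counts, and the power `2 q + 2` is split into a small multiple of the `τ`-th power and a constant,
collected in `b`, which will be charged only on the exceptional event. -/
theorem IsLocalStatistic.sq_sub_sub_le {E : Type*} [PseudoMetricSpace E]
    {a ρ : ℝ} {q : ℕ} {θ : Multiset E → ℝ} (h : IsLocalStatistic a ρ q θ) {τ : ℝ}
    {κ L : ℝ} (hL : 0 ≤ L) (hκL : ∀ u : ℝ, 0 < u → u ^ (2 * (q : ℝ) + 2) ≤ κ * u ^ τ + L)
    (hκ : 0 ≤ κ)
    {n : ℕ} {J : Finset (Fin n)} {i : Fin n} (hi : i ∈ J) (x y : Fin n → E) {b : ℝ≥0∞}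
    (hb : DiffersNear ρ J i x y → 4 * ENNReal.ofReal L ≤ b) :
    ENNReal.ofReal ((θ ((Finset.univ : Finset (Fin n)).val.map x) - θ (J.val.map y) -
      (θ ((Finset.univ.erase i).val.map x) - θ ((J.erase i).val.map y))) ^ 2) ≤
    ENNReal.ofReal (a ^ 2) * (2 * ENNReal.ofReal κ * (ENNReal.ofReal
        ((1 + (((Finset.univ.erase i).filter fun j => dist (x j) (x i) ≤ ρ).card : ℝ)) ^ τ) +
      ENNReal.ofReal
        ((1 + (((Finset.univ.erase i).filter fun j => dist (y j) (y i) ≤ ρ).card : ℝ)) ^ τ)) +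
      b) := by
  have heq : θ ((Finset.univ : Finset (Fin n)).val.map x) - θ (J.val.map y) -
      (θ ((Finset.univ.erase i).val.map x) - θ ((J.erase i).val.map y)) =
      (θ ((Finset.univ : Finset (Fin n)).val.map x) - θ ((Finset.univ.erase i).val.map x)) -
      (θ (J.val.map y) - θ ((J.erase i).val.map y)) := by ring
  rw [heq]
  by_cases hd : DiffersNear ρ J i x y
  · have h1 := h.abs_sub_erase_le Finset.univ i x
    have h2 := h.abs_sub_erase_le J i y
    set u : ℝ := 1 + (((Finset.univ.erase i).filter fun j => dist (x j) (x i) ≤ ρ).card : ℝ)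
    set w : ℝ := 1 + (((Finset.univ.erase i).filter fun j => dist (y j) (y i) ≤ ρ).card : ℝ)
    have hu : 0 < u := by positivity
    have hw : 0 < w := by positivity
    have hp : ∀ s : ℝ, s ^ (2 * (q : ℝ) + 2) = (s ^ (q + 1)) ^ 2 := fun s => by
      rw [← pow_mul, ← Real.rpow_natCast]; push_cast; ring_nf
    have hu' := hκL u hu
    have hw' := hκL w hw
    rw [hp] at hu' hw'
    have h3 := abs_sub (θ ((Finset.univ : Finset (Fin n)).val.map x) -
      θ ((Finset.univ.erase i).val.map x)) (θ (J.val.map y) - θ ((J.erase i).val.map y))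
    have h4 : ((θ ((Finset.univ : Finset (Fin n)).val.map x) -
        θ ((Finset.univ.erase i).val.map x)) - (θ (J.val.map y) - θ ((J.erase i).val.map y))) ^ 2 ≤
        a ^ 2 * (2 * κ * (u ^ τ + w ^ τ) + 4 * L) := by
      calc _ ≤ (a * u ^ (q + 1) + a * w ^ (q + 1)) ^ 2 := by
            rw [← sq_abs]
            gcongr
            linarith
        _ ≤ a ^ 2 * (2 * ((u ^ (q + 1)) ^ 2 + (w ^ (q + 1)) ^ 2)) := by
            have := mul_nonneg (sq_nonneg a) (sq_nonneg (u ^ (q + 1) - w ^ (q + 1)))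
            linarith
        _ ≤ _ := by
            gcongr
            linarith
    refine (ENNReal.ofReal_le_ofReal h4).trans (le_trans (le_of_eq ?_)
      (mul_le_mul_right (add_le_add_right (hb hd) _) _))
    rw [ENNReal.ofReal_mul (sq_nonneg a), ENNReal.ofReal_add (by positivity) (by positivity),
      ENNReal.ofReal_mul (by positivity), ENNReal.ofReal_add (by positivity) (by positivity),
      ENNReal.ofReal_mul (by positivity), ENNReal.ofReal_mul (by positivity)]
    simp
  · rw [h.sub_eq_of_not_differsNear hi hd, sub_self]
    simp

theorem IsLocalStatistic.sq_sub_erase_le {E : Type*} [PseudoMetricSpace E] {a ρ : ℝ} {q : ℕ}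
    {θ : Multiset E → ℝ} (h : IsLocalStatistic a ρ q θ) {τ : ℝ}
    (hτ : 2 * (q : ℝ) + 2 ≤ τ) {n : ℕ} (J : Finset (Fin n)) (i : Fin n) (x : Fin n → E) :
    (θ (J.val.map x) - θ ((J.erase i).val.map x)) ^ 2 ≤ a ^ 2 *
      (1 + (((Finset.univ.erase i).filter fun j => dist (x j) (x i) ≤ ρ).card : ℝ)) ^ τ := by
  set u : ℝ := 1 + (((Finset.univ.erase i).filter fun j => dist (x j) (x i) ≤ ρ).card : ℝ) with hu
  have hu1 : 1 ≤ u := by simp [hu]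
  have h1 := h.abs_sub_erase_le J i x
  calc (θ (J.val.map x) - θ ((J.erase i).val.map x)) ^ 2 ≤ (a * u ^ (q + 1)) ^ 2 := by
        rw [← sq_abs]; gcongr
    _ = a ^ 2 * u ^ ((2 * q + 2 : ℕ) : ℝ) := by rw [Real.rpow_natCast]; ring
    _ ≤ a ^ 2 * u ^ τ := by
        gcongr
        push_cast
        exact hτ

/-! ### Variance bounds from Efron–Stein -/

section VarianceBounds

variable {E : Type*} [PseudoMetricSpace E] [MeasurableSpace E] {vol : Measure E} {f g : E → ℝ≥0∞} {π : Measure (E × E)}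
  [IsProbabilityMeasure π] {a ρ : ℝ} {q : ℕ} {θ : Multiset E → ℝ}

theorem efronStein_ofReal {α : Type*} [MeasurableSpace α] (μ : Measure α) [IsProbabilityMeasure μ]
    {C : ℝ} (n : ℕ) (f : (Fin n → α) → ℝ) (hf : Measurable f) (hfC : ∀ x, |f x| ≤ C)
    (g : Fin n → (Fin n → α) → ℝ) (hg : ∀ i, Measurable (g i)) (hgC : ∀ i x, |g i x| ≤ C)
    (hgi : ∀ i x a, g i (Function.update x i a) = g i x) :
    ENNReal.ofReal (∫ x, (f x - ∫ y, f y ∂(Measure.pi fun _ => μ)) ^ 2 ∂(Measure.pi fun _ => μ)) ≤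
      ∑ i, ∫⁻ x, ENNReal.ofReal ((f x - g i x) ^ 2) ∂(Measure.pi fun _ => μ) := by
  refine (ENNReal.ofReal_le_ofReal (efronStein μ n f hf hfC g hg hgC hgi)).trans ?_
  rw [ENNReal.ofReal_sum_of_nonneg fun i _ => integral_nonneg fun x => sq_nonneg _]
  refine Finset.sum_le_sum fun i _ => ?_
  rw [ofReal_integral_eq_lintegral_ofReal]
  · refine integrable_sq_of_forall_abs_le (C := 2 * C) (hf.sub (hg i)) fun x => ?_
    have := abs_sub (f x) (g i x)
    linarith [hfC x, hgC i x]
  · exact ae_of_all _ fun x => sq_nonneg _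

/-- For each `i`, the moment of order `τ` of the number of points of a sample of size `n` within
distance `ρ` of its `i`-th point (this point included) is at most `D`. -/
def IsMomentBound (μ : Measure E) (ρ τ : ℝ) (n : ℕ) (D : ℝ≥0∞) : Prop :=
  ∀ i : Fin n, ∫⁻ x, ENNReal.ofReal
      ((1 + (((Finset.univ.erase i).filter fun j => dist (x j) (x i) ≤ ρ).card : ℝ)) ^ τ)
    ∂(Measure.pi fun _ : Fin n => μ) ≤ D

/-- The variance of a local statistic of `n` points is at most of order `n`. -/
theorem IsLocalStatistic.variance_le (h : IsLocalStatistic a ρ q θ)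
    (hθ : ∀ n, Measurable fun x : Fin n → E => θ ((Finset.univ : Finset (Fin n)).val.map x))
    {τ : ℝ} (hτ : 2 * (q : ℝ) + 2 ≤ τ) {n : ℕ} {μ : Measure E} [IsProbabilityMeasure μ]
    {D : ℝ≥0∞} (hD : IsMomentBound μ ρ τ n D) :
    ENNReal.ofReal (∫ x, (θ ((Finset.univ : Finset (Fin n)).val.map x) -
      ∫ y, θ ((Finset.univ : Finset (Fin n)).val.map y) ∂(Measure.pi fun _ => μ)) ^ 2
        ∂(Measure.pi fun _ => μ)) ≤ n * (ENNReal.ofReal (a ^ 2) * D) := by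
  obtain ⟨C, hC0, hC⟩ := h.exists_bound n
  refine (efronStein_ofReal μ n _ (hθ n) (C := C) (fun x => hC _ (by simp))
    (fun i x => θ ((Finset.univ.erase i).val.map x))
    (fun i => measurable_finset_map hθ _ fun j => measurable_pi_apply j)
    (fun i x => hC _ ?_) ?_).trans ?_
  · rw [Multiset.card_map, Finset.card_val]
    exact (Finset.card_le_univ _).trans (by simp)
  · intro i x b
    congr 1
    refine Multiset.map_congr rfl fun j hj => ?_
    rw [Function.update_of_ne (Finset.ne_of_mem_erase (Finset.mem_def.2 hj))]
  · calc _ ≤ ∑ i : Fin n, ENNReal.ofReal (a ^ 2) * D := by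
          refine Finset.sum_le_sum fun i _ => ?_
          refine (lintegral_mono fun x => ENNReal.ofReal_le_ofReal
            (h.sq_sub_erase_le hτ Finset.univ i x)).trans ?_
          simp_rw [ENNReal.ofReal_mul (sq_nonneg a)]
          rw [lintegral_const_mul' _ _ ENNReal.ofReal_ne_top]
          gcongr
          exact hD i
      _ = _ := by simp

variable [OpensMeasurableSpace E] [SecondCountableTopology E]

theorem measurable_rpow_card_near (ρ τ : ℝ) {n : ℕ} (i : Fin n) :
    Measurable fun x : Fin n → E => ENNReal.ofReal
      ((1 + (((Finset.univ.erase i).filter fun j => dist (x j) (x i) ≤ ρ).card : ℝ)) ^ τ) :=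
  ENNReal.measurable_ofReal.comp (((measurable_card_near _ _
      (fun j => measurable_pi_apply j) (measurable_pi_apply i)).const_add 1).pow_const τ)

theorem IsLocalStatistic.lintegral_sq_sub_sub_le [MeasurableEq E] (h : IsLocalStatistic a ρ q θ)
    {τ κ L : ℝ} (hL : 0 ≤ L) (hκL : ∀ u : ℝ, 0 < u → u ^ (2 * (q : ℝ) + 2) ≤ κ * u ^ τ + L)
    (hκ : 0 ≤ κ) {μ ν : Measure E} (hπf : π.map Prod.fst = μ) (hπg : π.map Prod.snd = ν)
    {n : ℕ} {D : ℝ≥0∞} (hDf : IsMomentBound μ ρ τ n D) (hDg : IsMomentBound ν ρ τ n D)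
    {J : Finset (Fin n)} {i : Fin n} (hi : i ∈ J) {p : ℝ≥0∞}
    (hp : (Measure.pi fun _ : Fin n => π)
        {z | DiffersNear ρ J i (fun j => (z j).1) fun j => (z j).2} ≤ p) :
    ∫⁻ z, ENNReal.ofReal ((
      θ ((Finset.univ : Finset (Fin n)).val.map fun j => (z j).1) - θ (J.val.map fun j => (z j).2) -
      (θ ((Finset.univ.erase i).val.map fun j => (z j).1) -
        θ ((J.erase i).val.map fun j => (z j).2))) ^ 2) ∂(Measure.pi fun _ => π) ≤
      ENNReal.ofReal (a ^ 2) * (4 * ENNReal.ofReal κ * D + 4 * ENNReal.ofReal L * p) := by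
  have hmu := measurable_rpow_card_near (E := E) ρ τ i
  have e1 := (lintegral_pi_fst hπf hmu).trans_le (hDf i)
  have e2 := (lintegral_pi_snd hπg hmu).trans_le (hDg i)
  set U : (Fin n → E) → ℝ≥0∞ := fun x => ENNReal.ofReal
      ((1 + (((Finset.univ.erase i).filter fun j => dist (x j) (x i) ≤ ρ).card : ℝ)) ^ τ)
  set S : Set (Fin n → E × E) := {z | DiffersNear ρ J i (fun j => (z j).1) fun j => (z j).2}
  have hfst : Measurable fun z : Fin n → E × E => U fun j => (z j).1 := hmu.comp
    (measurable_pi_iff.2 fun j => measurable_fst.comp (measurable_pi_apply j))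
  have hsnd : Measurable fun z : Fin n → E × E => U fun j => (z j).2 := hmu.comp
    (measurable_pi_iff.2 fun j => measurable_snd.comp (measurable_pi_apply j))
  have hpt : ∀ z : Fin n → E × E, ENNReal.ofReal ((
      θ ((Finset.univ : Finset (Fin n)).val.map fun j => (z j).1) - θ (J.val.map fun j => (z j).2) -
      (θ ((Finset.univ.erase i).val.map fun j => (z j).1) -
        θ ((J.erase i).val.map fun j => (z j).2))) ^ 2) ≤
      ENNReal.ofReal (a ^ 2) * (2 * ENNReal.ofReal κ * (U (fun j => (z j).1) + U fun j => (z j).2) +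
        S.indicator (fun _ => 4 * ENNReal.ofReal L) z) := fun z =>
    h.sq_sub_sub_le hL hκL hκ hi _ _ fun hd => by rw [Set.indicator_of_mem (show z ∈ S from hd)]
  have hsum : Measurable fun z : Fin n → E × E => U (fun j => (z j).1) + U fun j => (z j).2 :=
    hfst.add hsnd
  refine (lintegral_mono hpt).trans ?_
  rw [lintegral_const_mul' _ _ ENNReal.ofReal_ne_top, lintegral_add_left (hsum.const_mul _),
    lintegral_const_mul _ hsum, lintegral_add_left hfst]
  have e4 : ∫⁻ z, S.indicator (fun _ => 4 * ENNReal.ofReal L) z ∂(Measure.pi fun _ : Fin n => π) ≤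
      4 * ENNReal.ofReal L * p := (lintegral_indicator_const_le S _).trans (by gcongr)
  calc _ ≤ ENNReal.ofReal (a ^ 2) *
        (2 * ENNReal.ofReal κ * (D + D) + 4 * ENNReal.ofReal L * p) := by gcongr
    _ = _ := by ring

/-- The variance of the difference of a local statistic on two coupled samples. -/
theorem IsLocalStatistic.variance_sub_le [MeasurableEq E] (h : IsLocalStatistic a ρ q θ)
    (hθ : ∀ n, Measurable fun x : Fin n → E => θ ((Finset.univ : Finset (Fin n)).val.map x))
    {τ : ℝ} (hτ : 2 * (q : ℝ) + 2 ≤ τ)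
    {κ L : ℝ} (hL : 0 ≤ L) (hκL : ∀ u : ℝ, 0 < u → u ^ (2 * (q : ℝ) + 2) ≤ κ * u ^ τ + L)
    (hκ : 0 ≤ κ) (hf : Measurable f) (hπf : π.map Prod.fst = vol.withDensity f)
    (hπg : π.map Prod.snd = vol.withDensity g)
    {n : ℕ} {D : ℝ≥0∞} (hDf : IsMomentBound (vol.withDensity f) ρ τ n D)
    (hDg : IsMomentBound (vol.withDensity g) ρ τ n D)
    (J : Finset (Fin n)) (K : ℝ≥0∞) {v V η c : ℝ≥0∞}
    (hv : ∀ z, vol (Metric.closedBall z ρ) ≤ v) (hV : n * v ≤ V)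
    (hη : (Jᶜ.card : ℝ≥0∞) ≤ η * n) (hc : π {z | z.1 ≠ z.2} ≤ c) :
    ENNReal.ofReal (∫ z, (θ ((Finset.univ : Finset (Fin n)).val.map fun j => (z j).1) -
        θ (J.val.map fun j => (z j).2) -
      ∫ z, (θ ((Finset.univ : Finset (Fin n)).val.map fun j => (z j).1) -
        θ (J.val.map fun j => (z j).2)) ∂(Measure.pi fun _ => π)) ^ 2
        ∂(Measure.pi fun _ => π)) ≤
      n * (ENNReal.ofReal (a ^ 2) * (4 * ENNReal.ofReal κ * D + 4 * ENNReal.ofReal L *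
        (c + vol.withDensity f {x | K < f x} + η * (K * V) + 2 * (K * V * c)) + η * D)) := by
  obtain ⟨C, hC0, hC⟩ := h.exists_bound n
  have hC' : ∀ (A : Finset (Fin n)) (x : Fin n → E), |θ (A.val.map x)| ≤ C := fun A x => hC _ (by
    rw [Multiset.card_map, Finset.card_val]
    exact (Finset.card_le_univ _).trans (by simp))
  have hC2 : ∀ (A B : Finset (Fin n)) (x y : Fin n → E),
      |θ (A.val.map x) - θ (B.val.map y)| ≤ 2 * C := fun A B x y => by
    have := abs_sub (θ (A.val.map x)) (θ (B.val.map y))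
    linarith [hC' A x, hC' B y]
  have hm1 : ∀ A : Finset (Fin n), Measurable fun z : Fin n → E × E =>
      θ (A.val.map fun j => (z j).1) := fun A =>
    measurable_finset_map hθ A fun j => measurable_fst.comp (measurable_pi_apply j)
  have hm2 : ∀ A : Finset (Fin n), Measurable fun z : Fin n → E × E =>
      θ (A.val.map fun j => (z j).2) := fun A =>
    measurable_finset_map hθ A fun j => measurable_snd.comp (measurable_pi_apply j)
  refine (efronStein_ofReal π n
    (fun z => θ ((Finset.univ : Finset (Fin n)).val.map fun j => (z j).1) -
        θ (J.val.map fun j => (z j).2)) ((hm1 _).sub (hm2 _)) (C := 2 * C)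
    (fun z => hC2 _ _ _ _)
    (fun i z => θ ((Finset.univ.erase i).val.map fun j => (z j).1) -
        θ ((J.erase i).val.map fun j => (z j).2))
    (fun i => (hm1 _).sub (hm2 _)) (fun i z => hC2 _ _ _ _) ?_).trans ?_
  · intro i z b
    congr 2
    · refine Multiset.map_congr rfl fun j hj => ?_
      rw [Function.update_of_ne (Finset.ne_of_mem_erase (Finset.mem_def.2 hj))]
    · refine Multiset.map_congr rfl fun j hj => ?_
      rw [Function.update_of_ne (Finset.ne_of_mem_erase (Finset.mem_def.2 hj))]
  set p := c + vol.withDensity f {x | K < f x} + η * (K * V) + 2 * (K * V * c) with hp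
  have hin : ∀ i ∈ J, ∫⁻ z, ENNReal.ofReal ((
      θ ((Finset.univ : Finset (Fin n)).val.map fun j => (z j).1) - θ (J.val.map fun j => (z j).2) -
      (θ ((Finset.univ.erase i).val.map fun j => (z j).1) -
        θ ((J.erase i).val.map fun j => (z j).2))) ^ 2) ∂(Measure.pi fun _ => π) ≤
      ENNReal.ofReal (a ^ 2) * (4 * ENNReal.ofReal κ * D + 4 * ENNReal.ofReal L * p) :=
    fun i hi => h.lintegral_sq_sub_sub_le hL hκL hκ hπf hπg hDf hDg hi
      (measure_differsNear_le hf hπf J i K hv hV hη hc)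
  -- An index outside `J` does not occur in the second sample, so the full cost in the first one
  -- remains. This is affordable because there are at most `η * n` such indices.
  have hout : ∀ i ∉ J, ∫⁻ z, ENNReal.ofReal ((
      θ ((Finset.univ : Finset (Fin n)).val.map fun j => (z j).1) - θ (J.val.map fun j => (z j).2) -
      (θ ((Finset.univ.erase i).val.map fun j => (z j).1) -
        θ ((J.erase i).val.map fun j => (z j).2))) ^ 2) ∂(Measure.pi fun _ => π) ≤
      ENNReal.ofReal (a ^ 2) * D := by
    intro i hi
    have hmu := measurable_rpow_card_near (E := E) ρ τ i
    rw [Finset.erase_eq_of_notMem hi]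
    simp only [sub_sub_sub_cancel_right]
    refine (lintegral_mono fun (z : Fin n → E × E) => ENNReal.ofReal_le_ofReal
      (h.sq_sub_erase_le hτ Finset.univ i fun j => (z j).1)).trans ?_
    simp_rw [ENNReal.ofReal_mul (sq_nonneg a)]
    rw [lintegral_const_mul' _ _ ENNReal.ofReal_ne_top]
    gcongr
    exact (lintegral_pi_fst hπf hmu).trans_le (hDf i)
  rw [← Finset.sum_add_sum_compl J]
  calc _ ≤ ∑ i ∈ J, ENNReal.ofReal (a ^ 2) * (4 * ENNReal.ofReal κ * D + 4 * ENNReal.ofReal L * p)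
        + ∑ i ∈ Jᶜ, ENNReal.ofReal (a ^ 2) * D :=
        add_le_add (Finset.sum_le_sum hin)
          (Finset.sum_le_sum fun i hi => hout i (Finset.mem_compl.1 hi))
    _ = J.card * (ENNReal.ofReal (a ^ 2) * (4 * ENNReal.ofReal κ * D + 4 * ENNReal.ofReal L * p))
        + Jᶜ.card * (ENNReal.ofReal (a ^ 2) * D) := by simp
    _ ≤ n * (ENNReal.ofReal (a ^ 2) * (4 * ENNReal.ofReal κ * D + 4 * ENNReal.ofReal L * p))
        + η * n * (ENNReal.ofReal (a ^ 2) * D) := by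
        gcongr
        exact (Finset.card_le_univ _).trans (by simp)
    _ = _ := by ring

end VarianceBounds

theorem exists_pos_ofReal_mul_le {W ε : ℝ≥0∞} (hW : W ≠ ∞) (hε : ε ≠ 0) :
    ∃ δ : ℝ, 0 < δ ∧ ENNReal.ofReal δ * W ≤ ε := by
  obtain ⟨δ, hδ, h⟩ := ENNReal.exists_nnreal_pos_mul_lt hW hε
  exact ⟨δ, hδ, by simpa using h.le⟩

/-- Continuity from above; an integrable density is finite almost everywhere. -/
theorem tendsto_withDensity_gt {E : Type*} [MeasurableSpace E] {vol : Measure E} {f : E → ℝ≥0∞}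
    (hf : Measurable f) (hf1 : ∫⁻ x, f x ∂vol ≠ ∞) :
    Tendsto (fun K : ℕ => vol.withDensity f {x | (K : ℝ≥0∞) < f x}) atTop (𝓝 0) := by
  have hm : ∀ K : ℕ, MeasurableSet {x | (K : ℝ≥0∞) < f x} := fun K =>
    measurableSet_lt measurable_const hf
  have h := tendsto_measure_iInter_atTop (μ := vol.withDensity f)
    (fun K => (hm K).nullMeasurableSet)
    (fun K L hKL x (hx : (L : ℝ≥0∞) < f x) => lt_of_le_of_lt (by exact_mod_cast hKL) hx)
    ⟨0, ne_top_of_le_ne_top hf1 ((measure_mono (Set.subset_univ _)).trans (by simp))⟩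
  have h0 : vol.withDensity f (⋂ K : ℕ, {x | (K : ℝ≥0∞) < f x}) = 0 := by
    have hsub : (⋂ K : ℕ, {x | (K : ℝ≥0∞) < f x}) ⊆ {x | f x = ∞} := by
      intro x hx
      by_contra hne
      obtain ⟨K, hK⟩ := ENNReal.exists_nat_gt hne
      exact absurd (Set.mem_iInter.1 hx K) (not_lt.2 hK.le)
    refine measure_mono_null hsub (withDensity_absolutelyContinuous _ _ ?_)
    have := ae_lt_top hf hf1
    rw [ae_iff] at this
    simpa using this
  rwa [h0] at h

/-- Coupled samples: the variance of the difference of a local statistic is small compared to the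
sample size, uniformly over the statistics, the sample sizes and the second density. -/
theorem exists_variance_sub_le {E : Type*} [PseudoMetricSpace E] [MeasurableSpace E]
    [OpensMeasurableSpace E] [SecondCountableTopology E] [MeasurableEq E] (vol : Measure E)
    [SFinite vol] {f : E → ℝ≥0∞} (hf : Measurable f) (hf1 : ∫⁻ x, f x ∂vol = 1) (a : ℝ) (q : ℕ)
    {τ : ℝ} (hτ : 2 * (q : ℝ) + 2 < τ) {B V : ℝ≥0∞} (hB : B ≠ ∞) (hV : V ≠ ∞)
    (hfB : ∫⁻ x, f x ^ (τ + 1) ∂vol ≤ B) {ε : ℝ} (hε : 0 < ε) :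
    ∃ δ : ℝ, 0 < δ ∧ ∀ (θ : Multiset E → ℝ) (ρ : ℝ), IsLocalStatistic a ρ q θ →
      (∀ n, Measurable fun x : Fin n → E => θ ((Finset.univ : Finset (Fin n)).val.map x)) →
      ∀ (n : ℕ) (v : ℝ≥0∞), (∀ z, vol (Metric.closedBall z ρ) ≤ v) → n * v ≤ V →
      ∀ (J : Finset (Fin n)), (Jᶜ.card : ℝ≥0∞) ≤ ENNReal.ofReal δ * n →
      ∀ g : E → ℝ≥0∞, Measurable g → ∫⁻ x, g x ∂vol = 1 → ∫⁻ x, g x ^ (τ + 1) ∂vol ≤ B →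
      ∫⁻ x, (f x - g x) ∂vol ≤ ENNReal.ofReal δ →
      ∫ z, (θ ((Finset.univ : Finset (Fin n)).val.map fun j => (z j).1) -
        θ (J.val.map fun j => (z j).2) -
      ∫ z, (θ ((Finset.univ : Finset (Fin n)).val.map fun j => (z j).1) -
        θ (J.val.map fun j => (z j).2)) ∂(Measure.pi fun _ => densityCoupling vol f g)) ^ 2
        ∂(Measure.pi fun _ => densityCoupling vol f g) ≤ n * ε := by
  have hq : (0 : ℝ) ≤ q := by positivity
  obtain ⟨D, hD, hmom⟩ := exists_moment_bound (E := E) (τ := τ) (by linarith) hB hV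
  set A := ENNReal.ofReal (a ^ 2) with hA
  have hAt : A ≠ ∞ := ENNReal.ofReal_ne_top
  have hε3 : ENNReal.ofReal (ε / 3) ≠ 0 := by
    rw [Ne, ENNReal.ofReal_eq_zero, not_le]; positivity
  -- The order of choice matters: `κ` makes the moment term small, `L` depends on `κ`, the
  -- truncation level `K` of `f` depends on `L`, and `δ` comes last. Only `f` is truncated, so `δ`
  -- does not depend on `g`. Each of the three groups of terms receives `ε / 3`.
  obtain ⟨κ, hκ, hκε⟩ := exists_pos_ofReal_mul_le (W := A * (4 * D)) (by finiteness) hε3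
  obtain ⟨L, hL, hκL⟩ := exists_rpow_le_add (T := 2 * (q : ℝ) + 2) (by positivity) hτ hκ
  obtain ⟨δ₁, hδ₁, hδ₁ε⟩ := exists_pos_ofReal_mul_le (W := A * (4 * ENNReal.ofReal L))
    (by finiteness) hε3
  obtain ⟨K, hK⟩ := ((tendsto_withDensity_gt hf (hf1 ▸ ENNReal.one_ne_top)).eventually_le_const
    (ENNReal.ofReal_pos.2 hδ₁)).exists
  obtain ⟨δ, hδ, hδε⟩ := exists_pos_ofReal_mul_le
    (W := A * (4 * ENNReal.ofReal L * (1 + K * V + 2 * (K * V)) + D)) (by finiteness) hε3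
  refine ⟨δ, hδ, fun θ ρ hloc hθ n v hv hnv J hJ g hg hg1 hgB hfg => ?_⟩
  have hπ := isProbabilityMeasure_densityCoupling hf hg hf1 hg1
  have hmain := hloc.variance_sub_le hθ hτ.le hL hκL hκ.le hf
    (map_fst_densityCoupling hf hg hf1 hg1) (map_snd_densityCoupling hf hg hf1 hg1)
    (hmom vol f hf hf1 hfB ρ v hv n hnv) (hmom vol g hg hg1 hgB ρ v hv n hnv) J K hv hnv hJ
    ((densityCoupling_ne_le hf hg hf1 hg1).trans hfg)
  refine (ENNReal.ofReal_le_ofReal_iff (by positivity)).1 (hmain.trans ?_)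
  rw [ENNReal.ofReal_mul (by positivity), ENNReal.ofReal_natCast]
  gcongr
  calc _ ≤ A * (4 * ENNReal.ofReal κ * D + 4 * ENNReal.ofReal L *
        (ENNReal.ofReal δ + ENNReal.ofReal δ₁ + ENNReal.ofReal δ * (K * V) +
          2 * (K * V * ENNReal.ofReal δ)) + ENNReal.ofReal δ * D) := by gcongr
    _ = ENNReal.ofReal κ * (A * (4 * D)) + ENNReal.ofReal δ₁ * (A * (4 * ENNReal.ofReal L)) +
        ENNReal.ofReal δ * (A * (4 * ENNReal.ofReal L * (1 + K * V + 2 * (K * V)) + D)) := by ring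
    _ ≤ ENNReal.ofReal (ε / 3) + ENNReal.ofReal (ε / 3) + ENNReal.ofReal (ε / 3) := by gcongr
    _ = ENNReal.ofReal ε := by
        rw [← ENNReal.ofReal_add (by positivity) (by positivity),
          ← ENNReal.ofReal_add (by positivity) (by positivity)]
        ring_nf

/-! ### Lipschitz functionals of standardized vectors -/

theorem integral_abs_le_sqrt {α : Type*} {_ : MeasurableSpace α} {μ : Measure α}
    [IsProbabilityMeasure μ] {u : α → ℝ} (hu : Measurable u) {C : ℝ} (hC : ∀ x, |u x| ≤ C) :
    ∫ x, |u x| ∂μ ≤ Real.sqrt (∫ x, u x ^ 2 ∂μ) := by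
  refine Real.le_sqrt_of_sq_le ?_
  have := sq_integral_le (μ := μ) (u := fun x => |u x|) hu.abs (C := C)
    (fun x => by rw [abs_abs]; exact hC x)
  simpa only [sq_abs] using this

/-- The difference of the two arguments of `v` is `α'` times the centred `A - B` plus `α' - β` times
the centred `B`. Each coordinate is bounded in `L^1` by its standard deviation. -/
theorem abs_integral_lipschitz_sub_le {α : Type*} {_ : MeasurableSpace α} {μ : Measure α}
    [IsProbabilityMeasure μ] {k : ℕ} {A B : α → Fin k → ℝ} (hA : Measurable A) (hB : Measurable B)
    {C : ℝ} (hAC : ∀ x i, |A x i| ≤ C) (hBC : ∀ x i, |B x i| ≤ C)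
    {v : (Fin k → ℝ) → ℝ} {Λ : NNReal} (hv : LipschitzWith Λ v) (hvb : ∃ C, ∀ y, |v y| ≤ C)
    (α' β : ℝ) {s t : ℝ}
    (hs : ∀ i, |α'| * Real.sqrt (∫ x, (A x i - B x i - ∫ y, (A y i - B y i) ∂μ) ^ 2 ∂μ) ≤ s)
    (ht : ∀ i, |α' - β| * Real.sqrt (∫ x, (B x i - ∫ y, B y i ∂μ) ^ 2 ∂μ) ≤ t) :
    |∫ x, v (α' • (A x - ∫ y, A y ∂μ)) ∂μ - ∫ x, v (β • (B x - ∫ y, B y ∂μ)) ∂μ| ≤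
      Λ * (k * (s + t)) := by
  obtain ⟨Cv, hCv⟩ := hvb
  have hAi : ∀ i, Measurable fun x => A x i := fun i => (measurable_pi_apply i).comp hA
  have hBi : ∀ i, Measurable fun x => B x i := fun i => (measurable_pi_apply i).comp hB
  have hAint : ∀ i, Integrable (fun x => A x i) μ := fun i =>
    integrable_of_forall_abs_le (hAi i) fun x => hAC x i
  have hBint : ∀ i, Integrable (fun x => B x i) μ := fun i =>
    integrable_of_forall_abs_le (hBi i) fun x => hBC x i
  have hEA : ∀ i, (∫ y, A y ∂μ) i = ∫ y, A y i ∂μ := fun i => eval_integral hAint i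
  have hEB : ∀ i, (∫ y, B y ∂μ) i = ∫ y, B y i ∂μ := fun i => eval_integral hBint i
  have hABC : ∀ i x, |A x i - B x i| ≤ 2 * C := fun i x => by
    have := abs_sub (A x i) (B x i)
    linarith [hAC x i, hBC x i]
  have hvA : Integrable (fun x => v (α' • (A x - ∫ y, A y ∂μ))) μ :=
    integrable_of_forall_abs_le
      (hv.continuous.measurable.comp ((hA.sub_const _).const_smul α')) fun x => hCv _
  have hvB : Integrable (fun x => v (β • (B x - ∫ y, B y ∂μ))) μ :=
    integrable_of_forall_abs_le
      (hv.continuous.measurable.comp ((hB.sub_const _).const_smul β)) fun x => hCv _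
  set P : Fin k → α → ℝ := fun i x => A x i - B x i - ∫ y, (A y i - B y i) ∂μ with hP
  set Q : Fin k → α → ℝ := fun i x => B x i - ∫ y, B y i ∂μ with hQ
  have hPm : ∀ i, Measurable (P i) := fun i => ((hAi i).sub (hBi i)).sub_const _
  have hQm : ∀ i, Measurable (Q i) := fun i => (hBi i).sub_const _
  have hPC : ∀ i x, |P i x| ≤ 4 * C := fun i x => by
    have h1 := abs_sub (A x i - B x i) (∫ y, (A y i - B y i) ∂μ)
    have h2 := abs_integral_le_of_forall (μ := μ) (hABC i)
    simp only [hP]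
    linarith [hABC i x]
  have hQC : ∀ i x, |Q i x| ≤ 2 * C := fun i x => by
    have h1 := abs_sub (B x i) (∫ y, B y i ∂μ)
    have h2 := abs_integral_le_of_forall (μ := μ) fun x => hBC x i
    simp only [hQ]
    linarith [hBC x i]
  have hPi : ∀ i, Integrable (fun x => |P i x|) μ := fun i =>
    (integrable_of_forall_abs_le (hPm i) (hPC i)).abs
  have hQi : ∀ i, Integrable (fun x => |Q i x|) μ := fun i =>
    (integrable_of_forall_abs_le (hQm i) (hQC i)).abs
  have hpt : ∀ x, |v (α' • (A x - ∫ y, A y ∂μ)) - v (β • (B x - ∫ y, B y ∂μ))| ≤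
      Λ * ∑ i, (|α'| * |P i x| + |α' - β| * |Q i x|) := by
    intro x
    have h1 := hv.dist_le_mul (α' • (A x - ∫ y, A y ∂μ)) (β • (B x - ∫ y, B y ∂μ))
    rw [Real.dist_eq] at h1
    refine h1.trans ?_
    gcongr
    have hnn : ∀ i, 0 ≤ |α'| * |P i x| + |α' - β| * |Q i x| := fun i => by positivity
    refine (dist_pi_le_iff (Finset.sum_nonneg fun i _ => hnn i)).2 fun i => ?_
    refine le_trans ?_ (Finset.single_le_sum (fun j _ => hnn j) (Finset.mem_univ i))
    rw [Real.dist_eq, ← abs_mul, ← abs_mul]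
    refine le_trans (le_of_eq ?_) (abs_add_le _ _)
    congr 1
    simp only [Pi.smul_apply, Pi.sub_apply, smul_eq_mul, hEA, hEB, hP, hQ]
    rw [integral_sub (hAint i) (hBint i)]
    ring
  rw [← integral_sub hvA hvB]
  have hterm : ∀ i, Integrable (fun x => |α'| * |P i x| + |α' - β| * |Q i x|) μ := fun i =>
    ((hPi i).const_mul _).add ((hQi i).const_mul _)
  calc _ ≤ ∫ x, |v (α' • (A x - ∫ y, A y ∂μ)) - v (β • (B x - ∫ y, B y ∂μ))| ∂μ :=
        abs_integral_le_integral_abs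
    _ ≤ ∫ x, Λ * ∑ i, (|α'| * |P i x| + |α' - β| * |Q i x|) ∂μ :=
        integral_mono (hvA.sub hvB).abs
          ((integrable_finsetSum _ fun i _ => hterm i).const_mul _) hpt
    _ = Λ * ∑ i, (|α'| * ∫ x, |P i x| ∂μ + |α' - β| * ∫ x, |Q i x| ∂μ) := by
        rw [integral_const_mul, integral_finsetSum _ fun i _ => hterm i]
        congr 1
        refine Finset.sum_congr rfl fun i _ => ?_
        rw [integral_add ((hPi i).const_mul _) ((hQi i).const_mul _), integral_const_mul,
          integral_const_mul]
    _ ≤ Λ * ∑ i : Fin k, (s + t) := by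
        gcongr with i
        · exact (mul_le_mul_of_nonneg_left (integral_abs_le_sqrt (hPm i) (hPC i))
            (abs_nonneg _)).trans (hs i)
        · exact (mul_le_mul_of_nonneg_left (integral_abs_le_sqrt (hQm i) (hQC i))
            (abs_nonneg _)).trans (ht i)
    _ = _ := by rw [Finset.sum_const, Finset.card_univ, Fintype.card_fin, nsmul_eq_mul]

/-! ### Comparison of standardized laws -/

/-- The law of `N^{-1/2} (ψ(s Y_N) - E ψ(s Y_N))`, where `Y_N` consists of `N` independent points with
common law `Q`. -/
noncomputable def scaledLaw {d k : ℕ} (ψ : Multiset (Euc d) → Fin k → ℝ) (s : ℝ) (N : ℕ)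
    (Q : Measure (Euc d)) : Measure (Fin k → ℝ) :=
  (Measure.pi fun _ : Fin N => Q).map fun x =>
    (Real.sqrt N)⁻¹ • (ψ (pointMultiset fun i => s • x i) -
      ∫ y, ψ (pointMultiset fun i => s • y i) ∂(Measure.pi fun _ : Fin N => Q))

/-- In `scaledLaw` the scale is a separate parameter so that samples of different sizes can be
compared at one common scale. -/
theorem standardizedLaw_eq_scaledLaw {d k : ℕ} (ψ : Multiset (Euc d) → Fin k → ℝ) (n : ℕ)
    (Q : Measure (Euc d)) :
    standardizedLaw ψ n Q = scaledLaw ψ ((n : ℝ) ^ (1 / (d : ℝ))) n Q := rfl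

section

variable {d k : ℕ} {ψ : Multiset (Euc d) → Fin k → ℝ}

theorem MeasurableStatistic.measurable_smul (hψ : MeasurableStatistic ψ) (s : ℝ) (N : ℕ) :
    Measurable fun x : Fin N → Euc d => ψ (pointMultiset fun i => s • x i) :=
  (hψ N).comp (measurable_pi_iff.2 fun i => (measurable_pi_apply i).const_smul s)

theorem MeasurableStatistic.measurable_smul_sub (hψ : MeasurableStatistic ψ) (s b : ℝ) (N : ℕ)
    (c : Fin k → ℝ) :
    Measurable fun x : Fin N → Euc d => b • (ψ (pointMultiset fun i => s • x i) - c) :=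
  ((hψ.measurable_smul s N).sub_const c).const_smul b

/-- Realizes the law on any space carrying such a sample, in particular on the space of coupled
pairs. -/
theorem integral_scaledLaw (hψ : MeasurableStatistic ψ) (s : ℝ) (N : ℕ) {Q : Measure (Euc d)}
    {α : Type*} {_ : MeasurableSpace α} {P : Measure α} {T : α → Fin N → Euc d}
    (hT : MeasurePreserving T P (Measure.pi fun _ => Q)) {v : (Fin k → ℝ) → ℝ}
    (hv : Continuous v) :
    ∫ y, v y ∂(scaledLaw ψ s N Q) = ∫ z, v ((Real.sqrt N)⁻¹ •
      (ψ (pointMultiset fun i => s • T z i) -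
        ∫ z, ψ (pointMultiset fun i => s • T z i) ∂P)) ∂P := by
  have hm := hψ.measurable_smul s N
  rw [scaledLaw, ← hT.map_eq, integral_map hT.measurable.aemeasurable hm.aestronglyMeasurable,
    integral_map (hψ.measurable_smul_sub s _ N _).aemeasurable hv.aestronglyMeasurable,
    integral_map hT.measurable.aemeasurable]
  exact (hv.measurable.comp (hψ.measurable_smul_sub s _ N _)).aestronglyMeasurable

theorem scaledLaw_map_smul (hψ : MeasurableStatistic ψ) (s c : ℝ) (N : ℕ) (Q : Measure (Euc d))
    [IsProbabilityMeasure Q] :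
    scaledLaw ψ s N (Q.map fun x => c • x) = scaledLaw ψ (s * c) N Q := by
  have hc : Measurable fun x : Euc d => c • x := measurable_id.const_smul c
  have : IsProbabilityMeasure (Q.map fun x => c • x) :=
    Measure.isProbabilityMeasure_map hc.aemeasurable
  have hT := measurePreserving_pi (fun _ : Fin N => Q) (fun _ : Fin N => Q.map fun x => c • x)
    (fun _ => ⟨hc, rfl⟩)
  have hm := hψ.measurable_smul s N
  rw [scaledLaw, ← hT.map_eq, integral_map hT.measurable.aemeasurable hm.aestronglyMeasurable,
    Measure.map_map (hψ.measurable_smul_sub s _ N _) hT.measurable, scaledLaw]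
  simp only [Function.comp_def, smul_smul]

theorem isProbabilityMeasure_standardizedLaw (hψ : MeasurableStatistic ψ) (n : ℕ)
    (Q : Measure (Euc d)) [IsProbabilityMeasure Q] :
    IsProbabilityMeasure (standardizedLaw ψ n Q) :=
  Measure.isProbabilityMeasure_map
    (hψ.measurable_smul_sub ((n : ℝ) ^ (1 / (d : ℝ))) _ n _).aemeasurable

theorem measurePreserving_pi_comp {α ι κ : Type*} [MeasurableSpace α] [Fintype ι] [Fintype κ]
    (μ : Measure α) [IsProbabilityMeasure μ] {e : ι → κ} (he : Function.Injective e) :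
    MeasurePreserving (fun (z : κ → α) i => z (e i)) (Measure.pi fun _ => μ)
      (Measure.pi fun _ => μ) := by
  have hind : iIndepFun (fun (j : κ) (z : κ → α) => z j) (Measure.pi fun _ : κ => μ) :=
    iIndepFun_pi (X := fun _ => id) fun _ => aemeasurable_id
  refine ⟨measurable_pi_iff.2 fun i => measurable_pi_apply _, ?_⟩
  rw [(iIndepFun_iff_map_fun_eq_pi_map fun i => (measurable_pi_apply (e i)).aemeasurable).1
    (hind.precomp he)]
  congr 1 with i : 1
  exact (measurePreserving_eval (fun _ : κ => μ) (e i)).map_eq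

/-- The scale `n^{1/d}` is exactly the one for which `n` times the ball volume is independent of
`n`. -/
theorem card_mul_volume_closedBall (hd : 0 < d) {R : ℝ} (hR : 0 ≤ R) {n : ℕ} (hn : 0 < n)
    (z : Euc d) :
    (n : ℝ≥0∞) * volume (Metric.closedBall z (R / (n : ℝ) ^ (1 / (d : ℝ)))) =
      volume (Metric.closedBall (0 : Euc d) R) := by
  have hn' : (0 : ℝ) < n := by exact_mod_cast hn
  rw [Measure.addHaar_closedBall _ _ (by positivity), Measure.addHaar_closedBall _ _ hR,
    ← mul_assoc]
  congr 1
  rw [finrank_euclideanSpace_fin, div_pow, ← Real.rpow_natCast ((n : ℝ) ^ (1 / (d : ℝ))),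
    ← Real.rpow_mul hn'.le, one_div_mul_cancel (by positivity), Real.rpow_one,
    ← ENNReal.ofReal_natCast n, ← ENNReal.ofReal_mul hn'.le]
  congr 1
  field_simp

/-- Uniform continuity of the standardized law with respect to the sampling density and the sample
size, tested against a bounded Lipschitz function. -/
theorem exists_integral_scaledLaw_sub_le (hd : 0 < d) (hψ : MeasurableStatistic ψ) {a R : ℝ} {q : ℕ}
    (hR : 0 ≤ R) (hloc : ∀ i, IsLocalStatistic a R q fun S => ψ S i)
    {f : Euc d → ℝ≥0∞} (hf : Measurable f) (hf1 : ∫⁻ x, f x = 1)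
    {τ : ℝ} (hτ : 2 * (q : ℝ) + 2 < τ) {B : ℝ≥0∞} (hB : B ≠ ∞)
    (hfB : ∫⁻ x, f x ^ (τ + 1) ≤ B)
    {v : (Fin k → ℝ) → ℝ} {Λ : NNReal} (hv : LipschitzWith Λ v) (hvb : ∃ C, ∀ y, |v y| ≤ C)
    {ε : ℝ} (hε : 0 < ε) :
    ∃ δ : ℝ, 0 < δ ∧ ∀ n N : ℕ, 0 < N → N ≤ n → (n : ℝ) - N ≤ δ * n →
      ∀ g : Euc d → ℝ≥0∞, Measurable g → ∫⁻ x, g x = 1 → ∫⁻ x, g x ^ (τ + 1) ≤ B →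
      ∫⁻ x, (f x - g x) ≤ ENNReal.ofReal δ →
      |∫ y, v y ∂(scaledLaw ψ ((n : ℝ) ^ (1 / (d : ℝ))) n (volume.withDensity f)) -
        ∫ y, v y ∂(scaledLaw ψ ((n : ℝ) ^ (1 / (d : ℝ))) N (volume.withDensity g))| ≤ ε := by
  have hq : (0 : ℝ) ≤ q := by positivity
  set V := volume (Metric.closedBall (0 : Euc d) R) with hVdef
  have hV : V ≠ ∞ := measure_closedBall_lt_top.ne
  obtain ⟨D, hD, hmom⟩ := exists_moment_bound (E := Euc d) (τ := τ) (by linarith) hB hV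
  set W := (ENNReal.ofReal (a ^ 2) * D).toReal with hW
  have hW0 : 0 ≤ W := ENNReal.toReal_nonneg
  -- Two errors of size `η` in each of `k` coordinates give `Λ * k * 2 η ≤ ε`; the added `1` avoids
  -- division by zero.
  set η := ε / (2 * (Λ * k + 1)) with hη
  have hη0 : 0 < η := by positivity
  obtain ⟨δ₁, hδ₁, hvar⟩ := exists_variance_sub_le (volume : Measure (Euc d)) hf hf1 a q hτ hB hV hfB
    (ε := η ^ 2) (by positivity)
  -- Controls the change of normalization: the standard deviation for `N` points is at most `√(N
  -- W)`, and `|1/√n - 1/√N| * √N ≤ (n - N) / n`.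
  set δ₂ := η / (Real.sqrt W + 1) with hδ₂
  have hδ₂0 : 0 < δ₂ := by positivity
  refine ⟨min δ₁ δ₂, lt_min hδ₁ hδ₂0, fun n N hN hNn hnN g hg hg1 hgB hfg => ?_⟩
  have hn : 0 < n := hN.trans_le hNn
  have hn' : (0 : ℝ) < n := by exact_mod_cast hn
  have hN' : (0 : ℝ) < N := by exact_mod_cast hN
  set s := (n : ℝ) ^ (1 / (d : ℝ)) with hs
  have hs0 : 0 < s := by positivity
  set vv := volume (Metric.closedBall (0 : Euc d) (R / s)) with hvv
  have hball : ∀ z : Euc d, volume (Metric.closedBall z (R / s)) ≤ vv := fun z =>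
    (Measure.addHaar_closedBall_center _ _ _).le
  have hnv : n * vv ≤ V := (card_mul_volume_closedBall hd hR hn 0).le
  have hNv : N * vv ≤ V := le_trans (by gcongr) hnv
  have hμg := isProbabilityMeasure_withDensity' hg1
  set π := densityCoupling volume f g with hπ
  have : IsProbabilityMeasure π := isProbabilityMeasure_densityCoupling hf hg hf1 hg1
  have hθloc : ∀ i, IsLocalStatistic a (R / s) q fun S => ψ (S.map fun x => s • x) i := fun i =>
    (hloc i).comp_smul hs0
  have hθm : ∀ i (M : ℕ), Measurable fun x : Fin M → Euc d =>
      ψ (((Finset.univ : Finset (Fin M)).val.map x).map fun x => s • x) i := by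
    intro i M
    have := (measurable_pi_apply i).comp (hψ.measurable_smul s M)
    simpa only [Multiset.map_map, pointMultiset, Function.comp_def] using this
  have hbound : ∃ C, ∀ (x : Multiset (Euc d)) i, x.card ≤ n → |ψ x i| ≤ C := by
    have hb := fun i => (hloc i).exists_bound n
    choose C hC0 hC using hb
    exact ⟨∑ i, C i, fun x i hx => (hC i x hx).trans
      (Finset.single_le_sum (fun j _ => hC0 j) (Finset.mem_univ i))⟩
  obtain ⟨C, hC⟩ := hbound
  set T₁ : (Fin n → Euc d × Euc d) → Fin n → Euc d := fun z j => (z j).1 with hT₁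
  -- The smaller sample consists of the second coordinates of the first `N` pairs, so `J` below is
  -- the set of these indices and its complement has `n - N` elements.
  set T₂ : (Fin n → Euc d × Euc d) → Fin N → Euc d := fun z j => (z (Fin.castLE hNn j)).2 with hT₂
  have hmf : MeasurePreserving T₁ (Measure.pi fun _ => π)
      (Measure.pi fun _ => volume.withDensity f) :=
    have := isProbabilityMeasure_withDensity' hf1
    measurePreserving_pi _ _ fun _ => ⟨measurable_fst, map_fst_densityCoupling hf hg hf1 hg1⟩
  have hmg : MeasurePreserving T₂ (Measure.pi fun _ => π)
      (Measure.pi fun _ => volume.withDensity g) :=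
    (measurePreserving_pi_comp (volume.withDensity g) (Fin.castLE_injective hNn)).comp
      (measurePreserving_pi (fun _ : Fin n => π) (fun _ => volume.withDensity g)
        fun _ => ⟨measurable_snd, map_snd_densityCoupling hf hg hf1 hg1⟩)
  rw [integral_scaledLaw hψ s n hmf hv.continuous, integral_scaledLaw hψ s N hmg hv.continuous]
  set J : Finset (Fin n) := Finset.univ.map (Fin.castLEEmb hNn) with hJ
  have hJc : (Jᶜ.card : ℝ≥0∞) ≤ ENNReal.ofReal δ₁ * n := by
    have h1 : (Jᶜ.card : ℝ) = n - N := by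
      rw [Finset.card_compl, hJ, Finset.card_map, Finset.card_univ, Fintype.card_fin,
        Fintype.card_fin, Nat.cast_sub hNn]
    rw [← ENNReal.ofReal_natCast, ← ENNReal.ofReal_natCast n, ← ENNReal.ofReal_mul hδ₁.le, h1]
    refine ENNReal.ofReal_le_ofReal (hnN.trans ?_)
    gcongr
    exact min_le_left _ _
  have hx : ∀ z, (((Finset.univ : Finset (Fin n)).val.map fun j => (z j).1).map fun x => s • x) =
      pointMultiset fun i => s • T₁ z i := fun z => by rw [Multiset.map_map]; rfl
  have hy : ∀ z, ((J.val.map fun j => (z j).2).map fun x => s • x) =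
      pointMultiset fun i => s • T₂ z i := fun z => by
    rw [hJ, Finset.map_val, Multiset.map_map, Multiset.map_map]; rfl
  have hfin := abs_integral_lipschitz_sub_le (μ := Measure.pi fun _ : Fin n => π)
    (A := fun z => ψ (pointMultiset fun i => s • T₁ z i))
    (B := fun z => ψ (pointMultiset fun i => s • T₂ z i))
    ((hψ.measurable_smul s n).comp hmf.measurable) ((hψ.measurable_smul s N).comp hmg.measurable)
    (C := C) (fun z i => hC _ i (by simp [pointMultiset]))
    (fun z i => hC _ i (by simpa [pointMultiset] using hNn)) hv hvb
    (Real.sqrt n)⁻¹ (Real.sqrt N)⁻¹ (s := η) (t := η) ?_ ?_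
  · refine hfin.trans ?_
    have : (Λ : ℝ) * (k * (η + η)) = (Λ * k / (Λ * k + 1)) * ε := by
      rw [hη]; field_simp; ring
    rw [this]
    have h1 : (Λ * k / (Λ * k + 1) : ℝ) ≤ 1 := by
      rw [div_le_one (by positivity)]; linarith
    nlinarith
  · intro i
    have h1 := hvar _ _ (hθloc i) (hθm i) n vv hball hnv J hJc g hg hg1 hgB
      (hfg.trans (ENNReal.ofReal_le_ofReal (min_le_left _ _)))
    simp only [hx, hy] at h1
    rw [abs_of_nonneg (by positivity)]
    calc _ ≤ (Real.sqrt n)⁻¹ * Real.sqrt (n * η ^ 2) := by gcongr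
      _ = η := by
        rw [Real.sqrt_mul hn'.le, Real.sqrt_sq hη0.le]
        field_simp
  · intro i
    have h1 := (hθloc i).variance_le (hθm i) hτ.le (hmom volume g hg hg1 hgB _ vv hball N hNv)
    have h2 : ∀ x : Fin N → Euc d, (((Finset.univ : Finset (Fin N)).val.map x).map
        fun x => s • x) = pointMultiset fun i => s • x i := fun x => by rw [Multiset.map_map]; rfl
    simp only [h2] at h1
    have hmi : Measurable fun x : Fin N → Euc d => ψ (pointMultiset fun i => s • x i) i :=
      (measurable_pi_apply i).comp (hψ.measurable_smul s N)
    rw [← hmg.map_eq, integral_map hmg.measurable.aemeasurable hmi.aestronglyMeasurable,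
      integral_map hmg.measurable.aemeasurable
        ((hmi.sub_const _).pow_const 2).aestronglyMeasurable] at h1
    have h3 : (N : ℝ≥0∞) * (ENNReal.ofReal (a ^ 2) * D) = ENNReal.ofReal (N * W) := by
      rw [ENNReal.ofReal_mul hN'.le, ENNReal.ofReal_natCast, hW,
        ENNReal.ofReal_toReal (by finiteness)]
    rw [h3, ENNReal.ofReal_le_ofReal_iff (by positivity)] at h1
    have h4 : |(Real.sqrt n)⁻¹ - (Real.sqrt N)⁻¹| * Real.sqrt N ≤ δ₂ := by
      have hsn : 0 < Real.sqrt n := Real.sqrt_pos.2 hn'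
      have hsN : 0 < Real.sqrt N := Real.sqrt_pos.2 hN'
      have hle : Real.sqrt N ≤ Real.sqrt n := Real.sqrt_le_sqrt (by exact_mod_cast hNn)
      have e1 : (Real.sqrt n)⁻¹ ≤ (Real.sqrt N)⁻¹ := inv_anti₀ hsN hle
      rw [abs_of_nonpos (by linarith)]
      have e2 : -((Real.sqrt n)⁻¹ - (Real.sqrt N)⁻¹) * Real.sqrt N =
          (Real.sqrt n - Real.sqrt N) / Real.sqrt n := by field_simp; ring
      rw [e2, div_le_iff₀ hsn]
      have e3 : (n : ℝ) - N ≤ δ₂ * n := hnN.trans (by gcongr; exact min_le_right _ _)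
      have e4 : Real.sqrt n * Real.sqrt n = n := Real.mul_self_sqrt hn'.le
      have e5 : Real.sqrt N * Real.sqrt N = N := Real.mul_self_sqrt hN'.le
      by_contra hcon
      push Not at hcon
      nlinarith
    calc _ ≤ |(Real.sqrt n)⁻¹ - (Real.sqrt N)⁻¹| * Real.sqrt (N * W) := by gcongr
      _ = |(Real.sqrt n)⁻¹ - (Real.sqrt N)⁻¹| * Real.sqrt N * Real.sqrt W := by
        rw [Real.sqrt_mul hN'.le, mul_assoc]
      _ ≤ δ₂ * Real.sqrt W := by gcongr
      _ ≤ δ₂ * (Real.sqrt W + 1) := by gcongr; linarith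
      _ = η := by rw [hδ₂]; field_simp

end

/-! ### Dilations of a density -/

section Dilation

variable {d : ℕ}

theorem lintegral_dilation {h : Euc d → ℝ≥0∞} (hh : Measurable h) {b : ℝ} (hb : 0 < b) :
    ∫⁻ x, ENNReal.ofReal (b ^ d) * h (b • x) = ∫⁻ x, h x := by
  have hm : Measurable fun x : Euc d => b • x := measurable_id.const_smul b
  rw [lintegral_const_mul' _ _ ENNReal.ofReal_ne_top, ← lintegral_map hh hm,
    Measure.map_addHaar_smul _ hb.ne', lintegral_smul_measure, smul_eq_mul, ← mul_assoc,
    ← ENNReal.ofReal_mul (by positivity), finrank_euclideanSpace_fin,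
    abs_of_pos (by positivity), mul_inv_cancel₀ (by positivity), ENNReal.ofReal_one, one_mul]

theorem map_smul_withDensity {f : Euc d → ℝ≥0∞} (hf : Measurable f) {b : ℝ} (hb : 0 < b) :
    (volume.withDensity f).map (fun x => b⁻¹ • x) =
      volume.withDensity fun x => ENNReal.ofReal (b ^ d) * f (b • x) := by
  have hm : Measurable fun x : Euc d => b⁻¹ • x := measurable_id.const_smul b⁻¹
  ext s hs
  rw [Measure.map_apply hm hs, withDensity_apply _ (hm hs), withDensity_apply _ hs,
    ← lintegral_indicator (hm hs), ← lintegral_indicator hs,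
    ← lintegral_dilation (hf.indicator (hm hs)) hb]
  congr 1 with x
  have hx : b⁻¹ • b • x = x := by rw [smul_smul, inv_mul_cancel₀ hb.ne', one_smul]
  by_cases hxs : x ∈ s
  · rw [Set.indicator_of_mem hxs, Set.indicator_of_mem (by simpa [hx] using hxs)]
  · rw [Set.indicator_of_notMem hxs, Set.indicator_of_notMem (by simpa [hx] using hxs), mul_zero]

theorem lintegral_dilation_rpow {f : Euc d → ℝ≥0∞} (hf : Measurable f) {b : ℝ} (hb : 0 < b)
    {τ : ℝ} (hτ : 0 ≤ τ) :
    ∫⁻ x, (ENNReal.ofReal (b ^ d) * f (b • x)) ^ (τ + 1) =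
      ENNReal.ofReal (b ^ d) ^ τ * ∫⁻ x, f x ^ (τ + 1) := by
  rw [← lintegral_dilation (hf.pow_const (τ + 1)) hb, ← lintegral_const_mul' _ _
    (ENNReal.rpow_ne_top_of_nonneg hτ ENNReal.ofReal_ne_top)]
  congr 1 with x
  rw [ENNReal.mul_rpow_of_nonneg _ _ (by linarith), ENNReal.rpow_add_of_nonneg _ _ hτ zero_le_one,
    ENNReal.rpow_one, mul_assoc]

/-- Dominated convergence: for `1/2 < b < 2` all the dilates live in a fixed ball of twice the
radius and are bounded by `2 ^ d * C`. -/
theorem tendsto_lintegral_dilation_sub_of_hasCompactSupport {φ : Euc d → ℝ} (hφ : Continuous φ)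
    (hφc : HasCompactSupport φ) :
    Tendsto (fun b : ℝ => ∫⁻ x, ‖φ x - b ^ d * φ (b • x)‖ₑ) (𝓝 1) (𝓝 0) := by
  obtain ⟨C, hC⟩ := hφc.exists_bound_of_continuous hφ
  obtain ⟨r, hr⟩ := hφc.isCompact.isBounded.subset_closedBall (0 : Euc d)
  have hC0 : 0 ≤ C := (norm_nonneg _).trans (hC 0)
  have hz : ∀ x : Euc d, r < ‖x‖ → φ x = 0 := fun x hx => by
    by_contra hne
    have := hr (subset_tsupport φ hne)
    rw [mem_closedBall_zero_iff] at this
    linarith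
  have hlim := tendsto_lintegral_filter_of_dominated_convergence (μ := (volume : Measure (Euc d)))
    (l := 𝓝 (1 : ℝ)) (F := fun b x => ‖φ x - b ^ d * φ (b • x)‖ₑ) (f := fun _ => 0)
    ((Metric.closedBall (0 : Euc d) (2 * |r|)).indicator
      fun _ => ENNReal.ofReal (C + 2 ^ d * C)) ?_ ?_ ?_ ?_
  · simpa using hlim
  · refine Eventually.of_forall fun b => ?_
    exact (hφ.sub (continuous_const.mul (hφ.comp (continuous_const_smul b)))).measurable.enorm
  · filter_upwards [Ioo_mem_nhds (show (1 / 2 : ℝ) < 1 by norm_num) one_lt_two] with b hb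
    refine ae_of_all _ fun x => ?_
    by_cases hx : x ∈ Metric.closedBall (0 : Euc d) (2 * |r|)
    · rw [Set.indicator_of_mem hx, ← ofReal_norm]
      refine ENNReal.ofReal_le_ofReal ((norm_sub_le _ _).trans (add_le_add (hC x) ?_))
      rw [norm_mul, norm_pow, Real.norm_of_nonneg (by linarith [hb.1])]
      have hb0 : 0 ≤ b := by linarith [hb.1]
      have := hC (b • x)
      gcongr
      exact hb.2.le
    · rw [Set.indicator_of_notMem hx]
      rw [mem_closedBall_zero_iff, not_le] at hx
      have h1 : φ x = 0 := hz x (by linarith [le_abs_self r, abs_nonneg r])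
      have h2 : φ (b • x) = 0 := hz _ (by
        rw [norm_smul, Real.norm_of_nonneg (by linarith [hb.1])]
        nlinarith [le_abs_self r, abs_nonneg r, hb.1, norm_nonneg x])
      simp [h1, h2]
  · rw [lintegral_indicator_const Metric.isClosed_closedBall.measurableSet]
    exact ENNReal.mul_ne_top ENNReal.ofReal_ne_top measure_closedBall_lt_top.ne
  · refine ae_of_all _ fun x => ?_
    have hcont : Continuous fun b : ℝ => ‖φ x - b ^ d * φ (b • x)‖ₑ :=
      (continuous_const.sub ((continuous_pow d).mul
        (hφ.comp (continuous_id.smul continuous_const)))).enorm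
    have := hcont.tendsto 1
    simpa using this

/-- Dilations act continuously on integrable densities. -/
theorem eventually_lintegral_dilation_sub_le {f : Euc d → ℝ} (hfm : Measurable f)
    (hf : Integrable f) {ε : ℝ≥0∞} (hε : ε ≠ 0) :
    ∀ᶠ b : ℝ in 𝓝 1, ∫⁻ x, ‖f x - b ^ d * f (b • x)‖ₑ ≤ ε := by
  have hε3 : ε / 3 ≠ 0 := by simpa using hε
  -- Normalized dilations preserve the `L^1` norm, so the approximation error of the dilated
  -- functions equals that of `f` and `φ`.
  obtain ⟨φ, hφc, hφε, hφ, hφi⟩ := hf.exists_hasCompactSupport_lintegral_sub_le hε3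
  filter_upwards [(tendsto_lintegral_dilation_sub_of_hasCompactSupport hφ hφc).eventually_le_const
    (pos_iff_ne_zero.2 hε3), Ioi_mem_nhds (zero_lt_one' ℝ)] with b hb hb0
  have hb0' : (0 : ℝ) < b := hb0
  have hmfφ : Measurable fun x => ‖f x - φ x‖ₑ := (hfm.sub hφ.measurable).enorm
  have hmφ : Measurable fun x => ‖φ x - b ^ d * φ (b • x)‖ₑ :=
    (hφ.sub (continuous_const.mul (hφ.comp (continuous_const_smul b)))).measurable.enorm
  have hpt : ∀ x, ‖f x - b ^ d * f (b • x)‖ₑ ≤ ‖f x - φ x‖ₑ + ‖φ x - b ^ d * φ (b • x)‖ₑ +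
      ENNReal.ofReal (b ^ d) * ‖f (b • x) - φ (b • x)‖ₑ := by
    intro x
    have h1 : f x - b ^ d * f (b • x) = (f x - φ x) + (φ x - b ^ d * φ (b • x)) +
        -(b ^ d * (f (b • x) - φ (b • x))) := by ring
    have h2 : ‖b ^ d * (f (b • x) - φ (b • x))‖ₑ =
        ENNReal.ofReal (b ^ d) * ‖f (b • x) - φ (b • x)‖ₑ := by
      rw [enorm_mul, Real.enorm_of_nonneg (by positivity)]
    rw [h1, ← h2]
    refine (enorm_add_le _ _).trans ?_
    rw [enorm_neg]
    gcongr
    exact enorm_add_le _ _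
  calc _ ≤ ∫⁻ x, (‖f x - φ x‖ₑ + ‖φ x - b ^ d * φ (b • x)‖ₑ +
        ENNReal.ofReal (b ^ d) * ‖f (b • x) - φ (b • x)‖ₑ) := lintegral_mono hpt
    _ = (∫⁻ x, ‖f x - φ x‖ₑ) + (∫⁻ x, ‖φ x - b ^ d * φ (b • x)‖ₑ) +
        ∫⁻ x, ‖f x - φ x‖ₑ := by
        have hsum : Measurable fun x => ‖f x - φ x‖ₑ + ‖φ x - b ^ d * φ (b • x)‖ₑ := hmfφ.add hmφ
        rw [lintegral_add_left hsum, lintegral_add_left hmfφ,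
          lintegral_dilation (h := fun x => ‖f x - φ x‖ₑ) hmfφ hb0']
    _ ≤ ε / 3 + ε / 3 + ε / 3 := by gcongr
    _ = ε := ENNReal.add_thirds ε

end Dilation

theorem ofReal_sub_ofReal_le_enorm {x y : ℝ} (hy : 0 ≤ y) :
    ENNReal.ofReal x - ENNReal.ofReal y ≤ ‖x - y‖ₑ := by
  rw [← ENNReal.ofReal_sub _ hy]
  exact Real.ofReal_le_enorm _

/-- The standardized laws for samples of almost the same size are close, tested against a bounded
Lipschitz function. -/
theorem exists_integral_standardizedLaw_sub_le {d k : ℕ} {ψ : Multiset (Euc d) → Fin k → ℝ}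
    (hd : 0 < d) (hψ : MeasurableStatistic ψ) {a R : ℝ} {q : ℕ} (hR : 0 ≤ R)
    (hloc : ∀ i, IsLocalStatistic a R q fun S => ψ S i) {F : Measure (Euc d)}
    [IsProbabilityMeasure F] {f : Euc d → ℝ} (hF : HasLebesgueDensity F f) {τ : ℝ}
    (hτ : 2 * (q : ℝ) + 2 < τ) {B : ℝ≥0∞} (hB : B ≠ ∞)
    (hfB : ∫⁻ x, ENNReal.ofReal (f x) ^ (τ + 1) ≤ B) {v : (Fin k → ℝ) → ℝ} {Λ : NNReal}
    (hv : LipschitzWith Λ v) (hvb : ∃ C, ∀ y, |v y| ≤ C) {ε : ℝ} (hε : 0 < ε) :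
    ∃ δ : ℝ, 0 < δ ∧ ∀ n N : ℕ, 0 < N → N ≤ n → (n : ℝ) - N ≤ δ * n →
      |∫ y, v y ∂(standardizedLaw ψ n F) - ∫ y, v y ∂(standardizedLaw ψ N F)| ≤ ε := by
  obtain ⟨hfm, hf0, hFf⟩ := hF
  have hq : (0 : ℝ) ≤ q := by positivity
  have hfm' : Measurable fun x => ENNReal.ofReal (f x) := hfm.ennreal_ofReal
  have hf1 : ∫⁻ x, ENNReal.ofReal (f x) = 1 := by
    rw [← measure_univ (μ := F), hFf, withDensity_apply _ MeasurableSet.univ, Measure.restrict_univ]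
  have hfi : Integrable f := by
    refine ⟨hfm.aestronglyMeasurable, ?_⟩
    rw [hasFiniteIntegral_iff_ofReal (ae_of_all _ hf0), hf1]
    exact ENNReal.one_lt_top
  have h2τ : (2 : ℝ≥0∞) ^ τ ≠ ∞ := ENNReal.rpow_ne_top_of_nonneg (by linarith) ENNReal.ofNat_ne_top
  have h21 : (1 : ℝ≥0∞) ≤ 2 ^ τ := ENNReal.one_le_rpow one_le_two (by linarith)
  -- The comparison density will be a dilate of `f` by `b` with `b ^ d = n / N ≤ 2`, which
  -- multiplies the integral of the `τ + 1` power by at most `2 ^ τ`.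
  obtain ⟨δ₁, hδ₁, hclose⟩ := exists_integral_scaledLaw_sub_le hd hψ hR hloc hfm' hf1 hτ
    (B := 2 ^ τ * B) (by finiteness) (hfB.trans (le_mul_of_one_le_left zero_le h21)) hv hvb hε
  obtain ⟨η, hη, hηb⟩ := Metric.eventually_nhds_iff.1
    (eventually_lintegral_dilation_sub_le hfm hfi (ENNReal.ofReal_pos.2 hδ₁).ne')
  refine ⟨min δ₁ (min (1 / 2) (η / 4)), by positivity, fun n N hN hNn hnN => ?_⟩
  have hn : 0 < n := hN.trans_le hNn
  have hn' : (0 : ℝ) < n := by exact_mod_cast hn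
  have hN' : (0 : ℝ) < N := by exact_mod_cast hN
  have hNn' : (N : ℝ) ≤ n := by exact_mod_cast hNn
  have h1 : (n : ℝ) - N ≤ δ₁ * n := hnN.trans (by gcongr; exact min_le_left _ _)
  have h2 : (n : ℝ) - N ≤ 1 / 2 * n :=
    hnN.trans (by gcongr; exact (min_le_right _ _).trans (min_le_left _ _))
  have h3 : (n : ℝ) - N ≤ η / 4 * n :=
    hnN.trans (by gcongr; exact (min_le_right _ _).trans (min_le_right _ _))
  -- Dividing the points by `b` converts scale `n^{1/d}` into `N^{1/d}`. Thus `N` points of law `F`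
  -- at their own scale are `N` points of density `b ^ d * f (b • x)` at the scale of `n`.
  set b : ℝ := ((n : ℝ) / N) ^ (1 / (d : ℝ)) with hb
  have hb0 : 0 < b := by positivity
  have hd' : (d : ℝ) ≠ 0 := by positivity
  have hbd : b ^ d = n / N := by
    rw [hb, ← Real.rpow_natCast, ← Real.rpow_mul (by positivity), one_div_mul_cancel hd',
      Real.rpow_one]
  have hq1 : 1 ≤ (n : ℝ) / N := by rwa [one_le_div hN']
  have hb1 : 1 ≤ b := Real.one_le_rpow hq1 (by positivity)
  have hble : b ≤ (n : ℝ) / N := by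
    rw [← hbd]; exact le_self_pow₀ hb1 hd.ne'
  have hq2 : (n : ℝ) / N ≤ 2 := by rw [div_le_iff₀ hN']; linarith
  have hq3 : (n : ℝ) / N - 1 < η := by
    rw [div_sub_one hN'.ne', div_lt_iff₀ hN']
    nlinarith
  have hbη := hηb (y := b) (by rw [Real.dist_eq, abs_of_nonneg (by linarith)]; linarith)
  set g : Euc d → ℝ≥0∞ := fun x => ENNReal.ofReal (b ^ d) * ENNReal.ofReal (f (b • x)) with hg
  have hgm : Measurable g := (hfm'.comp (measurable_id.const_smul b)).const_mul _
  have key := hclose n N hN hNn h1 g hgm ((lintegral_dilation hfm' hb0).trans hf1) ?_ ?_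
  · have hscale : (n : ℝ) ^ (1 / (d : ℝ)) * b⁻¹ = (N : ℝ) ^ (1 / (d : ℝ)) := by
      rw [hb, Real.div_rpow hn'.le hN'.le, inv_div, mul_div_cancel₀]
      positivity
    rwa [hg, ← map_smul_withDensity hfm' hb0, ← hFf, scaledLaw_map_smul hψ, hscale,
      ← standardizedLaw_eq_scaledLaw, ← standardizedLaw_eq_scaledLaw] at key
  · rw [hg, lintegral_dilation_rpow hfm' hb0 (by linarith), hbd]
    have h2' : ENNReal.ofReal ((n : ℝ) / N) ≤ 2 := by simpa using ENNReal.ofReal_le_ofReal hq2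
    gcongr
    linarith
  · refine (lintegral_mono fun x => ?_).trans hbη
    simp only [hg]
    rw [← ENNReal.ofReal_mul (by positivity)]
    exact ofReal_sub_ofReal_le_enorm (mul_nonneg (by positivity) (hf0 _))

/-! ### Uniform integrability of densities -/

/-- Densities near `f` in `L^p`, `p > 2 q + 3`, are bounded in a common `L^{τ+1}`, `τ > 2 q + 2`. -/
theorem exists_lintegral_rpow_le {d : ℕ} (q : ℕ) {p : ℝ≥0∞} (hp : 2 * (q : ℝ≥0∞) + 3 < p)
    {f : Euc d → ℝ} (hfm : Measurable f) (hf : eLpNorm f p volume < ∞) :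
    ∃ τ : ℝ, 2 * (q : ℝ) + 2 < τ ∧ ∃ B : ℝ≥0∞, B ≠ ∞ ∧
      ∀ (Q : Measure (Euc d)) [IsProbabilityMeasure Q] (g : Euc d → ℝ), HasLebesgueDensity Q g →
        eLpNorm (g - f) p volume ≤ 1 → ∫⁻ x, ENNReal.ofReal (g x) ^ (τ + 1) ≤ B := by
  have hq : (0 : ℝ) ≤ q := by positivity
  have hp1 : 1 ≤ p := le_trans (le_add_left (by norm_num)) hp.le
  set A := 1 + eLpNorm f p volume with hA
  have hAt : A ≠ ∞ := by finiteness
  have hgA : ∀ g : Euc d → ℝ, Measurable g → eLpNorm (g - f) p volume ≤ 1 →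
      eLpNorm g p volume ≤ A := by
    intro g hg h
    have h1 := eLpNorm_add_le (μ := volume) (hg.sub hfm).aestronglyMeasurable
      hfm.aestronglyMeasurable hp1
    rw [sub_add_cancel] at h1
    exact h1.trans (add_le_add h le_rfl)
  -- For `p = ∞` any admissible `τ` works, since a bounded density satisfies `g ^ (τ + 1) ≤ A ^ τ *
  -- g`. For finite `p` the choice is `τ = p - 1`.
  by_cases hpt : p = ∞
  · refine ⟨2 * q + 3, by linarith, A ^ (2 * (q : ℝ) + 3), by finiteness, ?_⟩
    intro Q _ g ⟨hgm, hg0, hQ⟩ hgf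
    have hg := hgA g hgm hgf
    rw [hpt, eLpNorm_exponent_top] at hg
    have hg1 : ∫⁻ x, ENNReal.ofReal (g x) = 1 := by
      rw [← measure_univ (μ := Q), hQ, withDensity_apply _ MeasurableSet.univ,
        Measure.restrict_univ]
    calc ∫⁻ x, ENNReal.ofReal (g x) ^ (2 * (q : ℝ) + 3 + 1)
        ≤ ∫⁻ x, A ^ (2 * (q : ℝ) + 3) * ENNReal.ofReal (g x) := by
          refine lintegral_mono_ae ?_
          filter_upwards [ae_le_eLpNormEssSup (f := g) (μ := volume)] with x hx
          rw [Real.enorm_of_nonneg (hg0 x)] at hx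
          rw [ENNReal.rpow_add_of_nonneg _ _ (by linarith) zero_le_one, ENNReal.rpow_one]
          gcongr
          exact hx.trans hg
      _ = A ^ (2 * (q : ℝ) + 3) := by
          rw [lintegral_const_mul _ hgm.ennreal_ofReal, hg1, mul_one]
  · have hp0 : p ≠ 0 := (zero_lt_one.trans_le hp1).ne'
    have hpr : 2 * (q : ℝ) + 3 < p.toReal := by
      have h1 := (ENNReal.toReal_lt_toReal (by finiteness) hpt).2 hp
      rwa [ENNReal.toReal_add (by finiteness) (by finiteness), ENNReal.toReal_mul,
        ENNReal.toReal_ofNat, ENNReal.toReal_natCast, ENNReal.toReal_ofNat] at h1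
    refine ⟨p.toReal - 1, by linarith, A ^ p.toReal,
      ENNReal.rpow_ne_top_of_nonneg (by linarith) hAt, ?_⟩
    intro Q _ g ⟨hgm, hg0, hQ⟩ hgf
    have hg := hgA g hgm hgf
    rw [eLpNorm_eq_lintegral_rpow_enorm_toReal hp0 hpt] at hg
    have h2 := ENNReal.rpow_le_rpow hg (show 0 ≤ p.toReal by linarith)
    rw [← ENNReal.rpow_mul, one_div_mul_cancel (by linarith), ENNReal.rpow_one] at h2
    simpa only [sub_add_cancel, Real.enorm_of_nonneg (hg0 _)] using h2

/-! ### Modes of convergence -/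

section Modes

variable {k : ℕ}

theorem weakConv_of_lipschitz {L : ℕ → Measure (Fin k → ℝ)} [∀ n, IsProbabilityMeasure (L n)]
    {G : Measure (Fin k → ℝ)} [IsProbabilityMeasure G]
    (h : ∀ (v : (Fin k → ℝ) → ℝ) (Λ : NNReal), LipschitzWith Λ v → (∃ C, ∀ y, |v y| ≤ C) →
      Tendsto (fun n => ∫ y, v y ∂(L n)) atTop (𝓝 (∫ y, v y ∂G))) : WeakConv L G := by
  set μs : ℕ → ProbabilityMeasure (Fin k → ℝ) := fun n => ⟨L n, inferInstance⟩
  set μ : ProbabilityMeasure (Fin k → ℝ) := ⟨G, inferInstance⟩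
  have h1 : Tendsto μs atTop (𝓝 μ) := by
    refine tendsto_iff_forall_lipschitz_integral_tendsto.2 fun v hvb hv => ?_
    obtain ⟨C, hC⟩ := hvb
    obtain ⟨Λ, hΛ⟩ := hv
    refine h v Λ hΛ ⟨|v 0| + C, fun y => ?_⟩
    have h1 := hC y 0
    rw [Real.dist_eq] at h1
    have h2 := abs_add_le (v y - v 0) (v 0)
    rw [sub_add_cancel] at h2
    linarith
  exact ProbabilityMeasure.tendsto_iff_forall_integral_tendsto.1 h1

theorem WeakConv.tendsto_lipschitz {L : ℕ → Measure (Fin k → ℝ)} {G : Measure (Fin k → ℝ)}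
    (h : WeakConv L G) {v : (Fin k → ℝ) → ℝ} {Λ : NNReal} (hv : LipschitzWith Λ v)
    (hvb : ∃ C, ∀ y, |v y| ≤ C) :
    Tendsto (fun n => ∫ y, v y ∂(L n)) atTop (𝓝 (∫ y, v y ∂G)) := by
  obtain ⟨C, hC⟩ := hvb
  exact h (BoundedContinuousFunction.ofNormedAddCommGroup v hv.continuous C hC)

variable {Ω : Type*}

/-- The random laws `Lhat n ω` are asymptotically close to the laws `L n` when `N₁ n ω` and `N₂ n ω`
are small, tested against bounded Lipschitz functions. -/
def LipschitzClose (L : ℕ → Measure (Fin k → ℝ)) (Lhat : ℕ → Ω → Measure (Fin k → ℝ))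
    (N₁ N₂ : ℕ → Ω → ℝ≥0∞) : Prop :=
  ∀ (v : (Fin k → ℝ) → ℝ) (Λ : NNReal), LipschitzWith Λ v → (∃ C, ∀ y, |v y| ≤ C) →
    ∀ ε : ℝ, 0 < ε → ∃ δ : ℝ≥0∞, 0 < δ ∧ ∀ᶠ n in atTop, ∀ ω, N₁ n ω < δ → N₂ n ω < δ →
      |∫ y, v y ∂(L n) - ∫ y, v y ∂(Lhat n ω)| ≤ ε

variable {L : ℕ → Measure (Fin k → ℝ)} {Lhat : ℕ → Ω → Measure (Fin k → ℝ)}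
  {N₁ N₂ : ℕ → Ω → ℝ≥0∞} {G : Measure (Fin k → ℝ)} [IsProbabilityMeasure G]

/-- The sample point may vary along the sequence; a constant one gives the almost sure version, a
varying one the version in probability. -/
theorem LipschitzClose.weakConv_of_tendsto [∀ n ω, IsProbabilityMeasure (Lhat n ω)]
    (h : LipschitzClose L Lhat N₁ N₂) (hL : WeakConv L G)
    {φ : ℕ → ℕ} (hφ : Tendsto φ atTop atTop) {ω : ℕ → Ω}
    (h₁ : Tendsto (fun j => N₁ (φ j) (ω j)) atTop (𝓝 0))
    (h₂ : Tendsto (fun j => N₂ (φ j) (ω j)) atTop (𝓝 0)) :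
    WeakConv (fun j => Lhat (φ j) (ω j)) G := by
  refine weakConv_of_lipschitz fun v Λ hv hvb => ?_
  have hlim := (hL.tendsto_lipschitz hv hvb).comp hφ
  rw [Metric.tendsto_nhds] at hlim ⊢
  intro ε hε
  obtain ⟨δ, hδ, hclose⟩ := h v Λ hv hvb (ε / 2) (half_pos hε)
  filter_upwards [hlim (ε / 2) (half_pos hε), hφ.eventually hclose,
    h₁.eventually_lt_const hδ, h₂.eventually_lt_const hδ] with j hj1 hj2 hj3 hj4
  have h5 := hj2 (ω j) hj3 hj4
  rw [← Real.dist_eq, dist_comm] at h5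
  calc _ ≤ _ := dist_triangle _ (∫ y, v y ∂(L (φ j))) _
    _ < ε := by simp only [Function.comp_apply] at hj1; linarith

variable [MeasurableSpace Ω] {P : Measure Ω}

theorem LipschitzClose.weakConvAS [∀ n ω, IsProbabilityMeasure (Lhat n ω)]
    (h : LipschitzClose L Lhat N₁ N₂) (hL : WeakConv L G) (h₁ : ZeroAS P N₁) (h₂ : ZeroAS P N₂) :
    WeakConvAS P Lhat G := by
  filter_upwards [h₁, h₂] with ω hω₁ hω₂
  exact h.weakConv_of_tendsto hL tendsto_id (ω := fun _ => ω) hω₁ hω₂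

theorem LipschitzClose.weakConv_of_weakConvAS [IsProbabilityMeasure P]
    [∀ n, IsProbabilityMeasure (L n)] (h : LipschitzClose L Lhat N₁ N₂)
    (hL : WeakConvAS P Lhat G) (h₁ : ZeroAS P N₁) (h₂ : ZeroAS P N₂) : WeakConv L G := by
  obtain ⟨ω, hω, hω₁, hω₂⟩ := (hL.and (h₁.and h₂)).exists
  refine weakConv_of_lipschitz fun v Λ hv hvb => ?_
  have hlim := hω.tendsto_lipschitz hv hvb
  rw [Metric.tendsto_nhds] at hlim ⊢
  intro ε hε
  obtain ⟨δ, hδ, hclose⟩ := h v Λ hv hvb (ε / 2) (half_pos hε)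
  filter_upwards [hlim (ε / 2) (half_pos hε), hclose,
    hω₁.eventually_lt_const hδ, hω₂.eventually_lt_const hδ] with n h1 h2 h3 h4
  have h5 := h2 ω h3 h4
  rw [← Real.dist_eq] at h5
  calc _ ≤ _ := dist_triangle _ (∫ y, v y ∂(Lhat n ω)) _
    _ < ε := by linarith

theorem LipschitzClose.weakConvInProb [∀ n ω, IsProbabilityMeasure (Lhat n ω)]
    (h : LipschitzClose L Lhat N₁ N₂) (hL : WeakConv L G) (h₁ : ZeroInProb P N₁)
    (h₂ : ZeroInProb P N₂) : WeakConvInProb P Lhat G := by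
  intro v ε hε
  -- Closeness is assumed for Lipschitz test functions only, while `v` is merely continuous. If the
  -- claim failed, bad points `ω j` with both norms below `1 / (j + 1)` would form a sequence of
  -- laws that converges weakly to `G` and yet stays away from it at `v`.
  have key : ∃ δ : ℝ≥0∞, 0 < δ ∧ ∀ᶠ n in atTop, ∀ ω, N₁ n ω < δ → N₂ n ω < δ →
      edist (∫ y, v y ∂(Lhat n ω)) (∫ y, v y ∂G) < ε := by
    by_contra hcon
    push Not at hcon
    have hj : ∀ j : ℕ, ∃ n ≥ j, ∃ ω, N₁ n ω < ((j : ℝ≥0∞) + 1)⁻¹ ∧ N₂ n ω < ((j : ℝ≥0∞) + 1)⁻¹ ∧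
        ε ≤ edist (∫ y, v y ∂(Lhat n ω)) (∫ y, v y ∂G) := fun j => by
      obtain ⟨n, hn, hn'⟩ := (frequently_atTop.1
        (hcon ((j : ℝ≥0∞) + 1)⁻¹ (ENNReal.inv_pos.2 (by finiteness)))) j
      exact ⟨n, hn, hn'⟩
    choose φ hφ ω hω₁ hω₂ hω using hj
    have hinv : Tendsto (fun j : ℕ => ((j : ℝ≥0∞) + 1)⁻¹) atTop (𝓝 0) := by
      have := (tendsto_add_atTop_iff_nat 1).2 ENNReal.tendsto_inv_nat_nhds_zero
      simpa using this
    have hφt : Tendsto φ atTop atTop := tendsto_atTop_mono hφ tendsto_id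
    have hw := h.weakConv_of_tendsto hL hφt
      (tendsto_of_tendsto_of_tendsto_of_le_of_le tendsto_const_nhds hinv (fun _ => zero_le)
        fun j => (hω₁ j).le)
      (tendsto_of_tendsto_of_tendsto_of_le_of_le tendsto_const_nhds hinv (fun _ => zero_le)
        fun j => (hω₂ j).le)
    obtain ⟨j, hj⟩ := ((EMetric.tendsto_nhds.1 (hw v)) ε hε).exists
    exact absurd (hω j) (not_le.2 hj)
  obtain ⟨δ, hδ, hev⟩ := key
  have hsum := (h₁ δ hδ).add (h₂ δ hδ)
  rw [add_zero] at hsum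
  refine tendsto_of_tendsto_of_tendsto_of_le_of_le' tendsto_const_nhds hsum
    (Eventually.of_forall fun _ => zero_le) ?_
  filter_upwards [hev] with n hn
  refine (measure_mono fun ω hω => ?_).trans (measure_union_le {ω | δ ≤ N₁ n ω} {ω | δ ≤ N₂ n ω})
  by_contra hnot
  rw [Set.mem_union, not_or] at hnot
  exact absurd hω (not_le.2 (hn ω (not_le.1 hnot.1) (not_le.1 hnot.2)))

/-- The laws `L n` are not random, so one good `ω` for each large `n` is enough. It exists once the
three bad events have total probability below one. -/
theorem LipschitzClose.weakConv_of_weakConvInProb [IsProbabilityMeasure P]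
    [∀ n, IsProbabilityMeasure (L n)] (h : LipschitzClose L Lhat N₁ N₂)
    (hL : WeakConvInProb P Lhat G) (h₁ : ZeroInProb P N₁) (h₂ : ZeroInProb P N₂) :
    WeakConv L G := by
  refine weakConv_of_lipschitz fun v Λ hv hvb => ?_
  obtain ⟨C, hC⟩ := hvb
  have hlim := hL (BoundedContinuousFunction.ofNormedAddCommGroup v hv.continuous C hC)
  rw [tendstoInMeasure_iff_dist] at hlim
  rw [Metric.tendsto_nhds]
  intro ε hε
  obtain ⟨δ, hδ, hclose⟩ := h v Λ hv ⟨C, hC⟩ (ε / 2) (half_pos hε)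
  have hsum := ((hlim (ε / 2) (half_pos hε)).add (h₁ δ hδ)).add (h₂ δ hδ)
  simp only [add_zero] at hsum
  filter_upwards [hclose, hsum.eventually_lt_const zero_lt_one] with n hn1 hn2
  have hex : ∃ ω, ¬ (ε / 2 ≤ dist (∫ y, v y ∂(Lhat n ω)) (∫ y, v y ∂G)) ∧
      ¬ δ ≤ N₁ n ω ∧ ¬ δ ≤ N₂ n ω := by
    by_contra hcon
    push Not at hcon
    have huniv : (Set.univ : Set Ω) ⊆
        {ω | ε / 2 ≤ dist (∫ y, v y ∂(Lhat n ω)) (∫ y, v y ∂G)} ∪ {ω | δ ≤ N₁ n ω} ∪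
          {ω | δ ≤ N₂ n ω} := by
      intro ω _
      by_cases h1 : ε / 2 ≤ dist (∫ y, v y ∂(Lhat n ω)) (∫ y, v y ∂G)
      · exact Or.inl (Or.inl h1)
      by_cases h2 : δ ≤ N₁ n ω
      · exact Or.inl (Or.inr h2)
      exact Or.inr (hcon ω (not_le.1 h1) (not_le.1 h2))
    have h3 := measure_mono (μ := P) huniv
    rw [measure_univ] at h3
    refine absurd (h3.trans ((measure_union_le _ _).trans
      (add_le_add_left (measure_union_le _ _) _))) (not_le.2 hn2)
  obtain ⟨ω, h1, h2, h3⟩ := hex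
  have h5 := hn1 ω (not_le.1 h2) (not_le.1 h3)
  rw [← Real.dist_eq] at h5
  calc _ ≤ _ := dist_triangle _ (∫ y, v y ∂(Lhat n ω)) _
    _ < ε := by linarith [not_le.1 h1]

theorem weakConv_of_noAsymptoticGaps [∀ n, IsProbabilityMeasure (L n)] {m : ℕ → ℕ} (hm : NoAsymptoticGaps m)
    (hclose : ∀ (v : (Fin k → ℝ) → ℝ) (Λ : NNReal), LipschitzWith Λ v → (∃ C, ∀ y, |v y| ≤ C) →
      ∀ ε : ℝ, 0 < ε → ∃ δ : ℝ, 0 < δ ∧ ∀ n N : ℕ, 0 < N → N ≤ n → (n : ℝ) - N ≤ δ * n →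
        |∫ y, v y ∂(L n) - ∫ y, v y ∂(L N)| ≤ ε)
    (hL : WeakConv (fun n => L (m n)) G) : WeakConv L G := by
  refine weakConv_of_lipschitz fun v Λ hv hvb => ?_
  have hlim := hL.tendsto_lipschitz hv hvb
  rw [Metric.tendsto_nhds] at hlim ⊢
  intro ε hε
  obtain ⟨δ, hδ, hδL⟩ := hclose v Λ hv hvb (ε / 2) (half_pos hε)
  obtain ⟨n₀, hn₀⟩ := eventually_atTop.1 (hlim (ε / 2) (half_pos hε))
  -- The bound `1/2` gives `N ≤ 2 * m n`. Since `N` exceeds twice the sum of the first `n₀` values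
  -- of `m`, the index `n` found is at least `n₀`.
  filter_upwards [hm (min δ (1 / 2)) (by positivity),
    eventually_gt_atTop (2 * ∑ n ∈ Finset.range n₀, m n)] with N hN hNlarge
  obtain ⟨n, hn⟩ := hN
  have hN0 : 0 < N := by omega
  have hN0' : (0 : ℝ) < N := by exact_mod_cast hN0
  have h1 : |(m n : ℝ) - N| ≤ δ * N := hn.trans (by gcongr; exact min_le_left _ _)
  have h2 : |(m n : ℝ) - N| ≤ 1 / 2 * N := hn.trans (by gcongr; exact min_le_right _ _)
  rw [abs_le] at h1 h2
  have hmN : (N : ℝ) ≤ 2 * m n := by linarith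
  have hnn₀ : n₀ ≤ n := by
    by_contra hlt
    have h3 : m n ≤ ∑ n ∈ Finset.range n₀, m n :=
      Finset.single_le_sum (f := m) (fun _ _ => Nat.zero_le _) (Finset.mem_range.2 (not_le.1 hlt))
    have h4 : N ≤ 2 * m n := by exact_mod_cast hmN
    omega
  have h5 := hn₀ n hnn₀
  have h6 : dist (∫ y, v y ∂(L N)) (∫ y, v y ∂(L (m n))) ≤ ε / 2 := by
    rw [Real.dist_eq]
    rcases le_total (m n) N with hle | hle
    · exact hδL N (m n) (by exact_mod_cast (by linarith : (0 : ℝ) < m n)) hle (by linarith)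
    · rw [abs_sub_comm]
      have : (N : ℝ) ≤ m n := by exact_mod_cast hle
      exact hδL (m n) N hN0 hle (by nlinarith)
  calc _ ≤ _ := dist_triangle _ (∫ y, v y ∂(L (m n))) _
    _ < ε := by linarith

end Modes

/-! ### The bootstrap for truncated Euler characteristics -/

/-- The components of the vector of truncated Euler characteristics are local statistics with a
common range. -/
theorem ComplexFiltration.IsLocalBall.exists_isLocalStatistic {d : ℕ} {K : ComplexFiltration d}
    (hK : K.IsLocalBall) (q : ℕ) {k : ℕ} (r : Fin k → ℝ) :
    ∃ R : ℝ, 0 ≤ R ∧ ∀ i, IsLocalStatistic (q + 1) R q fun S => K.eulerVector q r S i := by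
  choose φ hφ using fun i => hK (r i)
  -- One range for all levels; absolute values because the radii may be negative.
  refine ⟨∑ i, 2 * |φ i|, by positivity, fun i => ?_⟩
  have h1 : 2 * |φ i| ≤ ∑ i, 2 * |φ i| :=
    Finset.single_le_sum (f := fun i => 2 * |φ i|) (fun j _ => by positivity) (Finset.mem_univ i)
  have h2 := le_abs_self (φ i)
  have h3 := abs_nonneg (φ i)
  exact K.isLocalStatistic q (r i) (φ i) _ (by linarith) (by linarith) (hφ i)

/-- If the estimated densities are close to `f` in `L^1` and in `L^p`, then the bootstrap laws are
close to the standardized laws under `F`. -/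
theorem lipschitzClose_standardizedLaw {d k : ℕ} {ψ : Multiset (Euc d) → Fin k → ℝ}
    (hd : 0 < d) (hψ : MeasurableStatistic ψ) {a R : ℝ} {q : ℕ} (hR : 0 ≤ R)
    (hloc : ∀ i, IsLocalStatistic a R q fun S => ψ S i) {F : Measure (Euc d)}
    [IsProbabilityMeasure F] {f : Euc d → ℝ} (hF : HasLebesgueDensity F f)
    {p : ℝ≥0∞} (hp : 2 * (q : ℝ≥0∞) + 3 < p) (hf : eLpNorm f p volume < ∞)
    {Ω : Type*} {Q : ℕ → Ω → Measure (Euc d)} [∀ n ω, IsProbabilityMeasure (Q n ω)]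
    {g : ℕ → Ω → Euc d → ℝ} (hQ : ∀ n ω, HasLebesgueDensity (Q n ω) (g n ω))
    {m : ℕ → ℕ} (hm : Tendsto m atTop atTop) :
    LipschitzClose (fun n => standardizedLaw ψ (m n) F)
      (fun n ω => standardizedLaw ψ (m n) (Q n ω))
      (fun n ω => eLpNorm (g n ω - f) 1 volume) fun n ω => eLpNorm (g n ω - f) p volume := by
  intro v Λ hv hvb ε hε
  obtain ⟨τ, hτ, B, hB, hbound⟩ := exists_lintegral_rpow_le q hp hF.1 hf
  have hmass : ∀ (μ : Measure (Euc d)) [IsProbabilityMeasure μ] (h : Euc d → ℝ),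
      HasLebesgueDensity μ h → ∫⁻ x, ENNReal.ofReal (h x) = 1 := by
    intro μ _ h ⟨_, _, hμ⟩
    rw [← measure_univ (μ := μ), hμ, withDensity_apply _ MeasurableSet.univ, Measure.restrict_univ]
  have hfB := hbound F f hF (by simp)
  obtain ⟨δ, hδ, hclose⟩ := exists_integral_scaledLaw_sub_le hd hψ hR hloc hF.1.ennreal_ofReal
    (hmass F f hF) hτ hB hfB hv hvb hε
  -- The `L^p` distance only has to be at most `1`, for a common bound on the `τ + 1` power; the
  -- quantitative closeness comes from `L^1`.
  refine ⟨min (ENNReal.ofReal δ) 1, lt_min (ENNReal.ofReal_pos.2 hδ) zero_lt_one, ?_⟩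
  filter_upwards [hm.eventually_gt_atTop 0] with n hn ω h1 hp1
  have hg := hQ n ω
  have key := hclose (m n) (m n) hn le_rfl (by rw [sub_self]; positivity)
    (fun x => ENNReal.ofReal (g n ω x)) hg.1.ennreal_ofReal (hmass _ _ hg)
    (hbound (Q n ω) (g n ω) hg (hp1.le.trans (min_le_right _ _))) ?_
  · rwa [← hF.2.2, ← hg.2.2, ← standardizedLaw_eq_scaledLaw, ← standardizedLaw_eq_scaledLaw] at key
  · refine le_trans ?_ (h1.le.trans (min_le_left _ _))
    rw [eLpNorm_one_eq_lintegral_enorm]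
    refine lintegral_mono fun x => ?_
    rw [Pi.sub_apply, ← enorm_neg, neg_sub]
    exact ofReal_sub_ofReal_le_enorm (hg.2.1 x)

/-- Here `X 0, X 1, …` are iid with law `F`, the estimate `Fhat n` (a law with density `fhat n`) is
evaluated at the sample of the first `n` of them, and `standardizedLaw ψ (m n) (Fhat n sample)` is
the conditional law, given this sample, of the centred and scaled statistic of `m n` bootstrap points
that are conditionally iid with law `Fhat n sample`. -/
theorem corollaryA8 {d : ℕ} (hd : 0 < d) (q : ℕ) {p : ℝ≥0∞} (hp : 2 * (q : ℝ≥0∞) + 3 < p)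
    (K : ComplexFiltration d) (hK : K.IsLocalBall)
    {k : ℕ} (r : Fin k → ℝ) (hψ : MeasurableStatistic (K.eulerVector q r))
    (F : Measure (Euc d)) [IsProbabilityMeasure F] (f : Euc d → ℝ)
    (hF : HasLebesgueDensity F f) (hf : eLpNorm f p volume < ∞)
    {Ω : Type*} [MeasurableSpace Ω] (P : Measure Ω) [IsProbabilityMeasure P]
    (X : ℕ → Ω → Euc d) (hX : ∀ i, Measurable (X i)) (hXF : ∀ i, P.map (X i) = F)
    (hXind : iIndepFun X P)
    (Fhat : ∀ n : ℕ, Kernel (Fin n → Euc d) (Euc d)) [∀ n, IsMarkovKernel (Fhat n)]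
    (fhat : ∀ n : ℕ, (Fin n → Euc d) → Euc d → ℝ)
    (hFhat : ∀ n x, HasLebesgueDensity (Fhat n x) (fhat n x))
    (m : ℕ → ℕ) (hm : Tendsto m atTop atTop)
    (G : Measure (Fin k → ℝ)) [IsProbabilityMeasure G] :
    -- the version "in probability"
    (ZeroInProb P (fun n ω => eLpNorm (fhat n (fun i : Fin n => X i ω) - f) 1 volume) →
      ZeroInProb P (fun n ω => eLpNorm (fhat n (fun i : Fin n => X i ω) - f) p volume) →
        (WeakConv (fun n => standardizedLaw (K.eulerVector q r) n F) G →
          WeakConvInProb P (fun n ω => standardizedLaw (K.eulerVector q r) (m n)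
            (Fhat n (fun i : Fin n => X i ω))) G) ∧
        (NoAsymptoticGaps m →
          WeakConvInProb P (fun n ω => standardizedLaw (K.eulerVector q r) (m n)
            (Fhat n (fun i : Fin n => X i ω))) G →
          WeakConv (fun n => standardizedLaw (K.eulerVector q r) n F) G) ∧
        (WeakConv (fun n => standardizedLaw (K.eulerVector q r) (m n) F) G ↔
          WeakConvInProb P (fun n ω => standardizedLaw (K.eulerVector q r) (m n)
            (Fhat n (fun i : Fin n => X i ω))) G)) ∧
    -- the version "almost surely"
    (ZeroAS P (fun n ω => eLpNorm (fhat n (fun i : Fin n => X i ω) - f) 1 volume) →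
      ZeroAS P (fun n ω => eLpNorm (fhat n (fun i : Fin n => X i ω) - f) p volume) →
        (WeakConv (fun n => standardizedLaw (K.eulerVector q r) n F) G →
          WeakConvAS P (fun n ω => standardizedLaw (K.eulerVector q r) (m n)
            (Fhat n (fun i : Fin n => X i ω))) G) ∧
        (NoAsymptoticGaps m →
          WeakConvAS P (fun n ω => standardizedLaw (K.eulerVector q r) (m n)
            (Fhat n (fun i : Fin n => X i ω))) G →
          WeakConv (fun n => standardizedLaw (K.eulerVector q r) n F) G) ∧
        (WeakConv (fun n => standardizedLaw (K.eulerVector q r) (m n) F) G ↔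
          WeakConvAS P (fun n ω => standardizedLaw (K.eulerVector q r) (m n)
            (Fhat n (fun i : Fin n => X i ω))) G)) := by
  obtain ⟨R, hR, hloc⟩ := hK.exists_isLocalStatistic q r
  set ψ := K.eulerVector q r with hψdef
  have hQ : ∀ n ω, HasLebesgueDensity (Fhat n (fun i : Fin n => X i ω))
      (fhat n (fun i : Fin n => X i ω)) := fun n ω => hFhat n _
  have hL : ∀ n, IsProbabilityMeasure (standardizedLaw ψ n F) := fun n =>
    isProbabilityMeasure_standardizedLaw hψ n F
  have hLhat : ∀ n ω, IsProbabilityMeasure (standardizedLaw ψ (m n)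
      (Fhat n (fun i : Fin n => X i ω))) := fun n ω =>
    isProbabilityMeasure_standardizedLaw hψ (m n) _
  have hLm : ∀ n, IsProbabilityMeasure (standardizedLaw ψ (m n) F) := fun n => hL (m n)
  -- This links (A_m) to (B). `hsub` and `hgap` then link (A_m) to (A) and concern `F` alone.
  have hclose := lipschitzClose_standardizedLaw hd hψ hR hloc hF hp hf
    (Q := fun n ω => Fhat n (fun i : Fin n => X i ω)) hQ hm
  have hsub : WeakConv (fun n => standardizedLaw ψ n F) G →
      WeakConv (fun n => standardizedLaw ψ (m n) F) G := fun h v => (h v).comp hm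
  have hgap : NoAsymptoticGaps m → WeakConv (fun n => standardizedLaw ψ (m n) F) G →
      WeakConv (fun n => standardizedLaw ψ n F) G := by
    intro hgaps
    refine weakConv_of_noAsymptoticGaps (L := fun n => standardizedLaw ψ n F) hgaps
      fun v Λ hv hvb ε hε => ?_
    obtain ⟨τ, hτ, B, hB, hbound⟩ := exists_lintegral_rpow_le q hp hF.1 hf
    exact exists_integral_standardizedLaw_sub_le hd hψ hR hloc hF hτ hB
      (hbound F f hF (by simp)) hv hvb hε
  refine ⟨fun h1 h2 => ?_, fun h1 h2 => ?_⟩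
  · have hto := fun h => hclose.weakConvInProb (G := G) h h1 h2
    have hfrom := fun h => hclose.weakConv_of_weakConvInProb (G := G) h h1 h2
    exact ⟨fun h => hto (hsub h), fun hg h => hgap hg (hfrom h), hto, hfrom⟩
  · have hto := fun h => hclose.weakConvAS (G := G) h h1 h2
    have hfrom := fun h => hclose.weakConv_of_weakConvAS (G := G) h h1 h2
    exact ⟨fun h => hto (hsub h), fun hg h => hgap hg (hfrom h), hto, hfrom⟩
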